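/- **Setting.** Let $V=\mathbb C^N$. For $X\in\mathrm{End}(V^{\otimes 2})$ let $X_m$ be the operator on $V^{\otimes n}$ acting as $X$ in the factors $m,m+1$ and as the identity elsewhere. An *R-matrix* is an invertible $R\in\mathrm{End}(V^{\otimes 2})$ with $R_1R_2R_1=R_2R_1R_2$; it gives representations $\rho_R:\sigma_i\mapsto R_i$ of the braid groups $\mathcal B_n$ on $V^{\otimes n}$. $X$ is *skew invertible* if there is $\Psi_X$ with $\mathrm{tr}_{(2)}X_{12}(\Psi_X)_{23}=\mathrm{tr}_{(2)}(\Psi_X)_{12}X_{23}=P_{13}$ ($P$ the permutation); put $C_X=\mathrm{tr}_{(1)}\Psi_X$, $D_X=\mathrm{tr}_{(2)}\Psi_X$; $X$ is *strict* skew invertible if moreover $C_X$ or $D_X$ is invertible. A pair $\{R,F\}$ is *compatible* if $R_1F_2F_1=F_2F_1R_2$ and $R_2F_1F_2=F_1F_2R_1$. Let $q\in\mathbb C\setminus\{0,\pm1\}$, $\mu\in\mathbb C\setminus\{0,q,-q^{-1}\}$ and $\eta=\frac{(q-\mu)(q^{-1}+\mu)}{\mu(q-q^{-1})}$. The *BMW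 algebra* $\mathcal W_n(q,\mu)$ is the quotient of $\mathbb C\mathcal B_n$ by the relations $\sigma_i\kappa_i=\kappa_i\sigma_i=\mu\kappa_i$ and $\kappa_i\sigma_{i+1}^{\pm1}\kappa_i=\mu^{\mp1}\kappa_i$, where $\kappa_i=\frac{(q-\sigma_i)(q^{-1}+\sigma_i)}{\mu(q-q^{-1})}$. An R-matrix $R$ is *of BMW type* (with parameters $q,\mu$) if its minimal polynomial is $(x-q)(x+q^{-1})(x-\mu)$ and $K=\mu^{-1}(q-q^{-1})^{-1}(q-R)(q^{-1}+R)$ satisfies $K_2K_1=R_1^{\pm1}R_2^{\pm1}K_1$ (equal signs) and $K_1K_2K_1=K_1$; then $\rho_R$ factors through $\mathcal W_n(q,\mu)$. Let $\{R,F\}$ be a compatible pair of strict skew invertible R-matrices, $R$ being of BMW type. The *quantum matrix algebra* $\mathcal M(R,F)$ is the unital associative $\mathbb C$-algebra generated by the entries of an $N\times N$ matrix $M$ subject to $R_1M_{\overline1}M_{\overline2}=M_{\overline1}M_{\overline2}R_1$, where $M_{\overline1}=M_1$, $M_{\overline{i+1}}=F_iM_{\overline i}F_i^{-1}$. For $\alpha\in\mathcal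 B_n$ or $\alpha\in\mathcal W_n(q,\mu)$, $n\ge1$, put $ch(\alpha)=\mathrm{tr}\big(D_R^{\otimes n}M_{\overline1}\cdots M_{\overline n}\,\rho_R(\alpha)\big)\in\mathcal M(R,F)$ (trace over $V^{\otimes n}$). The *characteristic subalgebra* $\mathcal C(R,F)\subset\mathcal M(R,F)$ is the linear span of $1$ and all $ch(\alpha)$, $\alpha\in\mathcal B_n$, $n\ge1$. Put $j_q=\frac{q^j-q^{-j}}{q-q^{-1}}$ and, for $\varepsilon=\pm1$, $\sigma_i^{\varepsilon}(x)=1+\frac{x-1}{q-q^{-1}}\sigma_i+\frac{x-1}{\alpha_\varepsilon x+1}\kappa_i$ with $\alpha_\varepsilon=-\varepsilon q^{-\varepsilon}\mu^{-1}$; write $\sigma_i^{\pm}(x)$ for $\varepsilon=\pm1$. Define $a^{(1)}=s^{(1)}=1$, $$a^{(i+1)}=\tfrac{q^i}{(i+1)_q}\,a^{(i)}\sigma_i^-(q^{-2i})a^{(i)},\qquad s^{(i+1)}=\tfrac{q^{-i}}{(i+1)_q}\,s^{(i)}\sigma_i^+(q^{2i})s^{(i)},$$ and $g=\eta^{-1}ch(\kappa_1)$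 with $\kappa_1\in\mathcal W_2(q,\mu)$; $a_0=s_0=1$; and, for $i\ge1$, $a_i=ch(a^{(i)})$, $s_i=ch(s^{(i)})$ with $a^{(i)},s^{(i)}\in\mathcal W_i(q,\mu)$. **Proposition 4.8.** Under these assumptions: 1. If $j_q\ne0$ and $\mu\ne-q^{-2j+3}$ for all $j=2,3,\dots$, then $\mathcal C(R,F)$ is the unital subalgebra of $\mathcal M(R,F)$ generated by $\{g,a_i\}_{i\ge0}$. 2. If $j_q\ne0$ and $\mu\ne q^{2j-3}$ for all $j=2,3,\dots$, then $\mathcal C(R,F)$ is the unital subalgebra of $\mathcal M(R,F)$ generated by $\{g,s_i\}_{i\ge0}$. -/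

import Mathlib

noncomputable section

namespace QMat

/-! ### Operators on tensor powers

`V` is a complex vector space with a fixed basis indexed by `Fin N`; an operator on the tensor power
`V^{⊗n}` is a square matrix whose rows and columns are multi-indices `Fin n → Fin N`.  Entries
may lie in an arbitrary (noncommutative) algebra `A`. -/

/-- `N^n × N^n` matrices with entries in `A`, i.e. `End(V^{⊗n}) ⊗ A`. -/
abbrev Op (N n : ℕ) (A : Type*) := Matrix (Fin n → Fin N) (Fin n → Fin N) A

section Embed

variable {N k l n : ℕ} {A : Type*}

/-- The operator `X` on `V^{⊗k}` acting in the tensor factors `e 0, …, e (k-1)` of `V^{⊗n}` and as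
the identity in all the other factors. -/
def embed [Zero A] (e : Fin k → Fin n) (X : Op N k A) : Op N n A :=
  Matrix.of fun i j => open Classical in
    if ∀ s, s ∉ Set.range e → i s = j s then X (i ∘ e) (j ∘ e) else 0

theorem embed_embed [Zero A] (e : Fin k → Fin l) (f : Fin l → Fin n) (hf : f.Injective)
    (X : Op N k A) : embed f (embed e X) = embed (f ∘ e) X := by
  classical
  ext i j
  simp only [embed, Matrix.of_apply, ← Function.comp_assoc]
  by_cases h : ∀ s, s ∉ Set.range (f ∘ e) → i s = j s
  · rw [if_pos h, if_pos, if_pos]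
    · intro s hs
      exact h _ (by rintro ⟨t, ht⟩; exact hs ⟨t, hf ht⟩)
    · intro s hs
      exact h _ (by rintro ⟨t, ht⟩; exact hs ⟨e t, ht⟩)
  · rw [if_neg h]
    by_cases h1 : ∀ s, s ∉ Set.range f → i s = j s
    · rw [if_pos h1, if_neg]
      intro h2
      apply h
      intro s hs
      by_cases h3 : s ∈ Set.range f
      · obtain ⟨t, rfl⟩ := h3
        exact h2 t (by rintro ⟨u, rfl⟩; exact hs ⟨u, rfl⟩)
      · exact h1 s h3
    · rw [if_neg h1]

theorem embed_one [Zero A] [One A] (e : Fin k → Fin n) : embed e (1 : Op N k A) = 1 := by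
  classical
  ext i j
  simp only [embed, Matrix.of_apply, Matrix.one_apply]
  by_cases h : i = j
  · subst h; simp
  · rw [if_neg h]
    by_cases h1 : ∀ s, s ∉ Set.range e → i s = j s
    · rw [if_pos h1, if_neg]
      intro h2
      apply h
      funext s
      by_cases h3 : s ∈ Set.range e
      · obtain ⟨t, rfl⟩ := h3
        exact congrFun h2 t
      · exact h1 s h3
    · rw [if_neg h1]

theorem embed_add [AddMonoid A] (e : Fin k → Fin n) (X Y : Op N k A) :
    embed e (X + Y) = embed e X + embed e Y := by
  ext i j
  simp only [embed, Matrix.of_apply, Matrix.add_apply]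
  split_ifs <;> simp

theorem embed_smul (e : Fin k → Fin n) (c : ℂ) (X : Op N k ℂ) :
    embed e (c • X) = c • embed e X := by
  ext i j
  simp only [embed, Matrix.of_apply, Matrix.smul_apply]
  split_ifs <;> simp

theorem embed_mul [Semiring A] (e : Fin k → Fin n) (he : e.Injective) (X Y : Op N k A) :
    embed e (X * Y) = embed e X * embed e Y := by
  classical
  ext i j
  simp only [embed, Matrix.of_apply, Matrix.mul_apply]
  by_cases h : ∀ s, s ∉ Set.range e → i s = j s
  · rw [if_pos h]
    refine Finset.sum_of_injOn (fun l => Function.extend e l i) ?_ ?_ ?_ ?_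
    · intro l _ l' _ hl
      funext t
      simpa [he.extend_apply] using congrFun hl (e t)
    · intro _ _; simp
    · intro m _ hm
      rw [if_neg, zero_mul]
      intro h1
      apply hm
      refine ⟨m ∘ e, by simp, ?_⟩
      funext s
      by_cases h3 : s ∈ Set.range e
      · obtain ⟨t, rfl⟩ := h3
        simp [he.extend_apply]
      · dsimp only
        rw [Function.extend_apply' _ _ _ h3]
        exact h1 s h3
    · intro l _
      have h2 : (Function.extend e l i) ∘ e = l := by
        funext t; simp [he.extend_apply]
      rw [if_pos, if_pos, h2]
      · intro s hs
        rw [Function.extend_apply' _ _ _ hs]; exact h s hs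
      · intro s hs
        rw [Function.extend_apply' _ _ _ hs]
  · rw [if_neg h, Finset.sum_eq_zero]
    intro m _
    by_cases h1 : ∀ s, s ∉ Set.range e → i s = m s
    · rw [if_neg (c := ∀ s, s ∉ Set.range e → m s = j s), mul_zero]
      intro h2
      exact h fun s hs => (h1 s hs).trans (h2 s hs)
    · rw [if_neg h1, zero_mul]

theorem embed_mul_apply_of_disjoint [Semiring A] (e : Fin k → Fin n) (f : Fin l → Fin n)
    (he : e.Injective) (hef : Disjoint (Set.range e) (Set.range f)) (X : Op N k A) (Y : Op N l A)
    (i j : Fin n → Fin N) : (embed e X * embed f Y) i j = open Classical in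
      if ∀ s, s ∉ Set.range e → s ∉ Set.range f → i s = j s then
        X (i ∘ e) (j ∘ e) * Y (i ∘ f) (j ∘ f) else 0 := by
  classical
  rw [Matrix.mul_apply, Finset.sum_eq_single (Function.extend e (j ∘ e) i)]
  · simp only [embed, Matrix.of_apply]
    have h2 : (Function.extend e (j ∘ e) i) ∘ e = j ∘ e := by
      funext t; simp [he.extend_apply]
    have h3 : (Function.extend e (j ∘ e) i) ∘ f = i ∘ f := by
      funext t
      exact Function.extend_apply' _ _ _ (Set.disjoint_right.1 hef ⟨t, rfl⟩)
    rw [if_pos (by intro s hs; rw [Function.extend_apply' _ _ _ hs]), h2, h3]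
    by_cases h : ∀ s, s ∉ Set.range e → s ∉ Set.range f → i s = j s
    · rw [if_pos h, if_pos]
      intro s hs
      by_cases h4 : s ∈ Set.range e
      · obtain ⟨t, rfl⟩ := h4
        simp [he.extend_apply]
      · rw [Function.extend_apply' _ _ _ h4]; exact h s h4 hs
    · rw [if_neg h, if_neg, mul_zero]
      intro h5
      apply h
      intro s h4 hs
      have := h5 s hs
      rwa [Function.extend_apply' _ _ _ h4] at this
  · intro m _ hm
    simp only [embed, Matrix.of_apply]
    by_cases h1 : ∀ s, s ∉ Set.range e → i s = m s
    · rw [if_neg (c := ∀ s, s ∉ Set.range f → m s = j s), mul_zero]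
      intro h2
      apply hm
      funext s
      by_cases h4 : s ∈ Set.range e
      · rw [h2 s (Set.disjoint_left.1 hef h4)]
        obtain ⟨t, rfl⟩ := h4
        simp [he.extend_apply]
      · rw [Function.extend_apply' _ _ _ h4]; exact (h1 s h4).symm
    · rw [if_neg h1, zero_mul]
  · simp

theorem embed_commute (e : Fin k → Fin n) (f : Fin l → Fin n) (he : e.Injective)
    (hf : f.Injective) (hef : Disjoint (Set.range e) (Set.range f)) (X : Op N k ℂ) (Y : Op N l ℂ) :
    embed e X * embed f Y = embed f Y * embed e X := by
  classical
  ext i j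
  rw [embed_mul_apply_of_disjoint e f he hef, embed_mul_apply_of_disjoint f e hf hef.symm,
    mul_comm]
  congr 1
  exact propext ⟨fun h s a b => h s b a, fun h s a b => h s b a⟩

/-- `embed e` as a unital algebra homomorphism `End(V^{⊗k}) → End(V^{⊗n})`. -/
def embedHom (e : Fin k → Fin n) (he : e.Injective) : Op N k ℂ →ₐ[ℂ] Op N n ℂ :=
  AlgHom.ofLinearMap
    { toFun := embed e, map_add' := embed_add e, map_smul' := embed_smul e }
    (embed_one e) (embed_mul e he)

/-- The positions `m, m+1` (counted from `0`) among `n` tensor factors. -/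
def pos (n m : ℕ) (h : m + 1 < n) : Fin 2 → Fin n :=
  ![⟨m, Nat.lt_of_succ_lt h⟩, ⟨m + 1, h⟩]

theorem pos_injective (n m : ℕ) (h : m + 1 < n) : (pos n m h).Injective := by
  intro a b
  fin_cases a <;> fin_cases b <;> simp [pos]

/-- `X_{m+1}`: the operator `X` on `V ⊗ V` acting in the tensor factors number `m+1, m+2` of
`V^{⊗n}` (so the index `m` counts from `0`). -/
def leg (n m : ℕ) (h : m + 1 < n) : Op N 2 ℂ →ₐ[ℂ] Op N n ℂ :=
  embedHom (pos n m h) (pos_injective n m h)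

/-- The positions `m, m+1, m+2` among `n` tensor factors. -/
def pos3 (n m : ℕ) (h : m + 2 < n) : Fin 3 → Fin n :=
  ![⟨m, by omega⟩, ⟨m + 1, by omega⟩, ⟨m + 2, h⟩]

theorem pos3_injective (n m : ℕ) (h : m + 2 < n) : (pos3 n m h).Injective := by
  intro a b
  fin_cases a <;> fin_cases b <;> simp [pos3]

theorem embedHom_pos3_leg_zero (n m : ℕ) (h : m + 2 < n) (X : Op N 2 ℂ) :
    embedHom (pos3 n m h) (pos3_injective n m h) (leg 3 0 (by omega) X) =
      leg n m (by omega) X := by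
  refine (embed_embed _ _ (pos3_injective n m h) X).trans ?_
  change embed _ X = embed _ X
  congr 1
  funext a
  fin_cases a <;> simp [pos3, pos]

theorem embedHom_pos3_leg_one (n m : ℕ) (h : m + 2 < n) (X : Op N 2 ℂ) :
    embedHom (pos3 n m h) (pos3_injective n m h) (leg 3 1 (by omega) X) =
      leg n (m + 1) (by omega) X := by
  refine (embed_embed _ _ (pos3_injective n m h) X).trans ?_
  change embed _ X = embed _ X
  congr 1
  funext a
  fin_cases a <;> simp [pos3, pos]

theorem leg_commute (n m m' : ℕ) (h : m + 1 < n) (h' : m' + 1 < n) (hm : m + 1 < m')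
    (X Y : Op N 2 ℂ) : leg n m h X * leg n m' h' Y = leg n m' h' Y * leg n m h X := by
  refine embed_commute _ _ (pos_injective n m h) (pos_injective n m' h') ?_ X Y
  rw [Set.disjoint_left]
  rintro _ ⟨a, rfl⟩ ⟨b, hb⟩
  fin_cases a <;> fin_cases b <;> simp [pos] at hb <;> omega

end Embed

/-! ### R-matrices, skew invertibility, compatible pairs -/

section RMatrix

variable {N : ℕ}

/-- `Y` is the skew inverse of `X`:
`tr_(2) X_{12} Y_{23} = tr_(2) Y_{12} X_{23} = P_{13}`, `P` the permutation operator, written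
in components. -/
def IsSkewInverse (X Y : Op N 2 ℂ) : Prop :=
  (∀ i₁ i₃ j₁ j₃ : Fin N, ∑ a, ∑ b, X ![i₁, a] ![j₁, b] * Y ![b, i₃] ![a, j₃] =
    if i₁ = j₃ ∧ i₃ = j₁ then 1 else 0) ∧
  (∀ i₁ i₃ j₁ j₃ : Fin N, ∑ a, ∑ b, Y ![i₁, a] ![j₁, b] * X ![b, i₃] ![a, j₃] =
    if i₁ = j₃ ∧ i₃ = j₁ then 1 else 0)

/-- Skew invertibility. -/
def SkewInvertible (X : Op N 2 ℂ) : Prop := ∃ Y, IsSkewInverse X Y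

open Classical in
/-- The (unique) skew inverse `Ψ_X` of a skew invertible operator; `0` if there is none. -/
def skewInv (X : Op N 2 ℂ) : Op N 2 ℂ :=
  if h : SkewInvertible X then h.choose else 0

theorem skewInv_spec {X : Op N 2 ℂ} (h : SkewInvertible X) : IsSkewInverse X (skewInv X) := by
  rw [skewInv, dif_pos h]
  exact h.choose_spec

/-- `C_X = tr_(1) Ψ_X`. -/
def matC (X : Op N 2 ℂ) : Matrix (Fin N) (Fin N) ℂ :=
  Matrix.of fun i j => ∑ a, skewInv X ![a, i] ![a, j]

/-- `D_X = tr_(2) Ψ_X`. -/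
def matD (X : Op N 2 ℂ) : Matrix (Fin N) (Fin N) ℂ :=
  Matrix.of fun i j => ∑ a, skewInv X ![i, a] ![j, a]

/-- Strict skew invertibility: skew invertible, and one of `C_X`, `D_X` is invertible. -/
def StrictSkewInvertible (X : Op N 2 ℂ) : Prop :=
  SkewInvertible X ∧ (IsUnit (matC X) ∨ IsUnit (matD X))

/-- `X₁` on `V^{⊗3}`. -/
abbrev leg₁ : Op N 2 ℂ →ₐ[ℂ] Op N 3 ℂ := leg 3 0 (by omega)

/-- `X₂` on `V^{⊗3}`. -/
abbrev leg₂ : Op N 2 ℂ →ₐ[ℂ] Op N 3 ℂ := leg 3 1 (by omega)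

/-- An R-matrix: an invertible solution of the Yang-Baxter equation. -/
structure IsRMatrix (R : Op N 2 ℂ) : Prop where
  isUnit : IsUnit R
  yangBaxter : leg₁ R * leg₂ R * leg₁ R = leg₂ R * leg₁ R * leg₂ R

/-- The twist relations for an ordered pair `{R, F}`. -/
def Compatible (R F : Op N 2 ℂ) : Prop :=
  leg₁ R * leg₂ F * leg₁ F = leg₂ F * leg₁ F * leg₂ R ∧
  leg₂ R * leg₁ F * leg₂ F = leg₁ F * leg₂ F * leg₁ R

/-- `K = μ⁻¹ (q - q⁻¹)⁻¹ (q I - R)(q⁻¹ I + R)`. -/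
def opK (q μ : ℂ) (R : Op N 2 ℂ) : Op N 2 ℂ :=
  (μ⁻¹ * (q - q⁻¹)⁻¹) • ((q • 1 - R) * (q⁻¹ • 1 + R))

/-- An R-matrix of Birman-Murakami-Wenzl type with parameters
`q ∈ ℂ \ {0, ±1}`, `μ ∈ ℂ \ {0, q, -q⁻¹}`. -/
structure IsBMWType (q μ : ℂ) (R : Op N 2 ℂ) : Prop extends IsRMatrix R where
  q_ne_zero : q ≠ 0
  q_ne_one : q ≠ 1
  q_ne_neg_one : q ≠ -1
  mu_ne_zero : μ ≠ 0
  mu_ne_q : μ ≠ q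
  mu_ne_neg_q_inv : μ ≠ -q⁻¹
  minpoly_eq : minpoly ℂ R = (Polynomial.X - Polynomial.C q) *
    (Polynomial.X + Polynomial.C q⁻¹) * (Polynomial.X - Polynomial.C μ)
  K_two_one : leg₂ (opK q μ R) * leg₁ (opK q μ R) = leg₁ R * leg₂ R * leg₁ (opK q μ R)
  K_two_one' : leg₂ (opK q μ R) * leg₁ (opK q μ R) = leg₁ R⁻¹ * leg₂ R⁻¹ * leg₁ (opK q μ R)
  K_one_two_one : leg₁ (opK q μ R) * leg₂ (opK q μ R) * leg₁ (opK q μ R) = leg₁ (opK q μ R)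

end RMatrix

/-! ### Braid groups and Birman-Murakami-Wenzl algebras -/

/-- Artin relations; the generators `σ_1, …, σ_{n-1}` are indexed by `Fin (n - 1)`, from `0`. -/
def braidRels (n : ℕ) : Set (FreeGroup (Fin (n - 1))) :=
  {r | ∃ i j : Fin (n - 1), (i : ℕ) + 1 = j ∧
    r = .of i * .of j * .of i * (.of j * .of i * .of j)⁻¹} ∪
  {r | ∃ i j : Fin (n - 1), (i : ℕ) + 1 < j ∧ r = .of i * .of j * (.of j * .of i)⁻¹}

/-- The braid group on `n` strands. -/
abbrev Braid (n : ℕ) := PresentedGroup (braidRels n)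

/-- The Artin generators of the braid group. -/
def braidGen {n : ℕ} (i : Fin (n - 1)) : Braid n := PresentedGroup.of i

/-- The generators in the group algebra of the braid group. -/
def preSigma {n : ℕ} (i : Fin (n - 1)) : MonoidAlgebra ℂ (Braid n) :=
  MonoidAlgebra.of ℂ (Braid n) (braidGen i)

/-- The inverse generators in the group algebra of the braid group. -/
def preSigmaInv {n : ℕ} (i : Fin (n - 1)) : MonoidAlgebra ℂ (Braid n) :=
  MonoidAlgebra.of ℂ (Braid n) (braidGen i)⁻¹

/-- `κ_i = (q - σ_i)(q⁻¹ + σ_i) / (μ (q - q⁻¹))`, in the group algebra of the braid group. -/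
def preKappa (q μ : ℂ) {n : ℕ} (i : Fin (n - 1)) : MonoidAlgebra ℂ (Braid n) :=
  (μ * (q - q⁻¹))⁻¹ • ((q • 1 - preSigma i) * (q⁻¹ • 1 + preSigma i))

/-- The defining relations of the BMW algebra. -/
inductive BMWRel (q μ : ℂ) (n : ℕ) :
    MonoidAlgebra ℂ (Braid n) → MonoidAlgebra ℂ (Braid n) → Prop
  | sigma_kappa (i : Fin (n - 1)) :
      BMWRel q μ n (preSigma i * preKappa q μ i) (μ • preKappa q μ i)
  | kappa_sigma (i : Fin (n - 1)) :
      BMWRel q μ n (preKappa q μ i * preSigma i) (μ • preKappa q μ i)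
  | kappa_sigma_kappa (i j : Fin (n - 1)) (h : (i : ℕ) + 1 = j) :
      BMWRel q μ n (preKappa q μ i * preSigma j * preKappa q μ i) (μ⁻¹ • preKappa q μ i)
  | kappa_sigmaInv_kappa (i j : Fin (n - 1)) (h : (i : ℕ) + 1 = j) :
      BMWRel q μ n (preKappa q μ i * preSigmaInv j * preKappa q μ i) (μ • preKappa q μ i)

/-- The Birman-Murakami-Wenzl algebra `W_n(q, μ)`. -/
abbrev BMW (q μ : ℂ) (n : ℕ) := RingQuot (BMWRel q μ n)

section Elements

variable (q μ : ℂ) {n : ℕ}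

/-- The generator `σ_{i+1}` of the BMW algebra. -/
def sigma (i : Fin (n - 1)) : BMW q μ n := RingQuot.mkAlgHom ℂ (BMWRel q μ n) (preSigma i)

/-- The element `κ_{i+1}` of the BMW algebra. -/
def kappa (i : Fin (n - 1)) : BMW q μ n := RingQuot.mkAlgHom ℂ (BMWRel q μ n) (preKappa q μ i)

/-- The baxterized element `σ_{i+1}^ε(x) = 1 + (x-1)/(q-q⁻¹) σ + (x-1)/(α_ε x + 1) κ`, with
`α = α_ε` as a parameter. -/
def baxter (α x : ℂ) (i : Fin (n - 1)) : BMW q μ n :=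
  1 + ((x - 1) / (q - q⁻¹)) • sigma q μ i + ((x - 1) / (α * x + 1)) • kappa q μ i

/-- `α_- = q μ⁻¹`. -/
def alphaMinus : ℂ := q * μ⁻¹

/-- `α_+ = - q⁻¹ μ⁻¹`. -/
def alphaPlus : ℂ := -(q⁻¹ * μ⁻¹)

/-- The `q`-number `k_q = (q^k - q^{-k}) / (q - q⁻¹)`. -/
def qNum (k : ℕ) : ℂ := (q ^ k - (q⁻¹) ^ k) / (q - q⁻¹)

/-- `η = (q - μ)(q⁻¹ + μ) / (μ (q - q⁻¹))`. -/
def eta : ℂ := (q - μ) * (q⁻¹ + μ) / (μ * (q - q⁻¹))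

/-- The antisymmetrizers `a^{(i)}`, `1 ≤ i ≤ n`, in `W_n(q, μ)`: `a^{(1)} = 1` and
`a^{(i+1)} = q^i / (i+1)_q · a^{(i)} σ_i^-(q^{-2i}) a^{(i)}`.  (The value at `0` is a convention
which is not used.) -/
def antisym (n : ℕ) : (i : ℕ) → i ≤ n → BMW q μ n
  | 0, _ => 1
  | 1, _ => 1
  | i + 2, h => (q ^ (i + 1) / qNum q (i + 2)) •
      (antisym n (i + 1) (by omega) *
        baxter q μ (alphaMinus q μ) ((q⁻¹) ^ (2 * (i + 1))) ⟨i, by omega⟩ *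
        antisym n (i + 1) (by omega))

/-- The symmetrizers `s^{(i)}`, `1 ≤ i ≤ n`, in `W_n(q, μ)`: `s^{(1)} = 1` and
`s^{(i+1)} = q^{-i} / (i+1)_q · s^{(i)} σ_i^+(q^{2i}) s^{(i)}`.  (The value at `0` is a convention
which is not used.) -/
def sym (n : ℕ) : (i : ℕ) → i ≤ n → BMW q μ n
  | 0, _ => 1
  | 1, _ => 1
  | i + 2, h => ((q⁻¹) ^ (i + 1) / qNum q (i + 2)) •
      (sym n (i + 1) (by omega) *
        baxter q μ (alphaPlus q μ) (q ^ (2 * (i + 1))) ⟨i, by omega⟩ *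
        sym n (i + 1) (by omega))

/-- The second order contractor `c^{(2)} = η⁻¹ κ_1` in `W_2(q, μ)`. -/
def contractor : BMW q μ 2 := (eta q μ)⁻¹ • kappa q μ 0

end Elements

/-! ### R-matrix representations -/

section Rep

variable {N : ℕ} {q μ : ℂ} {R : Op N 2 ℂ}

/-- The invertible operator `R_{i+1}` on `V^{⊗n}`. -/
def legUnit (hR : IsRMatrix R) (n : ℕ) (i : Fin (n - 1)) : (Op N n ℂ)ˣ :=
  Units.map (leg n i (by omega)).toMonoidHom hR.isUnit.unit

theorem coe_legUnit (hR : IsRMatrix R) (n : ℕ) (i : Fin (n - 1)) :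
    (legUnit hR n i : Op N n ℂ) = leg n i (by omega) R := rfl

theorem coe_legUnit_inv (hR : IsRMatrix R) (n : ℕ) (i : Fin (n - 1)) :
    ((legUnit hR n i)⁻¹ : (Op N n ℂ)ˣ) = leg n i (by omega) R⁻¹ := by
  rw [legUnit, ← map_inv, Units.coe_map, Matrix.coe_units_inv]
  rfl

/-- The representation `ρ_R` of the braid group on `V^{⊗n}`, `σ_i ↦ R_i`. -/
def braidRep (hR : IsRMatrix R) (n : ℕ) : Braid n →* (Op N n ℂ)ˣ :=
  PresentedGroup.toGroup (f := legUnit hR n) (by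
    rintro r (⟨i, j, hij, rfl⟩ | ⟨i, j, hij, rfl⟩)
    · simp only [map_mul, map_inv, FreeGroup.lift_apply_of, mul_inv_eq_one]
      obtain ⟨j, hj⟩ := j
      obtain rfl : (i : ℕ) + 1 = j := hij
      ext1
      simp only [Units.val_mul, coe_legUnit]
      have h := congrArg (embedHom (pos3 n i (by omega)) (pos3_injective n i (by omega)))
        hR.yangBaxter
      simpa only [map_mul, embedHom_pos3_leg_zero, embedHom_pos3_leg_one] using h
    · simp only [map_mul, map_inv, FreeGroup.lift_apply_of, mul_inv_eq_one]
      ext1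
      simp only [Units.val_mul, coe_legUnit]
      exact leg_commute n i j _ _ hij R R)

theorem braidRep_gen (hR : IsRMatrix R) (n : ℕ) (i : Fin (n - 1)) :
    braidRep hR n (braidGen i) = legUnit hR n i := PresentedGroup.toGroup.of _

/-- The linear extension of `ρ_R` to the group algebra of the braid group. -/
def groupAlgRep (hR : IsRMatrix R) (n : ℕ) : MonoidAlgebra ℂ (Braid n) →ₐ[ℂ] Op N n ℂ :=
  MonoidAlgebra.lift ℂ (Op N n ℂ) (Braid n) ((Units.coeHom _).comp (braidRep hR n))

theorem groupAlgRep_sigma (hR : IsRMatrix R) (n : ℕ) (i : Fin (n - 1)) :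
    groupAlgRep hR n (preSigma i) = leg n i (by omega) R := by
  rw [groupAlgRep, preSigma, MonoidAlgebra.lift_of, MonoidHom.comp_apply, braidRep_gen]
  rfl

theorem groupAlgRep_sigmaInv (hR : IsRMatrix R) (n : ℕ) (i : Fin (n - 1)) :
    groupAlgRep hR n (preSigmaInv i) = leg n i (by omega) R⁻¹ := by
  rw [groupAlgRep, preSigmaInv, MonoidAlgebra.lift_of, MonoidHom.comp_apply, map_inv,
    braidRep_gen, ← coe_legUnit_inv hR]
  rfl

theorem groupAlgRep_kappa (hR : IsRMatrix R) (n : ℕ) (i : Fin (n - 1)) :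
    groupAlgRep hR n (preKappa q μ i) = leg n i (by omega) (opK q μ R) := by
  rw [preKappa, opK, mul_inv]
  simp only [map_smul, map_mul, map_sub, map_add, map_one, groupAlgRep_sigma]

theorem IsBMWType.charR (hR : IsBMWType q μ R) :
    (R - q • 1) * (R + q⁻¹ • 1) * (R - μ • 1) = 0 := by
  have h := minpoly.aeval ℂ R
  rw [hR.minpoly_eq] at h
  simpa [Algebra.algebraMap_eq_smul_one] using h

theorem IsBMWType.K_mul_R (hR : IsBMWType q μ R) : opK q μ R * R = μ • opK q μ R := by
  have h := hR.charR
  have h2 : (q • 1 - R) * (q⁻¹ • 1 + R) * (R - μ • 1) = 0 := by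
    rw [← neg_sub R, add_comm (q⁻¹ • (1 : Op N 2 ℂ)), neg_mul, neg_mul, h, neg_zero]
  rw [mul_sub, sub_eq_zero, mul_smul_comm, mul_one] at h2
  rw [opK, smul_mul_assoc, h2, smul_comm]

theorem opK_commute : opK q μ R * R = R * opK q μ R := by
  rw [opK, smul_mul_assoc, mul_smul_comm]
  congr 1
  simp only [mul_add, add_mul, sub_mul, mul_sub, smul_mul_assoc, mul_smul_comm, one_mul, mul_one,
    mul_assoc]

theorem IsBMWType.K_mul_R_inv (hR : IsBMWType q μ R) : opK q μ R * R⁻¹ = μ⁻¹ • opK q μ R := by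
  have hu : R * R⁻¹ = 1 := Matrix.mul_nonsing_inv R ((Matrix.isUnit_iff_isUnit_det R).1 hR.isUnit)
  have h := congrArg (fun Y => μ⁻¹ • (Y * R⁻¹)) hR.K_mul_R
  simp only [mul_assoc, hu, mul_one, smul_mul_assoc, smul_smul,
    inv_mul_cancel₀ hR.mu_ne_zero, one_smul] at h
  exact h.symm

theorem IsBMWType.K_R_K (hR : IsBMWType q μ R) :
    leg₁ (opK q μ R) * leg₂ R * leg₁ (opK q μ R) = μ⁻¹ • leg₁ (opK q μ R) := by
  have h := hR.K_one_two_one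
  rw [mul_assoc, hR.K_two_one, ← mul_assoc, ← mul_assoc, ← map_mul, hR.K_mul_R, map_smul,
    smul_mul_assoc, smul_mul_assoc] at h
  nth_rewrite 3 [← h]
  rw [smul_smul, inv_mul_cancel₀ hR.mu_ne_zero, one_smul]

theorem IsBMWType.K_R_inv_K (hR : IsBMWType q μ R) :
    leg₁ (opK q μ R) * leg₂ R⁻¹ * leg₁ (opK q μ R) = μ • leg₁ (opK q μ R) := by
  have h := hR.K_one_two_one
  rw [mul_assoc, hR.K_two_one', ← mul_assoc, ← mul_assoc, ← map_mul, hR.K_mul_R_inv, map_smul,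
    smul_mul_assoc, smul_mul_assoc] at h
  nth_rewrite 3 [← h]
  rw [smul_smul, mul_inv_cancel₀ hR.mu_ne_zero, one_smul]

theorem groupAlgRep_rel (hR : IsBMWType q μ R) (n : ℕ) (x y : MonoidAlgebra ℂ (Braid n))
    (h : BMWRel q μ n x y) :
    groupAlgRep hR.toIsRMatrix n x = groupAlgRep hR.toIsRMatrix n y := by
  cases h with
  | sigma_kappa i =>
    simp only [map_mul, map_smul, groupAlgRep_sigma, groupAlgRep_kappa]
    rw [← map_mul, ← opK_commute, hR.K_mul_R, map_smul]
  | kappa_sigma i =>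
    simp only [map_mul, map_smul, groupAlgRep_sigma, groupAlgRep_kappa]
    rw [← map_mul, hR.K_mul_R, map_smul]
  | kappa_sigma_kappa i j h =>
    simp only [map_mul, map_smul, groupAlgRep_sigma, groupAlgRep_kappa]
    obtain ⟨j, hj⟩ := j
    obtain rfl : (i : ℕ) + 1 = j := h
    have h := congrArg (embedHom (pos3 n i (by omega)) (pos3_injective n i (by omega))) hR.K_R_K
    simpa only [map_mul, map_smul, embedHom_pos3_leg_zero, embedHom_pos3_leg_one] using h
  | kappa_sigmaInv_kappa i j h =>
    simp only [map_mul, map_smul, groupAlgRep_sigmaInv, groupAlgRep_kappa]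
    obtain ⟨j, hj⟩ := j
    obtain rfl : (i : ℕ) + 1 = j := h
    have h := congrArg (embedHom (pos3 n i (by omega)) (pos3_injective n i (by omega)))
      hR.K_R_inv_K
    simpa only [map_mul, map_smul, embedHom_pos3_leg_zero, embedHom_pos3_leg_one] using h

/-- The representation `ρ_R` of the BMW algebra `W_n(q, μ)` on `V^{⊗n}`, `σ_i ↦ R_i`. -/
def bmwRep (hR : IsBMWType q μ R) (n : ℕ) : BMW q μ n →ₐ[ℂ] Op N n ℂ :=
  RingQuot.liftAlgHom ℂ ⟨groupAlgRep hR.toIsRMatrix n, groupAlgRep_rel hR n⟩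

end Rep

/-! ### The quantum matrix algebra and its characteristic subalgebra -/

section QMAlgebra

variable {N : ℕ}

/-- A numerical operator regarded as an operator with entries in `A`. -/
def scal (A : Type*) [Ring A] [Algebra ℂ A] {n : ℕ} (X : Op N n ℂ) : Op N n A :=
  X.map (algebraMap ℂ A)

/-- The matrix copies on `V^{⊗n}`, numbered from `0`: the first copy is `M` acting in the first
tensor factor, and the next ones are `F_i M_{\bar i} F_i⁻¹`. -/
def mcopy {A : Type*} [Ring A] [Algebra ℂ A] (F : Op N 2 ℂ) (M : Matrix (Fin N) (Fin N) A)
    (n : ℕ) : (i : ℕ) → i < n → Op N n A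
  | 0, h => embed (fun _ : Fin 1 => ⟨0, h⟩) (Matrix.of fun a b => M (a 0) (b 0))
  | i + 1, h => scal A (leg n i h F) * mcopy F M n i (by omega) * scal A (leg n i h F⁻¹)

/-- The string `M_{\bar 1} M_{\bar 2} … M_{\bar n}` on `V^{⊗n}`. -/
def mstring {A : Type*} [Ring A] [Algebra ℂ A] (F : Op N 2 ℂ) (M : Matrix (Fin N) (Fin N) A)
    (n : ℕ) : Op N n A :=
  (List.ofFn fun i : Fin n => mcopy F M n i i.isLt).prod

/-- The matrix of the generators of the free algebra. -/
def freeGen (N : ℕ) : Matrix (Fin N) (Fin N) (FreeAlgebra ℂ (Fin N × Fin N)) :=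
  Matrix.of fun a b => FreeAlgebra.ι ℂ (a, b)

/-- The entries of the matrix relation `R_1 M_{\bar 1} M_{\bar 2} = M_{\bar 1} M_{\bar 2} R_1`. -/
inductive QMRel (R F : Op N 2 ℂ) :
    FreeAlgebra ℂ (Fin N × Fin N) → FreeAlgebra ℂ (Fin N × Fin N) → Prop
  | entry (i j : Fin 2 → Fin N) :
      QMRel R F ((scal (FreeAlgebra ℂ (Fin N × Fin N)) R * mstring F (freeGen N) 2) i j)
        ((mstring F (freeGen N) 2 * scal (FreeAlgebra ℂ (Fin N × Fin N)) R) i j)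

/-- The quantum matrix algebra `M(R, F)`. -/
abbrev QMAlg (R F : Op N 2 ℂ) := RingQuot (QMRel R F)

/-- The matrix `M` of the generators of `M(R, F)`. -/
def genM (R F : Op N 2 ℂ) : Matrix (Fin N) (Fin N) (QMAlg R F) :=
  (freeGen N).map (RingQuot.mkAlgHom ℂ (QMRel R F))

/-- The R-trace `Tr_R(1,…,n)` over all the factors of `V^{⊗n}`, i.e. the trace of
`D_R^{⊗n} · X`. -/
def rTrace {A : Type*} [Ring A] [Algebra ℂ A] (R : Op N 2 ℂ) {n : ℕ} (X : Op N n A) : A :=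
  ∑ i : Fin n → Fin N, ∑ j : Fin n → Fin N, (∏ k, matD R (i k) (j k)) • X j i

/-- `Tr_R(1,…,n) (M_{\bar 1} … M_{\bar n} X)`. -/
def chOp (R F : Op N 2 ℂ) (n : ℕ) (X : Op N n ℂ) : QMAlg R F :=
  rTrace R (mstring F (genM R F) n * scal (QMAlg R F) X)

/-- `ch(α)` for `α` in the braid group on `n` strands. -/
def chBraid {R : Op N 2 ℂ} (hR : IsRMatrix R) (F : Op N 2 ℂ) {n : ℕ} (α : Braid n) :
    QMAlg R F :=
  chOp R F n (braidRep hR n α)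

/-- The characteristic subalgebra `C(R, F)`, defined as the linear span of the unity and of the
elements `ch(α)`, `α` in the braid group on `n` strands, `n ≥ 1`. -/
def charSub {R : Op N 2 ℂ} (hR : IsRMatrix R) (F : Op N 2 ℂ) : Submodule ℂ (QMAlg R F) :=
  Submodule.span ℂ (insert 1 {x | ∃ n, 1 ≤ n ∧ ∃ α : Braid n, x = chBraid hR F α})

variable {q μ : ℂ} {R : Op N 2 ℂ}

/-- `ch(α)` for `α` in the BMW algebra `W_n(q, μ)`. -/
def chBMW (hR : IsBMWType q μ R) (F : Op N 2 ℂ) {n : ℕ} (α : BMW q μ n) : QMAlg R F :=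
  chOp R F n (bmwRep hR n α)

/-- The 2-contraction `g = ch(c^{(2)})`. -/
def contraction (hR : IsBMWType q μ R) (F : Op N 2 ℂ) : QMAlg R F :=
  chBMW hR F (contractor q μ)

/-- `a_0 = 1` and `a_i = ch(a^{(i)})` for `i ≥ 1`. -/
def elemA (hR : IsBMWType q μ R) (F : Op N 2 ℂ) (i : ℕ) : QMAlg R F :=
  if i = 0 then 1 else chBMW hR F (antisym q μ i i le_rfl)

/-- `s_0 = 1` and `s_i = ch(s^{(i)})` for `i ≥ 1`. -/
def elemS (hR : IsBMWType q μ R) (F : Op N 2 ℂ) (i : ℕ) : QMAlg R F :=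
  if i = 0 then 1 else chBMW hR F (sym q μ i i le_rfl)

end QMAlgebra

end QMat

end

/-! Let `W_n` be the algebra of operators on `V^{⊗n}` generated by the `R_i`. It contains the
`R_i⁻¹` and the `K_i`, and the characteristic subalgebra is spanned by 1 and all `ch(W_n)`. Two
properties of `ch` carry the proof. It is a trace on `W_n` (`chOp_mul_comm`), because the `R_i`
commute with the string of matrix copies and with `D_R^{⊗n}`. It also turns juxtaposition into
multiplication (`chOp_mul`): `ch(x) ch(y) = ch(x · y^{↑k})` for `x ∈ W_k`, where `↑k` is an iterated
conjugation by products of the `F_i`. That conjugation raises the indices of `R_i` and of the matrix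
copies and commutes with partial R-traces. Hence the span is closed under products and contains the
algebra `𝒜` generated by `g` and the `a_i` (or the `s_i`).

For the converse, use induction on `n`, with `f` the map `ch` modulo `𝒜` on `W_n`. It is a trace. By
the product formula and induction it vanishes on `W_k · W_{n-k}^{↑k}` for `0 < k < n`, and on
`W_{n-2} K_{n-1}`; it vanishes on the `n`-th (anti)symmetrizer by the choice of generators. Since
`K_{n-1} W_n K_{n-1} ⊆ W_{n-2} K_{n-1}`, `K² = ηK` with `η ≠ 0`, and all `K_i` are conjugate, `f`
kills the ideal generated by the `K_i` (`BMWSystem.trace_mul_e`). So `f` descends to a quotient of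
`W_n` in which Hecke relations hold. There the `κ`-term of the baxterized elements disappears and
the (anti)symmetrizer becomes the Hecke one.

On a Hecke algebra, the decomposition `H_{k+1} = H_k + H_k s H_k` and cyclicity express every value
of `f`, modulo vanishing parabolic terms, through its value on the Coxeter element
(`HeckeSystem.trace_tail_eq_zero`). The value on the antisymmetrizer is a nonzero multiple of that
same value (`HeckeSystem.trace_heckeA_tail`). Hence `f = 0`.

The two assertions are one argument with a parameter `p` satisfying `p - p⁻¹ = q - q⁻¹`: `p = q` for
antisymmetrizers and `p = -q⁻¹` for symmetrizers. -/

noncomputable section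

namespace QMat

/-! ### Trace functionals on Hecke algebras -/

section Hecke

variable {H : Type*} [Ring H] [Algebra ℂ H] {p : ℂ} {n : ℕ} {s : ℕ → H}

/-- The subalgebra generated by the first `k - 1` generators. -/
def lowAlg (s : ℕ → H) (k : ℕ) : Subalgebra ℂ H := Algebra.adjoin ℂ {x | ∃ i, i + 1 < k ∧ x = s i}

/-- The subalgebra generated by the generators with numbers `k, …, n - 2`. -/
def highAlg (s : ℕ → H) (n k : ℕ) : Subalgebra ℂ H :=
  Algebra.adjoin ℂ {x | ∃ i, k ≤ i ∧ i + 1 < n ∧ x = s i}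

theorem mem_lowAlg {i k : ℕ} (h : i + 1 < k) : s i ∈ lowAlg s k :=
  Algebra.subset_adjoin ⟨i, h, rfl⟩

theorem mem_highAlg {i k : ℕ} (hk : k ≤ i) (h : i + 1 < n) : s i ∈ highAlg s n k :=
  Algebra.subset_adjoin ⟨i, hk, h, rfl⟩

theorem lowAlg_mono {k l : ℕ} (h : k ≤ l) : lowAlg s k ≤ lowAlg s l :=
  Algebra.adjoin_mono fun _ ⟨i, hi, hx⟩ => ⟨i, by omega, hx⟩

theorem lowAlg_eq_bot {k : ℕ} (h : k ≤ 1) : lowAlg s k = ⊥ := by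
  rw [lowAlg, ← Algebra.adjoin_empty]
  congr 1
  ext x
  simp only [Set.mem_ofPred_eq, Set.mem_empty_iff_false, iff_false]
  rintro ⟨i, hi, -⟩
  omega

theorem commute_of_mem_lowAlg {k : ℕ} {y : H} (h : ∀ i, i + 1 < k → Commute (s i) y) {x : H}
    (hx : x ∈ lowAlg s k) : Commute x y := by
  have : lowAlg s k ≤ Subalgebra.centralizer ℂ {y} := by
    refine Algebra.adjoin_le ?_
    rintro _ ⟨i, hi, rfl⟩
    simp only [SetLike.mem_coe, Subalgebra.mem_centralizer_iff, Set.mem_singleton_iff, forall_eq]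
    exact (h i hi).eq.symm
  have := this hx
  rw [Subalgebra.mem_centralizer_iff] at this
  exact (this y rfl).symm

/-- The additive span of `L` and of the products `x t y`, where `x, y ∈ L` and `t ∈ T`. -/
def twoSidedSpan (L : Subalgebra ℂ H) (T : Set H) : AddSubmonoid H :=
  AddSubmonoid.closure ((L : Set H) ∪ {z | ∃ x ∈ L, ∃ t ∈ T, ∃ y ∈ L, z = x * t * y})

theorem mem_twoSidedSpan {L : Subalgebra ℂ H} {T : Set H} {x : H} (hx : x ∈ L) :
    x ∈ twoSidedSpan L T :=
  AddSubmonoid.subset_closure (Or.inl hx)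

theorem mul_mem_twoSidedSpan {L : Subalgebra ℂ H} {T : Set H} {x t y : H} (hx : x ∈ L)
    (ht : t ∈ T) (hy : y ∈ L) : x * t * y ∈ twoSidedSpan L T :=
  AddSubmonoid.subset_closure (Or.inr ⟨x, hx, t, ht, y, hy, rfl⟩)

theorem twoSidedSpan_induction {L : Subalgebra ℂ H} {T : Set H} {P : H → Prop}
    (hadd : ∀ x y, P x → P y → P (x + y)) (h0 : ∀ x ∈ L, P x)
    (h1 : ∀ x ∈ L, ∀ t ∈ T, ∀ y ∈ L, P (x * t * y)) : ∀ x ∈ twoSidedSpan L T, P x := by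
  intro x hx
  induction hx using AddSubmonoid.closure_induction with
  | mem x hx =>
    obtain hx | ⟨x, hx, t, ht, y, hy, rfl⟩ := hx
    exacts [h0 x hx, h1 x hx t ht y hy]
  | zero => exact h0 0 (zero_mem _)
  | add x y _ _ hx hy => exact hadd x y hx hy

theorem mul_left_mem_twoSidedSpan {L : Subalgebra ℂ H} {T : Set H} {x u : H} (hx : x ∈ L)
    (hu : u ∈ twoSidedSpan L T) : x * u ∈ twoSidedSpan L T := by
  revert u
  change ∀ u ∈ _, _
  refine twoSidedSpan_induction ?_ ?_ ?_
  · intro u v hu hv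
    rw [mul_add]; exact add_mem hu hv
  · exact fun u hu => mem_twoSidedSpan (mul_mem hx hu)
  · intro u hu t ht v hv
    rw [← mul_assoc, ← mul_assoc]
    exact mul_mem_twoSidedSpan (mul_mem hx hu) ht hv

theorem mul_right_mem_twoSidedSpan {L : Subalgebra ℂ H} {T : Set H} {x u : H} (hx : x ∈ L)
    (hu : u ∈ twoSidedSpan L T) : u * x ∈ twoSidedSpan L T := by
  revert u
  change ∀ u ∈ _, _
  refine twoSidedSpan_induction ?_ ?_ ?_
  · intro u v hu hv
    rw [add_mul]; exact add_mem hu hv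
  · exact fun u hu => mem_twoSidedSpan (mul_mem hu hx)
  · intro u hu t ht v hv
    rw [mul_assoc]
    exact mul_mem_twoSidedSpan hu ht (mul_mem hv hx)

/-- The span contains 1, so it is enough that it be stable under right multiplication by the
generators. Only the last one, `s k`, applied to a term `x t y` needs an argument, and that is `hT`.
Hecke algebras use `T = {s k}`, BMW algebras `T = {s k, e k}`. -/
theorem lowAlg_le_twoSidedSpan {k : ℕ} {T : Set H} (hs : s k ∈ T)
    (hT : ∀ t ∈ T, ∀ y ∈ lowAlg s (k + 1), t * y * s k ∈ twoSidedSpan (lowAlg s (k + 1)) T) {x : H}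
    (hx : x ∈ lowAlg s (k + 2)) : x ∈ twoSidedSpan (lowAlg s (k + 1)) T := by
  suffices ∀ u ∈ twoSidedSpan (lowAlg s (k + 1)) T, u * x ∈ twoSidedSpan (lowAlg s (k + 1)) T by
    simpa using this 1 (mem_twoSidedSpan (one_mem _))
  induction hx using Algebra.adjoin_induction with
  | mem x hx =>
    obtain ⟨i, hi, rfl⟩ := hx
    obtain hi | rfl : i + 1 < k + 1 ∨ i = k := by omega
    · exact fun u hu => mul_right_mem_twoSidedSpan (mem_lowAlg hi) hu
    · refine twoSidedSpan_induction ?_ ?_ ?_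
      · intro u v hu hv
        rw [add_mul]; exact add_mem hu hv
      · intro u hu
        simpa using mul_mem_twoSidedSpan hu hs (one_mem _)
      · intro u hu t ht v hv
        rw [mul_assoc u, mul_assoc u]
        exact mul_left_mem_twoSidedSpan hu (hT t ht v hv)
  | algebraMap c =>
    exact fun u hu => mul_right_mem_twoSidedSpan (Subalgebra.algebraMap_mem _ c) hu
  | add x y _ _ hx hy =>
    intro u hu
    rw [mul_add]; exact add_mem (hx u hu) (hy u hu)
  | mul x y _ _ hx hy =>
    intro u hu
    rw [← mul_assoc]; exact hy _ (hx u hu)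

/-! ### Hecke relations and antisymmetrizers. -/

/-- Generators of a Hecke algebra of type `A`, with eigenvalues `p` and `-p⁻¹`. -/
structure HeckeSystem (p : ℂ) (n : ℕ) (s : ℕ → H) : Prop where
  braid : ∀ i, i + 2 < n → s i * s (i + 1) * s i = s (i + 1) * s i * s (i + 1)
  comm : ∀ i j, i + 1 < j → j + 1 < n → s i * s j = s j * s i
  quad : ∀ i, i + 1 < n → s i * s i = 1 + (p - p⁻¹) • s i

/-- The antisymmetrizers, defined recursively. -/
def heckeA (p : ℂ) (s : ℕ → H) : ℕ → H
  | 0 => 1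
  | 1 => 1
  | i + 2 => (qNum p (i + 2))⁻¹ •
      (heckeA p s (i + 1) * (p ^ (i + 1) • 1 - qNum p (i + 1) • s i) * heckeA p s (i + 1))

theorem heckeA_mem : ∀ k, heckeA p s k ∈ lowAlg s k
  | 0 => one_mem _
  | 1 => one_mem _
  | i + 2 => by
    have h := lowAlg_mono (Nat.le_succ (i + 1)) (heckeA_mem (i + 1))
    rw [heckeA]
    exact Subalgebra.smul_mem _ (mul_mem (mul_mem h (sub_mem (Subalgebra.smul_mem _ (one_mem _) _)
      (Subalgebra.smul_mem _ (mem_lowAlg (by omega)) _))) h) _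

theorem qNum_one (hp : p - p⁻¹ ≠ 0) : qNum p 1 = 1 := by
  simp [qNum, hp]

/-- The right side is the value of `p^k - k_p s` at the eigenvalue `s = -p⁻¹`; this is what
normalizes the antisymmetrizers. -/
theorem qNum_succ (hp0 : p ≠ 0) (hp : p - p⁻¹ ≠ 0) (k : ℕ) :
    qNum p (k + 1) = p ^ k + p⁻¹ * qNum p k := by
  have h : p⁻¹ * p = 1 := inv_mul_cancel₀ hp0
  simp only [qNum]
  rw [div_eq_iff hp, add_mul, mul_assoc, div_mul_cancel₀ _ hp, pow_succ, pow_succ]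
  linear_combination (0 : ℂ) * h

theorem qNum_two (hp0 : p ≠ 0) (hp : p - p⁻¹ ≠ 0) : qNum p 2 = p + p⁻¹ := by
  rw [qNum_succ hp0 hp, qNum_one hp]; ring

/-- The Yang-Baxter equation for the baxterized generators. -/
theorem baxter_hecke {x y : H} (hp0 : p ≠ 0) (hp : p - p⁻¹ ≠ 0) (hb : x * y * x = y * x * y)
    (hx : x * x = 1 + (p - p⁻¹) • x) (hy : y * y = 1 + (p - p⁻¹) • y) (k : ℕ) :
    (p • 1 - x) * (p ^ (k + 1) • 1 - qNum p (k + 1) • y) * (p ^ k • 1 - qNum p k • x) =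
    (p ^ k • 1 - qNum p k • y) * (p ^ (k + 1) • 1 - qNum p (k + 1) • x) * (p • 1 - y) := by
  rw [qNum_succ hp0 hp]
  generalize qNum p k = a at *
  simp only [mul_sub, sub_mul, smul_mul_assoc, mul_smul_comm, mul_one, one_mul, smul_sub, hb, hx,
    hy, smul_add, smul_smul]
  match_scalars <;> field_simp <;> ring

/-- `A` is an antisymmetrizer and `e` the preceding one. Expanding the right copy of `A` produces a
factor in `x`, its left `e` being absorbed by `A` after commuting with `y`. Writing `(p + p⁻¹) A = A
(p - x)` on the left completes one side of `baxter_hecke`; the other side ends in `p - y`, which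
right multiplication by `y` scales by `-p⁻¹`. -/
theorem absorb_step {A e x y : H} {c : ℂ} {k : ℕ} (hp0 : p ≠ 0) (hp : p - p⁻¹ ≠ 0)
    (h2 : p + p⁻¹ ≠ 0) (hb : x * y * x = y * x * y) (hx : x * x = 1 + (p - p⁻¹) • x)
    (hy : y * y = 1 + (p - p⁻¹) • y) (hey : e * y = y * e) (hAe : A * e = A)
    (hAx : A * x = -p⁻¹ • A) (hA : A = c • (e * (p ^ k • 1 - qNum p k • x) * e)) :
    A * (p ^ (k + 1) • 1 - qNum p (k + 1) • y) * A * y =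
      -p⁻¹ • (A * (p ^ (k + 1) • 1 - qNum p (k + 1) • y) * A) := by
  have hc : ∀ a b : ℂ, e * (a • 1 - b • y) = (a • 1 - b • y) * e := fun a b => by
    simp only [mul_sub, sub_mul, mul_smul_comm, smul_mul_assoc, mul_one, one_mul, hey]
  have hA1 : (p + p⁻¹) • A = A * (p • 1 - x) := by
    rw [mul_sub, hAx, mul_smul_comm, mul_one]; module
  have hyy : (p • 1 - y) * y = -p⁻¹ • (p • 1 - y) := by
    simp only [sub_mul, smul_mul_assoc, one_mul, hy]
    match_scalars <;> field_simp
    ring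
  have key : (p + p⁻¹) • (A * (p ^ (k + 1) • 1 - qNum p (k + 1) • y) * A) =
      c • (A * (p ^ k • 1 - qNum p k • y) * (p ^ (k + 1) • 1 - qNum p (k + 1) • x) * e *
        (p • 1 - y)) := by
    have h1 : A * (p ^ (k + 1) • 1 - qNum p (k + 1) • y) * A =
        c • (A * (p ^ (k + 1) • 1 - qNum p (k + 1) • y) * (p ^ k • 1 - qNum p k • x) * e) := by
      nth_rewrite 2 [hA]
      rw [mul_smul_comm]
      congr 1
      rw [← mul_assoc, ← mul_assoc, mul_assoc A, ← hc, ← mul_assoc, hAe]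
    have hc' := hc p 1
    rw [one_smul] at hc'
    rw [h1, smul_comm]
    congr 1
    rw [← smul_mul_assoc, ← smul_mul_assoc, ← smul_mul_assoc, hA1, mul_assoc _ e, hc',
      ← mul_assoc, mul_assoc (A * _), mul_assoc A, mul_assoc A, mul_assoc A, ← mul_assoc (p • 1 - x),
      baxter_hecke hp0 hp hb hx hy]
    simp only [mul_assoc]
  refine smul_right_injective H h2 ?_
  dsimp only
  rw [smul_comm, ← smul_mul_assoc, key, smul_mul_assoc, mul_assoc _ (p • 1 - y), hyy,
    mul_smul_comm, smul_comm]

/-- Each middle factor of `heckeA` acts on `A` by `p^(j+1) + p⁻¹ (j+1)_p = (j+2)_p`, which cancels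
the normalization. -/
theorem absorb_mul {A : H} {k : ℕ} (hp0 : p ≠ 0) (hp : p - p⁻¹ ≠ 0)
    (hq : ∀ k, 1 ≤ k → qNum p k ≠ 0) (hA : ∀ i, i + 1 < k → A * s i = -p⁻¹ • A) :
    ∀ j, j ≤ k → A * heckeA p s j = A
  | 0, _ => mul_one _
  | 1, _ => mul_one _
  | j + 2, h => by
    have ih := absorb_mul hp0 hp hq hA (j + 1) (by omega)
    rw [heckeA, mul_smul_comm, ← mul_assoc, ← mul_assoc, ih, mul_sub, mul_smul_comm, mul_one,
      mul_smul_comm, hA j (by omega), smul_smul, ← sub_smul, smul_mul_assoc, ih, smul_smul]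
    convert one_smul ℂ A
    rw [inv_mul_eq_one₀ (hq _ (by omega)), qNum_succ hp0 hp]
    ring

theorem mul_absorb {A : H} {k : ℕ} (hp0 : p ≠ 0) (hp : p - p⁻¹ ≠ 0)
    (hq : ∀ k, 1 ≤ k → qNum p k ≠ 0) (hA : ∀ i, i + 1 < k → s i * A = -p⁻¹ • A) :
    ∀ j, j ≤ k → heckeA p s j * A = A
  | 0, _ => one_mul _
  | 1, _ => one_mul _
  | j + 2, h => by
    have ih := mul_absorb hp0 hp hq hA (j + 1) (by omega)
    rw [heckeA, smul_mul_assoc, mul_assoc, ih, mul_assoc, sub_mul, smul_mul_assoc, one_mul,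
      smul_mul_assoc, hA j (by omega), smul_smul, ← sub_smul, mul_smul_comm, ih, smul_smul]
    convert one_smul ℂ A
    rw [inv_mul_eq_one₀ (hq _ (by omega)), qNum_succ hp0 hp]
    ring

theorem HeckeSystem.commute_heckeA (h : HeckeSystem p n s) {j k : ℕ} (hk : k ≤ j)
    (hj : j + 1 < n) : heckeA p s k * s j = s j * heckeA p s k :=
  (commute_of_mem_lowAlg (fun i hi => h.comm i j (by omega) hj) (heckeA_mem k)).eq

theorem HeckeSystem.absorb (h : HeckeSystem p n s) (hp0 : p ≠ 0) (hp : p - p⁻¹ ≠ 0)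
    (hq : ∀ k, 1 ≤ k → qNum p k ≠ 0) : ∀ k, k ≤ n →
    (∀ i, i + 1 < k → heckeA p s k * s i = -p⁻¹ • heckeA p s k) ∧
    (∀ i, i + 1 < k → s i * heckeA p s k = -p⁻¹ • heckeA p s k)
  | 0, _ => ⟨fun i hi => by omega, fun i hi => by omega⟩
  | 1, _ => ⟨fun i hi => by omega, fun i hi => by omega⟩
  | 2, hn => by
    have h0 := h.quad 0 (by omega)
    have e1 : heckeA p s 2 = (qNum p 2)⁻¹ • (p • 1 - s 0) := by
      simp [heckeA, qNum_one hp]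
    constructor <;> rintro i hi <;> obtain rfl : i = 0 := by omega
    · rw [e1, smul_mul_assoc, smul_comm]
      congr 1
      simp only [sub_mul, smul_mul_assoc, one_mul, h0]
      match_scalars <;> field_simp
      ring
    · rw [e1, mul_smul_comm, smul_comm]
      congr 1
      simp only [mul_sub, mul_smul_comm, mul_one, h0]
      match_scalars <;> field_simp
      ring
  | k + 3, hn => by
    obtain ⟨hr, hl⟩ := HeckeSystem.absorb h hp0 hp hq (k + 2) (by omega)
    have h2 : p + p⁻¹ ≠ 0 := by
      rw [← qNum_two hp0 hp]; exact hq 2 (by omega)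
    have hx := h.quad k (by omega)
    have hy := h.quad (k + 1) (by omega)
    have hb := h.braid k (by omega)
    have hey := h.commute_heckeA (k := k + 1) (j := k + 1) le_rfl (by omega)
    constructor <;> rintro i hi <;> obtain hi | rfl : i < k + 1 ∨ i = k + 1 := by omega
    · rw [heckeA, smul_mul_assoc, mul_assoc, hr i (by omega), mul_smul_comm, smul_comm]
    · rw [heckeA, smul_mul_assoc, absorb_step hp0 hp h2 hb hx hy hey
        (absorb_mul hp0 hp hq hr _ (by omega)) (hr k (by omega)) (heckeA.eq_3 p s k), smul_comm]
    · rw [heckeA, mul_smul_comm, ← mul_assoc, ← mul_assoc, hl i (by omega), smul_mul_assoc,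
        smul_mul_assoc, smul_comm]
    -- All hypotheses are symmetric under reversal of products, so the left-handed statement is the
    -- right-handed one in the opposite algebra.
    · have e := absorb_step (H := Hᵐᵒᵖ) (A := .op (heckeA p s (k + 2)))
        (e := .op (heckeA p s (k + 1))) (x := .op (s k)) (y := .op (s (k + 1)))
        (c := (qNum p (k + 2))⁻¹) (k := k + 1) hp0 hp h2
        (by simp only [← MulOpposite.op_mul, ← mul_assoc, hb])
        (by rw [← MulOpposite.op_mul, hx]; simp) (by rw [← MulOpposite.op_mul, hy]; simp)
        (by simp only [← MulOpposite.op_mul, hey])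
        (by rw [← MulOpposite.op_mul, mul_absorb hp0 hp hq hl _ (by omega)])
        (by rw [← MulOpposite.op_mul, hl k (by omega), MulOpposite.op_smul])
        (by rw [heckeA]; simp [mul_assoc])
      have e' := congrArg MulOpposite.unop e
      simp only [MulOpposite.unop_mul, MulOpposite.unop_sub, MulOpposite.unop_smul,
        MulOpposite.unop_one, MulOpposite.unop_op, ← mul_assoc] at e'
      rw [heckeA, mul_smul_comm, ← mul_assoc, ← mul_assoc, e', smul_comm]

theorem HeckeSystem.heckeA_mul_self (h : HeckeSystem p n s) (hp0 : p ≠ 0) (hp : p - p⁻¹ ≠ 0)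
    (hq : ∀ k, 1 ≤ k → qNum p k ≠ 0) {k : ℕ} (hk : k ≤ n) :
    heckeA p s k * heckeA p s k = heckeA p s k :=
  absorb_mul hp0 hp hq (h.absorb hp0 hp hq k hk).1 k le_rfl

/-! ### Decomposition of a Hecke algebra over a parabolic subalgebra. -/

theorem HeckeSystem.mul_sq_mem (h : HeckeSystem p n s) {k : ℕ} (hk : k + 1 < n) {y : H}
    (hy : y ∈ lowAlg s (k + 1)) :
    y * (s k * s k) ∈ twoSidedSpan (lowAlg s (k + 1)) {s k} := by
  rw [h.quad k hk, mul_add, mul_one, mul_smul_comm, ← smul_mul_assoc]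
  refine add_mem (mem_twoSidedSpan hy) ?_
  have := mul_mem_twoSidedSpan (T := {s k}) (Subalgebra.smul_mem _ hy (p - p⁻¹))
    (Set.mem_singleton _) (one_mem _)
  rwa [mul_one] at this

/-- To rewrite `s (k+1) * y * s (k+1)`, decompose `y` one level lower: a term from the smaller
algebra commutes with `s (k+1)` and the quadratic relation applies, while a term `x * s k * y` is
handled by the braid relation. -/
theorem HeckeSystem.lowAlg_le (h : HeckeSystem p n s) : ∀ k, k + 1 < n →
    ∀ x ∈ lowAlg s (k + 2), x ∈ twoSidedSpan (lowAlg s (k + 1)) {s k}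
  | 0, hk, x, hx => by
    refine lowAlg_le_twoSidedSpan (Set.mem_singleton _) ?_ hx
    rintro _ rfl y hy
    rw [lowAlg_eq_bot le_rfl] at hy
    obtain ⟨c, rfl⟩ := Algebra.mem_bot.1 hy
    rw [← Algebra.commutes, mul_assoc]
    exact h.mul_sq_mem hk (Subalgebra.algebraMap_mem _ c)
  | k + 1, hk, x, hx => by
    refine lowAlg_le_twoSidedSpan (Set.mem_singleton _) ?_ hx
    have hc : ∀ z ∈ lowAlg s (k + 1), s (k + 1) * z = z * s (k + 1) := fun z hz =>
      (commute_of_mem_lowAlg (fun j hj => h.comm j (k + 1) (by omega) (by omega)) hz).eq.symm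
    have hle := lowAlg_mono (s := s) (Nat.le_succ (k + 1))
    rintro _ rfl y hy
    have hy' := HeckeSystem.lowAlg_le h k (by omega) y hy
    clear hy
    revert y
    refine twoSidedSpan_induction ?_ ?_ ?_
    · intro x y hx hy
      rw [mul_add, add_mul]
      exact add_mem hx hy
    · intro z hz
      rw [hc z hz, mul_assoc]
      exact h.mul_sq_mem hk (hle hz)
    · rintro x hx _ rfl y hy
      have e : s (k + 1) * (x * s k * y) * s (k + 1) = x * s k * s (k + 1) * (s k * y) := by
        calc _ = s (k + 1) * x * s k * (y * s (k + 1)) := by simp only [mul_assoc]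
          _ = x * (s (k + 1) * s k * s (k + 1)) * y := by
            rw [hc x hx, ← hc y hy]; simp only [mul_assoc]
          _ = _ := by rw [← h.braid k (by omega)]; simp only [mul_assoc]
      rw [e]
      have hs := mem_lowAlg (s := s) (show k + 1 < k + 2 by omega)
      exact mul_mem_twoSidedSpan (mul_mem (hle hx) hs) (Set.mem_singleton _)
        (mul_mem hs (hle hy))

theorem HeckeSystem.lowAlg_induction (h : HeckeSystem p n s) {k : ℕ} (hk : k + 1 < n)
    {P : H → Prop} (hadd : ∀ x y, P x → P y → P (x + y)) (h0 : ∀ x ∈ lowAlg s (k + 1), P x)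
    (h1 : ∀ x ∈ lowAlg s (k + 1), ∀ y ∈ lowAlg s (k + 1), P (x * s k * y)) :
    ∀ x ∈ lowAlg s (k + 2), P x := fun x hx =>
  twoSidedSpan_induction hadd h0 (by rintro x hx _ rfl y hy; exact h1 x hx y hy) x
    (h.lowAlg_le k hk x hx)

/-! ### Traces on Hecke algebras and the Coxeter element. -/

/-- The Coxeter type product `s_{k-1} ⋯ s_{n-2}`. -/
def tailProd (s : ℕ → H) (n k : ℕ) : H := ((List.range' (k - 1) (n - k)).map s).prod

theorem tailProd_self : tailProd s n n = 1 := by simp [tailProd]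

theorem tailProd_succ {k : ℕ} (hk : k + 1 < n) :
    tailProd s n (k + 1) = s k * tailProd s n (k + 2) := by
  simp only [tailProd]
  rw [show n - (k + 1) = (n - (k + 2)) + 1 by omega, List.range'_succ]
  simp

theorem tailProd_mem {k : ℕ} : tailProd s n (k + 1) ∈ highAlg s n k := by
  refine list_prod_mem ?_
  simp only [List.mem_map, List.mem_range'_1, forall_exists_index, and_imp]
  rintro _ i h1 h2 rfl
  exact mem_highAlg (by omega) (by omega)

theorem HeckeSystem.commute_tailProd (h : HeckeSystem p n s) {k : ℕ} {x : H}
    (hx : x ∈ lowAlg s (k + 1)) : Commute x (tailProd s n (k + 2)) := by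
  refine Commute.list_prod_right _ _ ?_
  simp only [List.mem_map, List.mem_range'_1, forall_exists_index, and_imp]
  rintro _ i h1 h2 rfl
  exact commute_of_mem_lowAlg (fun j hj => h.comm j i (by omega) (by omega)) hx

variable {Q : Type*} [AddCommGroup Q] [Module ℂ Q]

/-- Decompose `x`. The part in the smaller algebra gives a parabolic product. In a term `x * s k *
y`, the factor `y` passes through the tail and returns to the left by cyclicity, so that `s k` joins
the tail. At the bottom `x` is a scalar and the tail is the full Coxeter element. -/
theorem HeckeSystem.trace_tail_eq_zero (h : HeckeSystem p n s) {f : H →ₗ[ℂ] Q}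
    (htr : ∀ x y, f (x * y) = f (y * x))
    (hpar : ∀ k, 1 ≤ k → k < n → ∀ x ∈ lowAlg s k, ∀ y ∈ highAlg s n k, f (x * y) = 0)
    (h1 : f (tailProd s n 1) = 0) : ∀ k, k + 1 ≤ n → ∀ x ∈ lowAlg s (k + 1),
      f (x * tailProd s n (k + 1)) = 0
  | 0, _, x, hx => by
    rw [lowAlg_eq_bot le_rfl] at hx
    obtain ⟨c, rfl⟩ := Algebra.mem_bot.1 hx
    rw [← Algebra.smul_def, map_smul, h1, smul_zero]
  | k + 1, hk, x, hx => by
    revert x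
    refine h.lowAlg_induction (by omega) ?_ ?_ ?_
    · intro x y hx hy
      rw [add_mul, map_add, hx, hy, add_zero]
    · exact fun x hx => hpar (k + 1) (by omega) (by omega) x hx _ tailProd_mem
    · intro x hx y hy
      rw [mul_assoc, (h.commute_tailProd hy).eq, ← mul_assoc, htr, ← mul_assoc, ← mul_assoc,
        mul_assoc (y * x), ← tailProd_succ (by omega)]
      exact HeckeSystem.trace_tail_eq_zero h htr hpar h1 k (by omega) _ (mul_mem hy hx)

/-- Cyclicity and idempotency merge the two outer factors of the antisymmetrizer. The constant term
in the middle gives a parabolic product, and the `s k` term lengthens the tail. So the two values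
differ by the nonzero factor `-(k+1)_p / (k+2)_p`. -/
theorem HeckeSystem.trace_heckeA_tail (h : HeckeSystem p n s) (hp0 : p ≠ 0) (hp : p - p⁻¹ ≠ 0)
    (hq : ∀ k, 1 ≤ k → qNum p k ≠ 0) {f : H →ₗ[ℂ] Q} (htr : ∀ x y, f (x * y) = f (y * x))
    (hpar : ∀ k, 1 ≤ k → k < n → ∀ x ∈ lowAlg s k, ∀ y ∈ highAlg s n k, f (x * y) = 0)
    {k : ℕ} (hk : k + 1 < n)
    (h0 : f (heckeA p s (k + 2) * tailProd s n (k + 2)) = 0) :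
    f (heckeA p s (k + 1) * tailProd s n (k + 1)) = 0 := by
  have hA := heckeA_mem (p := p) (s := s) (k + 1)
  have hi := h.heckeA_mul_self hp0 hp hq (k := k + 1) (by omega)
  rw [heckeA, smul_mul_assoc, map_smul, mul_assoc, (h.commute_tailProd hA).eq, ← mul_assoc, htr,
    ← mul_assoc, ← mul_assoc, hi, mul_sub, sub_mul, map_sub, mul_smul_comm, mul_one,
    smul_mul_assoc, map_smul, hpar (k + 1) (by omega) (by omega) _ hA _ tailProd_mem, smul_zero,
    zero_sub, mul_smul_comm, smul_mul_assoc, map_smul, mul_assoc, ← tailProd_succ hk] at h0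
  simpa [hq] using h0

theorem HeckeSystem.trace_eq_zero (h : HeckeSystem p n s) (hn : 1 ≤ n) (hp0 : p ≠ 0)
    (hp : p - p⁻¹ ≠ 0) (hq : ∀ k, 1 ≤ k → qNum p k ≠ 0) {f : H →ₗ[ℂ] Q}
    (htr : ∀ x y, f (x * y) = f (y * x))
    (hpar : ∀ k, 1 ≤ k → k < n → ∀ x ∈ lowAlg s k, ∀ y ∈ highAlg s n k, f (x * y) = 0)
    (hA : f (heckeA p s n) = 0) {x : H} (hx : x ∈ lowAlg s n) : f x = 0 := by
  obtain ⟨m, rfl⟩ := Nat.exists_eq_add_of_le' hn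
  -- Descend from the top antisymmetrizer with empty tail (`d = 0`) to the trivial antisymmetrizer
  -- with the Coxeter element as tail (`d = m`).
  have h1 : ∀ d, d ≤ m → f (heckeA p s (m - d + 1) * tailProd s (m + 1) (m - d + 1)) = 0 := by
    intro d hd
    induction d with
    | zero => rwa [Nat.sub_zero, tailProd_self, mul_one]
    | succ d ih =>
      refine h.trace_heckeA_tail hp0 hp hq htr hpar (by omega) ?_
      rw [show m - (d + 1) + 2 = m - d + 1 by omega]
      exact ih (by omega)
  have h2 := h1 m le_rfl
  rw [Nat.sub_self, zero_add, heckeA, one_mul] at h2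
  have h3 := h.trace_tail_eq_zero htr hpar h2 m le_rfl x hx
  rwa [tailProd_self, mul_one] at h3

end Hecke

/-! ### Birman-Murakami-Wenzl relations -/

section BMWSystem

variable {B : Type*} [Ring B] [Algebra ℂ B] {q μ : ℂ} {n : ℕ} {s t e : ℕ → B}

/-- Generators `s i`, their inverses `t i` and the elements `e i` of an algebra satisfying
the relations of a Birman-Murakami-Wenzl algebra. -/
structure BMWSystem (q μ : ℂ) (n : ℕ) (s t e : ℕ → B) : Prop where
  q_ne_zero : q ≠ 0
  mu_ne_zero : μ ≠ 0
  q_sub_ne_zero : q - q⁻¹ ≠ 0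
  braid : ∀ i, i + 2 < n → s i * s (i + 1) * s i = s (i + 1) * s i * s (i + 1)
  comm : ∀ i j, i + 1 < j → j + 1 < n → s i * s j = s j * s i
  st : ∀ i, i + 1 < n → s i * t i = 1
  ts : ∀ i, i + 1 < n → t i * s i = 1
  e_def : ∀ i, i + 1 < n →
    e i = (μ⁻¹ * (q - q⁻¹)⁻¹) • ((q • 1 - s i) * (q⁻¹ • 1 + s i))
  es : ∀ i, i + 1 < n → e i * s i = μ • e i
  ee : ∀ i, i + 2 < n → e (i + 1) * e i = s i * s (i + 1) * e i
  ee' : ∀ i, i + 2 < n → e (i + 1) * e i = t i * t (i + 1) * e i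
  eee : ∀ i, i + 2 < n → e i * e (i + 1) * e i = e i

namespace BMWSystem

variable (h : BMWSystem q μ n s t e) {i : ℕ}
include h

/-- `e i` and `e j` are the same polynomial in `s i` and `s j`. -/
theorem e_intertwine {j : ℕ} (hi : i + 1 < n) (hj : j + 1 < n) {w : B} (hw : w * s i = s j * w) :
    w * e i = e j * w := by
  rw [h.e_def i hi, h.e_def j hj, mul_smul_comm, smul_mul_assoc]
  congr 1
  simp only [mul_add, mul_sub, add_mul, sub_mul, mul_smul_comm, smul_mul_assoc, mul_one, one_mul,
    hw, ← mul_assoc]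
  simp only [mul_assoc, hw]

theorem se (hi : i + 1 < n) : s i * e i = μ • e i := by
  rw [h.e_intertwine hi hi rfl, h.es i hi]

theorem et (hi : i + 1 < n) : e i * t i = μ⁻¹ • e i := by
  have := congrArg (fun x => μ⁻¹ • (x * t i)) (h.es i hi)
  simpa [mul_assoc, h.st i hi, smul_smul, h.mu_ne_zero] using this.symm

theorem te (hi : i + 1 < n) : t i * e i = μ⁻¹ • e i := by
  have := congrArg (fun x => μ⁻¹ • (t i * x)) (h.se hi)
  simpa [← mul_assoc, h.ts i hi, smul_smul, h.mu_ne_zero] using this.symm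

/-- The skein relation: multiply the quadratic expression defining `e i` by `t i` and use `e i * t i
= μ⁻¹ e i`; the powers of `μ` cancel. -/
theorem t_eq (hi : i + 1 < n) : t i = s i - (q - q⁻¹) • (1 - e i) := by
  have h1 := h.et hi
  have hq := h.q_sub_ne_zero
  have hq0 := h.q_ne_zero
  have hm := h.mu_ne_zero
  have h2 : (q - q⁻¹) • e i = t i - s i + (q - q⁻¹) • 1 := by
    have h3 : μ • (e i * t i) = e i := by rw [h1, smul_smul, mul_inv_cancel₀ hm, one_smul]
    have h4 : (q • 1 - s i) * (q⁻¹ • 1 + s i) * t i = t i - s i + (q - q⁻¹) • 1 := by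
      rw [mul_assoc, add_mul, h.st i hi, smul_mul_assoc, one_mul]
      simp only [mul_add, sub_mul, mul_smul_comm, smul_mul_assoc, mul_one, one_mul, h.st i hi]
      match_scalars <;> field_simp
      ring
    rw [← h3, h.e_def i hi, smul_mul_assoc, h4, smul_smul, smul_smul]
    convert one_smul ℂ _
    rw [← mul_assoc, mul_assoc _ μ, mul_inv_cancel₀ hm, mul_one, mul_inv_cancel₀ hq]
  rw [smul_sub, h2]
  abel

theorem ss (hi : i + 1 < n) : s i * s i = 1 + (q - q⁻¹) • (s i - μ • e i) := by
  have := congrArg (s i * ·) (h.t_eq hi)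
  simp only [h.st i hi, mul_sub, mul_smul_comm, mul_one, h.se hi] at this
  rw [this]
  abel

/-- Multiply the skein relation by `e i`. The coefficient is `η`, see `IsBMWType.eta_eq`. -/
theorem e_sq (hi : i + 1 < n) :
    e i * e i = (1 - (μ - μ⁻¹) * (q - q⁻¹)⁻¹) • e i := by
  have := congrArg (e i * ·) (h.t_eq hi)
  simp only [h.et hi, mul_sub, mul_smul_comm, mul_one, h.es i hi] at this
  have hq := h.q_sub_ne_zero
  refine smul_right_injective B hq ?_
  have h2 : (q - q⁻¹) • (e i * e i) = (μ⁻¹ - μ + (q - q⁻¹)) • e i := by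
    rw [add_smul, sub_smul μ⁻¹, this, smul_sub (q - q⁻¹)]; abel
  dsimp only
  rw [h2, smul_smul, mul_sub, mul_one, mul_comm (μ - μ⁻¹), ← mul_assoc, mul_inv_cancel₀ hq]
  congr 1
  ring

theorem ss_e (hi : i + 2 < n) : s i * s (i + 1) * e i = e (i + 1) * (s i * s (i + 1)) :=
  h.e_intertwine (by omega) (by omega) (by rw [h.braid i hi, mul_assoc])

theorem tt_s (hi : i + 2 < n) : t i * t (i + 1) * s i = s (i + 1) * (t i * t (i + 1)) := by
  have hb := h.braid i hi
  have e1 : s (i + 1) * s i = t i * (s (i + 1) * s i * s (i + 1)) := by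
    rw [← hb, ← mul_assoc, ← mul_assoc, h.ts i (by omega), one_mul]
  calc _ = t i * t (i + 1) * s i * (s (i + 1) * (s i * t i) * t (i + 1)) := by
        rw [h.st i (by omega), mul_one, h.st (i + 1) (by omega), mul_one]
    _ = t i * t (i + 1) * (s i * s (i + 1) * s i) * (t i * t (i + 1)) := by
        simp only [mul_assoc]
    _ = t i * (t (i + 1) * s (i + 1)) * (s i * s (i + 1)) * (t i * t (i + 1)) := by
        rw [hb]; simp only [mul_assoc]
    _ = (t i * s i) * s (i + 1) * (t i * t (i + 1)) := by
        rw [h.ts (i + 1) (by omega)]; simp only [mul_assoc, one_mul]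
    _ = _ := by rw [h.ts i (by omega), one_mul]

theorem tt_e (hi : i + 2 < n) : t i * t (i + 1) * e i = e (i + 1) * (t i * t (i + 1)) :=
  h.e_intertwine (by omega) (by omega) (h.tt_s hi)

theorem e_s_s (hi : i + 2 < n) : e (i + 1) * s i * s (i + 1) = e (i + 1) * e i := by
  rw [h.ee i hi, h.ss_e hi, mul_assoc]

theorem e_e_s (hi : i + 2 < n) : e (i + 1) * e i * s (i + 1) = e (i + 1) * t i := by
  rw [h.ee' i hi, h.tt_e hi, mul_assoc, mul_assoc, h.ts (i + 1) (by omega), mul_one]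

theorem s_e_s (hi : i + 2 < n) :
    s (i + 1) * e i * s (i + 1) = t i * e (i + 1) * t i := by
  have := h.e_e_s hi
  rw [mul_assoc (t i), ← this, h.ee i hi, ← mul_assoc, ← mul_assoc, ← mul_assoc,
    h.ts i (by omega), one_mul]

theorem e_s_e_low (hi : i + 2 < n) : e i * s (i + 1) * e i = μ⁻¹ • e i := by
  have h1 := h.eee i hi
  rw [mul_assoc, h.ee i hi, ← mul_assoc, ← mul_assoc, h.es i (by omega), smul_mul_assoc,
    smul_mul_assoc] at h1
  nth_rewrite 3 [← h1]
  rw [smul_smul, inv_mul_cancel₀ h.mu_ne_zero, one_smul]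

/-- Derived from `e_s_e_low`, which has the lower index outside. Conjugation by `s i * s (i + 1)`
carries `e i` to `e (i + 1)`; the middle then becomes `s i * s (i + 1) * t i`, whose outer factors
contribute `μ` and `μ⁻¹` against the adjacent `e i`. -/
theorem e_s_e (hi : i + 2 < n) : e (i + 1) * s i * e (i + 1) = μ⁻¹ • e (i + 1) := by
  have hst := h.st i (by omega)
  have hst' := h.st (i + 1) (by omega)
  have hts := h.ts i (by omega)
  have hts' := h.ts (i + 1) (by omega)
  have hse := h.ss_e hi
  have e1 : e (i + 1) = s i * s (i + 1) * e i * t (i + 1) * t i := by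
    rw [hse]
    simp only [mul_assoc]
    rw [← mul_assoc (s (i + 1)), hst', one_mul, hst, mul_one]
  have e2 : t (i + 1) * s i * s (i + 1) = s i * s (i + 1) * t i := by
    calc _ = t (i + 1) * (s i * s (i + 1) * s i) * t i := by
          simp only [mul_assoc]; rw [hst, mul_one]
      _ = _ := by rw [h.braid i hi]; simp only [← mul_assoc]; rw [hts', one_mul]
  have e3 : e i * (t (i + 1) * s i * s (i + 1)) * e i = μ⁻¹ • e i := by
    rw [e2]
    calc _ = (e i * s i) * s (i + 1) * (t i * e i) := by simp only [mul_assoc]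
      _ = _ := by
        rw [h.es i (by omega), h.te (by omega)]
        simp only [smul_mul_assoc, mul_smul_comm, smul_smul, mul_inv_cancel₀ h.mu_ne_zero,
          mul_one, h.e_s_e_low hi]
  rw [e1]
  calc _ = s i * s (i + 1) * e i * t (i + 1) * (t i * s i) * s i * s (i + 1) * e i *
        t (i + 1) * t i := by simp only [mul_assoc]
    _ = s i * s (i + 1) * (e i * (t (i + 1) * s i * s (i + 1)) * e i) * t (i + 1) * t i := by
        rw [hts, mul_one]; simp only [mul_assoc]
    _ = _ := by rw [e3, mul_smul_comm, smul_mul_assoc, smul_mul_assoc]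

theorem e_e_e (hi : i + 2 < n) : e (i + 1) * e i * e (i + 1) = e (i + 1) := by
  rw [← h.e_s_s hi, mul_assoc, h.se (by omega), mul_smul_comm, h.e_s_e hi, smul_smul,
    mul_inv_cancel₀ h.mu_ne_zero, one_smul]

/-! ### Decomposition of a BMW algebra and the corner cut out by the last `e`. -/

theorem e_mem {k : ℕ} (hi : i + 1 < k) (hk : k ≤ n) : e i ∈ lowAlg s k := by
  rw [h.e_def i (by omega)]
  exact Subalgebra.smul_mem _ (mul_mem
    (sub_mem (Subalgebra.smul_mem _ (one_mem _) _) (mem_lowAlg hi))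
    (add_mem (Subalgebra.smul_mem _ (one_mem _) _) (mem_lowAlg hi))) _

theorem t_mem {k : ℕ} (hi : i + 1 < k) (hk : k ≤ n) : t i ∈ lowAlg s k := by
  rw [h.t_eq (by omega)]
  exact sub_mem (mem_lowAlg hi)
    (Subalgebra.smul_mem _ (sub_mem (one_mem _) (h.e_mem hi hk)) _)

theorem commute_s {k : ℕ} (hk : k + 1 < n) {x : B} (hx : x ∈ lowAlg s k) : x * s k = s k * x :=
  (commute_of_mem_lowAlg (fun j hj => h.comm j k (by omega) hk) hx).eq

theorem commute_e {k : ℕ} (hk : k + 1 < n) {x : B} (hx : x ∈ lowAlg s k) : x * e k = e k * x :=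
  h.e_intertwine hk hk (h.commute_s hk hx)

/-- `e_k x s_k ∈ e_k W_{k+1}` for `x ∈ W_{k+1}`, given the decomposition of `W_{k+1}`. -/
theorem exists_e_mul_s {k : ℕ} (hk : k + 2 < n) {y : B}
    (hy : y ∈ twoSidedSpan (lowAlg s (k + 1)) {s k, e k}) :
    ∃ x ∈ lowAlg s (k + 2), e (k + 1) * y * s (k + 1) = e (k + 1) * x := by
  have hle := lowAlg_mono (s := s) (Nat.le_succ (k + 1))
  have hE := h.e_mem (i := k) (k := k + 2) (by omega) (by omega)
  have hT := h.t_mem (i := k) (k := k + 2) (by omega) (by omega)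
  revert y
  change ∀ y ∈ _, _
  refine twoSidedSpan_induction ?_ ?_ ?_
  · rintro x y ⟨x', hx', ex⟩ ⟨y', hy', ey⟩
    exact ⟨x' + y', add_mem hx' hy', by rw [mul_add, add_mul, ex, ey, mul_add]⟩
  · intro x hx
    refine ⟨μ • x, Subalgebra.smul_mem _ (hle hx) _, ?_⟩
    rw [mul_assoc, h.commute_s (by omega) hx, ← mul_assoc, h.es _ (by omega), smul_mul_assoc,
      mul_smul_comm]
  · rintro x hx z hz y hy
    have e1 : ∀ z, e (k + 1) * (x * z * y) * s (k + 1) = x * (e (k + 1) * z * s (k + 1)) * y := by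
      intro z
      simp only [mul_assoc]
      rw [h.commute_s (by omega) hy]
      simp only [← mul_assoc]
      rw [h.commute_e (by omega) hx]
    obtain rfl | rfl := hz
    · refine ⟨x * e k * y, mul_mem (mul_mem (hle hx) hE) (hle hy), ?_⟩
      rw [e1, h.e_s_s hk]
      simp only [← mul_assoc]
      rw [h.commute_e (by omega) hx]
    · refine ⟨x * t k * y, mul_mem (mul_mem (hle hx) hT) (hle hy), ?_⟩
      rw [e1, h.e_e_s hk]
      simp only [← mul_assoc]
      rw [h.commute_e (by omega) hx]

theorem s_mul_s_mem {k : ℕ} (hk : k + 2 < n) {y : B}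
    (hy : y ∈ twoSidedSpan (lowAlg s (k + 1)) {s k, e k}) :
    s (k + 1) * y * s (k + 1) ∈ twoSidedSpan (lowAlg s (k + 2)) {s (k + 1), e (k + 1)} := by
  have hle := lowAlg_mono (s := s) (Nat.le_succ (k + 1))
  have hS := mem_lowAlg (s := s) (i := k) (k := k + 2) (by omega)
  have hT := h.t_mem (i := k) (k := k + 2) (by omega) (by omega)
  revert y
  change ∀ y ∈ _, _
  refine twoSidedSpan_induction ?_ ?_ ?_
  · intro x y hx hy
    rw [mul_add, add_mul]; exact add_mem hx hy
  · intro x hx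
    rw [← h.commute_s (by omega) hx, mul_assoc, h.ss (by omega)]
    refine mul_left_mem_twoSidedSpan (hle hx) (add_mem (mem_twoSidedSpan (one_mem _)) ?_)
    have m1 := mul_mem_twoSidedSpan (L := lowAlg s (k + 2)) (T := {s (k + 1), e (k + 1)})
      (Subalgebra.smul_mem _ (one_mem _) (q - q⁻¹)) (Or.inl rfl) (one_mem _)
    have m2 := mul_mem_twoSidedSpan (L := lowAlg s (k + 2)) (T := {s (k + 1), e (k + 1)})
      (Subalgebra.smul_mem _ (one_mem _) (-((q - q⁻¹) * μ))) (Or.inr rfl) (one_mem _)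
    convert add_mem m1 m2 using 1
    simp only [smul_mul_assoc, one_mul, mul_one]
    module
  · rintro x hx z hz y hy
    have e1 : ∀ z, s (k + 1) * (x * z * y) * s (k + 1) = x * (s (k + 1) * z * s (k + 1)) * y := by
      intro z
      simp only [mul_assoc]
      rw [h.commute_s (by omega) hy]
      simp only [← mul_assoc]
      rw [h.commute_s (by omega) hx]
    obtain rfl | rfl := hz
    · rw [e1, ← h.braid k hk]
      have := mul_mem_twoSidedSpan (mul_mem (hle hx) hS)
        (Set.mem_insert (s (k + 1)) {e (k + 1)}) (mul_mem hS (hle hy))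
      simpa only [mul_assoc] using this
    · rw [e1, h.s_e_s hk]
      have := mul_mem_twoSidedSpan (mul_mem (hle hx) hT)
        (show e (k + 1) ∈ {s (k + 1), e (k + 1)} from Or.inr rfl) (mul_mem hT (hle hy))
      simpa only [mul_assoc] using this

/-- The Hecke pattern with the extra middle element `e k`. The new products are `e y s`, shortened
by `exists_e_mul_s`, and `s e s = t e t`, treated in `s_mul_s_mem`. Both take the decomposition one
level down as a hypothesis, supplied here by induction. -/
theorem lowAlg_le : ∀ k, k + 1 < n →
    ∀ x ∈ lowAlg s (k + 2), x ∈ twoSidedSpan (lowAlg s (k + 1)) {s k, e k}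
  | 0, hk, x, hx => by
    refine lowAlg_le_twoSidedSpan (Set.mem_insert _ _) ?_ hx
    have hone := one_mem (lowAlg s 1)
    rintro z hz y hy
    rw [lowAlg_eq_bot le_rfl] at hy
    obtain ⟨c, rfl⟩ := Algebra.mem_bot.1 hy
    have hc : algebraMap ℂ B c ∈ lowAlg s 1 := Subalgebra.algebraMap_mem _ c
    rw [← Algebra.commutes, mul_assoc]
    refine mul_left_mem_twoSidedSpan hc ?_
    obtain rfl | rfl := hz
    · rw [h.ss (by omega)]
      refine add_mem (mem_twoSidedSpan (one_mem _)) ?_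
      have m1 := mul_mem_twoSidedSpan (L := lowAlg s 1) (T := {s 0, e 0})
        (Subalgebra.smul_mem _ (one_mem _) (q - q⁻¹)) (Or.inl rfl) (one_mem _)
      have m2 := mul_mem_twoSidedSpan (L := lowAlg s 1) (T := {s 0, e 0})
        (Subalgebra.smul_mem _ (one_mem _) (-((q - q⁻¹) * μ))) (Or.inr rfl) (one_mem _)
      convert add_mem m1 m2 using 1
      simp only [smul_mul_assoc, one_mul, mul_one]
      module
    · rw [h.es _ (by omega)]
      have m2 := mul_mem_twoSidedSpan (L := lowAlg s 1) (T := {s 0, e 0})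
        (Subalgebra.smul_mem _ (one_mem _) μ) (Or.inr rfl) (one_mem _)
      simpa only [smul_mul_assoc, one_mul, mul_one] using m2
  | k + 1, hk, x, hx => by
    refine lowAlg_le_twoSidedSpan (Set.mem_insert _ _) ?_ hx
    rintro z hz y hy
    have hy' := BMWSystem.lowAlg_le k (by omega) y hy
    obtain rfl | rfl := hz
    · exact h.s_mul_s_mem hk hy'
    · obtain ⟨x, hx, ex⟩ := h.exists_e_mul_s hk hy'
      rw [ex]
      have := mul_mem_twoSidedSpan (one_mem _)
        (show e (k + 1) ∈ {s (k + 1), e (k + 1)} from Or.inr rfl) hx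
      rwa [one_mul] at this

theorem exists_e_mul {k : ℕ} (hk : k + 1 < n) {x : B} (hx : x ∈ lowAlg s (k + 2)) :
    ∃ y ∈ lowAlg s (k + 1), e k * x = e k * y := by
  -- The prefix `u` lets the generators of `x` be absorbed one at a time, each result serving as the
  -- next prefix.
  suffices ∀ u ∈ lowAlg s (k + 1), ∃ y ∈ lowAlg s (k + 1), e k * (u * x) = e k * y by
    simpa using this 1 (one_mem _)
  induction hx using Algebra.adjoin_induction with
  | mem x hx =>
    obtain ⟨i, hi, rfl⟩ := hx
    intro u hu
    obtain hi | rfl : i + 1 < k + 1 ∨ i = k := by omega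
    · exact ⟨_, mul_mem hu (mem_lowAlg hi), rfl⟩
    · cases i with
      | zero =>
        rw [lowAlg_eq_bot le_rfl] at hu
        obtain ⟨c, rfl⟩ := Algebra.mem_bot.1 hu
        refine ⟨_, Subalgebra.smul_mem _ (Subalgebra.algebraMap_mem _ c) μ, ?_⟩
        rw [← Algebra.smul_def, mul_smul_comm, h.es _ hk, Algebra.algebraMap_eq_smul_one]
        simp only [mul_smul_comm, mul_one, smul_comm c]
      | succ k =>
        obtain ⟨x, hx, ex⟩ := h.exists_e_mul_s hk (h.lowAlg_le k (by omega) u hu)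
        exact ⟨x, hx, by rw [← ex, mul_assoc]⟩
  | algebraMap c =>
    exact fun u hu => ⟨_, mul_mem hu (Subalgebra.algebraMap_mem _ c), rfl⟩
  | add x y _ _ hx hy =>
    intro u hu
    obtain ⟨x', hx', ex⟩ := hx u hu
    obtain ⟨y', hy', ey⟩ := hy u hu
    exact ⟨_, add_mem hx' hy', by rw [mul_add, mul_add, ex, ey, mul_add]⟩
  | mul x y _ _ hx hy =>
    intro u hu
    obtain ⟨x', hx', ex⟩ := hx u hu
    obtain ⟨y', hy', ey⟩ := hy x' hx'
    refine ⟨y', hy', ?_⟩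
    rw [← ey, ← mul_assoc, ← mul_assoc, mul_assoc _ u, ex, mul_assoc]

/-- Decompose `x`: the outer factors commute with the last `e`, and sandwiching 1, the preceding `s`
or the preceding `e` between two copies of it gives that `e` times `η`, `μ⁻¹` or 1. -/
theorem exists_e_mul_e_of_low {k : ℕ} (hk : k + 1 < n) {x : B} (hx : x ∈ lowAlg s (k + 1)) :
    ∃ y ∈ lowAlg s k, e k * x * e k = y * e k := by
  cases k with
  | zero =>
    rw [lowAlg_eq_bot le_rfl] at hx
    obtain ⟨c, rfl⟩ := Algebra.mem_bot.1 hx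
    refine ⟨(1 - (μ - μ⁻¹) * (q - q⁻¹)⁻¹) • algebraMap ℂ B c,
      Subalgebra.smul_mem _ (Subalgebra.algebraMap_mem _ c) _, ?_⟩
    rw [← Algebra.commutes, mul_assoc, h.e_sq hk, mul_smul_comm, smul_mul_assoc]
  | succ k =>
    have hx' := h.lowAlg_le k (by omega) x hx
    clear hx
    revert x
    change ∀ x ∈ _, _
    refine twoSidedSpan_induction ?_ ?_ ?_
    · rintro x y ⟨x', hx', ex⟩ ⟨y', hy', ey⟩
      exact ⟨x' + y', add_mem hx' hy', by rw [mul_add, add_mul, ex, ey, add_mul]⟩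
    · intro x hx
      refine ⟨(1 - (μ - μ⁻¹) * (q - q⁻¹)⁻¹) • x, Subalgebra.smul_mem _ hx _, ?_⟩
      rw [← h.commute_e hk hx, mul_assoc, h.e_sq hk, mul_smul_comm, smul_mul_assoc]
    · rintro x hx z hz y hy
      have e1 : ∀ z, e (k + 1) * (x * z * y) * e (k + 1) =
          x * (e (k + 1) * z * e (k + 1)) * y := by
        intro z
        simp only [mul_assoc]
        rw [h.commute_e (by omega) hy]
        simp only [← mul_assoc]
        rw [h.commute_e (by omega) hx]
      obtain rfl | rfl := hz
      · refine ⟨_, Subalgebra.smul_mem _ (mul_mem hx hy) μ⁻¹, ?_⟩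
        rw [e1, h.e_s_e hk, mul_smul_comm, smul_mul_assoc, smul_mul_assoc, mul_assoc, mul_assoc,
          h.commute_e hk hy]
      · refine ⟨_, mul_mem hx hy, ?_⟩
        rw [e1, h.e_e_e hk, mul_assoc, mul_assoc, h.commute_e hk hy]

/-- `e_k W_{k+2} e_k ⊆ W_k e_k`. -/
theorem exists_e_mul_e {k : ℕ} (hk : k + 1 < n) {x : B} (hx : x ∈ lowAlg s (k + 2)) :
    ∃ y ∈ lowAlg s k, e k * x * e k = y * e k := by
  obtain ⟨y, hy, ey⟩ := h.exists_e_mul hk hx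
  rw [ey]
  exact h.exists_e_mul_e_of_low hk hy

end BMWSystem

end BMWSystem

/-! ### Operators with coefficients -/

section Coeff

variable {N k l m n : ℕ} {A : Type*} [Ring A] [Algebra ℂ A]

theorem scal_mul (X Y : Op N n ℂ) : scal A (X * Y) = scal A X * scal A Y := Matrix.map_mul

theorem scal_one : scal A (1 : Op N n ℂ) = 1 := Matrix.map_one _ (map_zero _) (map_one _)

theorem scal_add (X Y : Op N n ℂ) : scal A (X + Y) = scal A X + scal A Y :=
  Matrix.map_add _ (map_add _) _ _

theorem scal_smul (c : ℂ) (X : Op N n ℂ) : scal A (c • X) = c • scal A X := by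
  ext i j
  simp only [scal, Matrix.map_apply, Matrix.smul_apply, smul_eq_mul, map_mul, ← Algebra.smul_def]

theorem scal_apply (X : Op N n ℂ) (i j : Fin n → Fin N) :
    scal A X i j = algebraMap ℂ A (X i j) := rfl

theorem scal_embed (e : Fin k → Fin n) (X : Op N k ℂ) :
    scal A (embed e X) = embed e (scal A X) := by
  ext i j
  simp only [scal, embed, Matrix.map_apply, Matrix.of_apply]
  split_ifs <;> simp

/-- Disjoint supports do not suffice over a noncommutative `A`; the second operator is numerical, so
its entries are central. -/
theorem embed_commute_scal (e : Fin k → Fin n) (f : Fin l → Fin n) (he : e.Injective)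
    (hf : f.Injective) (hef : Disjoint (Set.range e) (Set.range f)) (X : Op N k A)
    (Y : Op N l ℂ) : Commute (embed e X) (scal A (embed f Y)) := by
  classical
  rw [scal_embed, Commute, SemiconjBy]
  ext i j
  rw [embed_mul_apply_of_disjoint e f he hef, embed_mul_apply_of_disjoint f e hf hef.symm,
    scal_apply, Algebra.commutes]
  congr 1
  exact propext ⟨fun h s a b => h s b a, fun h s a b => h s b a⟩

theorem commute_embed {e : Fin k → Fin n} (he : e.Injective) {X Y : Op N k A} (h : Commute X Y) :
    Commute (embed e X) (embed e Y) := by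
  rw [Commute, SemiconjBy, ← embed_mul e he, ← embed_mul e he, h.eq]

theorem commute_scal {X Y : Op N n ℂ} (h : Commute X Y) :
    Commute (scal A X) (scal A Y) := by
  rw [Commute, SemiconjBy, ← scal_mul, ← scal_mul, h.eq]

/-- The operator `X` in the tensor factors `i + 1, i + 2`, or `0` if there are no such factors. -/
def legT (n i : ℕ) (X : Op N 2 ℂ) : Op N n ℂ := if h : i + 1 < n then leg n i h X else 0

theorem legT_of_lt {i : ℕ} (h : i + 1 < n) (X : Op N 2 ℂ) : legT n i X = leg n i h X := dif_pos h

theorem legT_two (X : Op N 2 ℂ) : legT 2 0 X = X := by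
  rw [legT_of_lt (by omega)]
  change embed (pos 2 0 _) X = X
  have : pos 2 0 (by omega) = id := by
    funext a; fin_cases a <;> rfl
  rw [this]
  ext i j
  simp [embed]

theorem legT_mul (i : ℕ) (X Y : Op N 2 ℂ) : legT n i (X * Y) = legT n i X * legT n i Y := by
  unfold legT
  split_ifs <;> simp

theorem legT_one {i : ℕ} (h : i + 1 < n) : legT n i (1 : Op N 2 ℂ) = 1 := by
  rw [legT_of_lt h, map_one]

theorem legT_commute {i j : ℕ} (h : i + 1 < j) (X Y : Op N 2 ℂ) :
    Commute (legT n i X) (legT n j Y) := by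
  unfold legT
  split_ifs
  · exact leg_commute n i j _ _ h X Y
  · simp
  · simp
  · simp

theorem embed_leg {e : Fin m → Fin n} {i j : ℕ} (hi : i + 1 < m) (hj : j + 1 < n)
    (he : e.Injective) (h0 : (e ⟨i, by omega⟩ : ℕ) = j) (h1 : (e ⟨i + 1, hi⟩ : ℕ) = j + 1)
    (X : Op N 2 ℂ) : embed e (legT m i X) = legT n j X := by
  rw [legT_of_lt hi, legT_of_lt hj]
  refine (embed_embed _ _ he X).trans ?_
  change embed _ X = embed _ X
  congr 1
  funext a
  fin_cases a <;> ext <;> simp [pos, h0, h1]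

theorem embed_castLE_legT (h : m ≤ n) {i : ℕ} (hi : i + 1 < m) (X : Op N 2 ℂ) :
    embed (Fin.castLE h) (legT m i X) = legT n i X :=
  embed_leg hi (by omega) (Fin.castLE_injective h) rfl rfl X

theorem embed_castSucc_legT {i : ℕ} (hi : i + 1 < m) (X : Op N 2 ℂ) :
    embed (Fin.castSucc) (legT m i X) = legT (m + 1) i X :=
  embed_leg hi (by omega) (Fin.castSucc_injective m) rfl rfl X

/-- A relation between operators in three consecutive tensor factors. -/
theorem legT_relation {i : ℕ} (hi : i + 2 < n) {X Y Z X' Y' Z' : Op N 2 ℂ} :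
    (leg₁ X * leg₂ Y * leg₁ Z = leg₂ X' * leg₁ Y' * leg₂ Z' →
      legT n i X * legT n (i + 1) Y * legT n i Z =
        legT n (i + 1) X' * legT n i Y' * legT n (i + 1) Z') ∧
    (leg₂ X * leg₁ Y * leg₂ Z = leg₁ X' * leg₂ Y' * leg₁ Z' →
      legT n (i + 1) X * legT n i Y * legT n (i + 1) Z =
        legT n i X' * legT n (i + 1) Y' * legT n i Z') := by
  constructor <;> intro h
  all_goals
    have h := congrArg (embedHom (pos3 n i hi) (pos3_injective n i hi)) h
    simp only [map_mul, embedHom_pos3_leg_zero, embedHom_pos3_leg_one] at h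
    rw [legT_of_lt (by omega), legT_of_lt (by omega), legT_of_lt (by omega),
      legT_of_lt (by omega), legT_of_lt (by omega), legT_of_lt (by omega)]
    exact h

end Coeff

/-! ### Matrix copies -/

section Copies

variable {N k m n : ℕ} {A : Type*} [Ring A] [Algebra ℂ A] {F R : Op N 2 ℂ}
  {M : Matrix (Fin N) (Fin N) A}

/-- The matrix copy number `i`, or `1` if `n ≤ i`. -/
def mcopyT (F : Op N 2 ℂ) (M : Matrix (Fin N) (Fin N) A) (n i : ℕ) : Op N n A :=
  if h : i < n then mcopy F M n i h else 1

theorem mcopyT_of_lt {i : ℕ} (h : i < n) : mcopyT F M n i = mcopy F M n i h := dif_pos h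

theorem mcopyT_zero (h : 0 < n) : mcopyT F M n 0 =
    embed (fun _ : Fin 1 => ⟨0, h⟩) (Matrix.of fun a b => M (a 0) (b 0)) := by
  rw [mcopyT_of_lt h]; rfl

theorem mcopyT_succ {i : ℕ} (h : i + 1 < n) : mcopyT F M n (i + 1) =
    scal A (legT n i F) * mcopyT F M n i * scal A (legT n i F⁻¹) := by
  rw [mcopyT_of_lt h, mcopyT_of_lt (Nat.lt_of_succ_lt h), legT_of_lt h, legT_of_lt h]; rfl

theorem embed_castLE_mcopyT (h : m ≤ n) : ∀ {i : ℕ}, i < m →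
    embed (Fin.castLE h) (mcopyT F M m i) = mcopyT F M n i
  | 0, hi => by
    rw [mcopyT_zero hi, mcopyT_zero (by omega), embed_embed _ _ (Fin.castLE_injective h)]
    rfl
  | i + 1, hi => by
    rw [mcopyT_succ hi, mcopyT_succ (by omega), embed_mul _ (Fin.castLE_injective h),
      embed_mul _ (Fin.castLE_injective h), embed_castLE_mcopyT h (by omega), ← scal_embed,
      ← scal_embed, embed_castLE_legT h hi, embed_castLE_legT h hi]

/-- The product of the matrix copies number `a, …, a + b - 1`. -/
def mprod (F : Op N 2 ℂ) (M : Matrix (Fin N) (Fin N) A) (n a b : ℕ) : Op N n A :=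
  ((List.range b).map fun i => mcopyT F M n (a + i)).prod

theorem mprod_zero (a : ℕ) : mprod F M n a 0 = 1 := rfl

theorem mprod_succ (a b : ℕ) : mprod F M n a (b + 1) = mprod F M n a b * mcopyT F M n (a + b) := by
  simp [mprod, List.range_succ]

theorem mprod_add (a b : ℕ) : mprod F M n 0 (a + b) = mprod F M n 0 a * mprod F M n a b := by
  induction b with
  | zero => rw [mprod_zero, mul_one, add_zero]
  | succ b ih => rw [← add_assoc, mprod_succ, ih, mprod_succ, mul_assoc, zero_add]

theorem mstring_eq_mprod : mstring F M n = mprod F M n 0 n := by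
  rw [mstring, mprod]
  congr 1
  refine List.ext_getElem (by simp) ?_
  intro i h1 h2
  simp only [List.length_ofFn] at h1
  simp [mcopyT_of_lt h1]

theorem embed_castLE_mprod (h : m ≤ n) {b : ℕ} (hb : b ≤ m) :
    embed (Fin.castLE h) (mprod F M m 0 b) = mprod F M n 0 b := by
  induction b with
  | zero => rw [mprod_zero, mprod_zero, embed_one]
  | succ b ih =>
    rw [mprod_succ, mprod_succ, embed_mul _ (Fin.castLE_injective h), ih (by omega),
      embed_castLE_mcopyT h (by omega)]

/-! ### Commutation of R-matrices with matrix copies. -/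

theorem legT_commute_mcopyT_zero {i : ℕ} (hi : i + 2 < n) (X : Op N 2 ℂ) :
    Commute (scal A (legT n (i + 1) X)) (mcopyT F M n 0) := by
  rw [mcopyT_zero (by omega), legT_of_lt (by omega)]
  refine (embed_commute_scal _ _ (Function.injective_of_subsingleton _)
    (pos_injective n (i + 1) (by omega)) ?_ _ _).symm
  rw [Set.disjoint_left]
  rintro _ ⟨a, rfl⟩ ⟨b, hb⟩
  fin_cases b <;> simp [pos] at hb

/-- The copy number `j` involves only the tensor factors `0, …, j`. -/
theorem legT_commute_mcopyT_of_lt {i : ℕ} (hi : i + 1 < n) (X : Op N 2 ℂ) : ∀ {j : ℕ}, j < i →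
    Commute (scal A (legT n i X)) (mcopyT F M n j)
  | 0, hj => by
    obtain ⟨i, rfl⟩ := Nat.exists_eq_succ_of_ne_zero hj.ne'
    exact legT_commute_mcopyT_zero (by omega) X
  | j + 1, hj => by
    rw [mcopyT_succ (by omega)]
    exact ((commute_scal (legT_commute hj _ _).symm).mul_right
      (legT_commute_mcopyT_of_lt hi X (by omega))).mul_right
        (commute_scal (legT_commute hj _ _).symm)

theorem scal_legT_mul_inv (hF : IsUnit F) {i : ℕ} (hi : i + 1 < n) :
    scal A (legT n i F) * scal A (legT n i F⁻¹) = 1 := by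
  rw [← scal_mul, ← legT_mul, Matrix.mul_nonsing_inv F ((Matrix.isUnit_iff_isUnit_det F).1 hF),
    legT_one hi, scal_one]

theorem scal_legT_inv_mul (hF : IsUnit F) {i : ℕ} (hi : i + 1 < n) :
    scal A (legT n i F⁻¹) * scal A (legT n i F) = 1 := by
  rw [← scal_mul, ← legT_mul, Matrix.nonsing_inv_mul F ((Matrix.isUnit_iff_isUnit_det F).1 hF),
    legT_one hi, scal_one]

/-- If `w x = y w` and `w v = 1 = v w`, then `x v = v y`. -/
theorem mul_eq_of_intertwine {S : Type*} [Ring S] {x y v w : S} (h : w * x = y * w)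
    (h1 : w * v = 1) (h2 : v * w = 1) : x * v = v * y := by
  calc x * v = v * (w * x) * v := by rw [← mul_assoc, h2, one_mul]
    _ = v * y * (w * v) := by rw [h]; simp only [mul_assoc]
    _ = v * y := by rw [h1, mul_one]

theorem intertwine_legT {R' F' : Op N 2 ℂ} {i : ℕ} (hi : i + 2 < n)
    (h : leg₂ R' * leg₁ F' * leg₂ F' = leg₁ F' * leg₂ F' * leg₁ R') :
    scal A (legT n (i + 1) R') * (scal A (legT n i F') * scal A (legT n (i + 1) F')) =
      scal A (legT n i F') * scal A (legT n (i + 1) F') * scal A (legT n i R') := by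
  have := congrArg (scal A) ((legT_relation hi).2 h)
  simpa only [scal_mul, mul_assoc] using this

theorem intertwine_legT' {R' F' : Op N 2 ℂ} {i : ℕ} (hi : i + 2 < n)
    (h : leg₁ R' * leg₂ F' * leg₁ F' = leg₂ F' * leg₁ F' * leg₂ R') :
    scal A (legT n i R') * (scal A (legT n (i + 1) F') * scal A (legT n i F')) =
      scal A (legT n (i + 1) F') * scal A (legT n i F') * scal A (legT n (i + 1) R') := by
  have := congrArg (scal A) ((legT_relation hi).1 h)
  simpa only [scal_mul, mul_assoc] using this

theorem commute_conj {S : Type*} [Ring S] {x y v w z : S} (hw : y * w = w * x)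
    (h1 : w * v = 1) (h2 : v * w = 1) (hz : Commute x z) : Commute y (w * z * v) := by
  have hv := mul_eq_of_intertwine hw.symm h1 h2
  rw [Commute, SemiconjBy, ← mul_assoc, ← mul_assoc, hw, mul_assoc w, hz.eq, mul_assoc _ v, ← hv]
  simp only [mul_assoc]

/-- Copy `i + 2` is copy `i` conjugated by `F_{i+1} F_i`. The same conjugation carries `R_{i+1}`,
which commutes with copy `i`, to `R_i`. -/
theorem legT_commute_mcopyT_add_two (hF : IsUnit F) (hRF : Compatible R F) {i : ℕ}
    (hi : i + 2 < n) : Commute (scal A (legT n i R)) (mcopyT F M n (i + 2)) := by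
  have h1 := scal_legT_mul_inv (A := A) hF (i := i) (n := n) (by omega)
  have h2 := scal_legT_mul_inv (A := A) hF (i := i + 1) (n := n) (by omega)
  have h3 := scal_legT_inv_mul (A := A) hF (i := i) (n := n) (by omega)
  have h4 := scal_legT_inv_mul (A := A) hF (i := i + 1) (n := n) (by omega)
  rw [mcopyT_succ (by omega), mcopyT_succ (by omega)]
  have := commute_conj (v := scal A (legT n i F⁻¹) * scal A (legT n (i + 1) F⁻¹))
    (intertwine_legT' (A := A) hi hRF.1)
    (by rw [← mul_assoc, mul_assoc _ (scal A (legT n i F)), h1, mul_one, h2])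
    (by rw [← mul_assoc, mul_assoc _ (scal A (legT n (i + 1) F⁻¹)), h4, mul_one, h3])
    (legT_commute_mcopyT_of_lt (F := F) (M := M) (i := i + 1) (j := i) (by omega) R (by omega))
  simpa only [mul_assoc] using this

theorem legT_commute_mcopyT_of_gt (hF : IsUnit F) (hRF : Compatible R F) {i j : ℕ}
    (hij : i + 2 ≤ j) (hj : j < n) : Commute (scal A (legT n i R)) (mcopyT F M n j) := by
  induction j, hij using Nat.le_induction with
  | base => exact legT_commute_mcopyT_add_two hF hRF hj
  | succ j hij ih =>
    rw [mcopyT_succ hj]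
    exact ((commute_scal (legT_commute hij _ _)).mul_right (ih (by omega))).mul_right
      (commute_scal (legT_commute hij _ _))

/-- Conjugation by `F_i F_{i+1}` carries `R_i` to `R_{i+1}` and the product of copies `i, i+1` to
that of copies `i+1, i+2`, so the defining relation propagates. -/
theorem legT_commute_mcopyT_mul (hF : IsRMatrix F) (hRF : Compatible R F)
    (hM : scal A R * mstring F M 2 = mstring F M 2 * scal A R) : ∀ {i : ℕ}, i + 1 < n →
    Commute (scal A (legT n i R)) (mcopyT F M n i * mcopyT F M n (i + 1))
  | 0, hi => by
    have h : Commute (scal A (legT 2 0 R)) (mstring F M 2) := by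
      rw [legT_two]
      exact hM
    have h2 := commute_embed (Fin.castLE_injective (show 2 ≤ n by omega)) h
    rw [← scal_embed, embed_castLE_legT _ (by omega), mstring_eq_mprod, embed_castLE_mprod _ le_rfl,
      mprod_succ, mprod_succ, mprod_zero, one_mul] at h2
    exact h2
  | i + 1, hi => by
    have ih := legT_commute_mcopyT_mul hF hRF hM (i := i) (by omega)
    have h1 := scal_legT_mul_inv (A := A) hF.isUnit (i := i) (n := n) (by omega)
    have h2 := scal_legT_mul_inv (A := A) hF.isUnit (i := i + 1) (n := n) (by omega)
    have h3 := scal_legT_inv_mul (A := A) hF.isUnit (i := i) (n := n) (by omega)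
    have h4 := scal_legT_inv_mul (A := A) hF.isUnit (i := i + 1) (n := n) (by omega)
    have c1 := legT_commute_mcopyT_of_lt (A := A) (M := M) (F := F) (n := n) (i := i + 1) (j := i)
      (by omega) F (by omega)
    have c2 := legT_commute_mcopyT_of_lt (A := A) (M := M) (F := F) (n := n) (i := i + 1) (j := i)
      (by omega) F⁻¹ (by omega)
    have hb := intertwine_legT (A := A) (n := n) (i := i) (by omega) hF.yangBaxter.symm
    have hr := intertwine_legT (A := A) (n := n) (i := i) (by omega) hRF.2
    have e : mcopyT F M n (i + 1) * mcopyT F M n (i + 1 + 1) =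
        scal A (legT n i F) * scal A (legT n (i + 1) F) *
          (mcopyT F M n i * mcopyT F M n (i + 1)) *
          (scal A (legT n (i + 1) F⁻¹) * scal A (legT n i F⁻¹)) := by
      rw [mcopyT_succ hi, mcopyT_succ (i := i) (by omega)]
      generalize scal A (legT n i F) = f at *
      generalize scal A (legT n (i + 1) F) = g at *
      generalize scal A (legT n i F⁻¹) = f' at *
      generalize scal A (legT n (i + 1) F⁻¹) = g' at *
      generalize mcopyT F M n i = w at *
      -- The Yang-Baxter equation for `F` creates `g` and `g'` next to `w`, that is, `F_{i+1}^{±1}`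
      -- next to copy `i`, with which they commute.
      have e1 : f' * g * f = g * f * g' := by
        calc f' * g * f = f' * (g * (f * g)) * g' := by
              simp only [mul_assoc]; rw [h2, mul_one]
          _ = f' * f * g * f * g' := by rw [hb]; simp only [mul_assoc]
          _ = _ := by rw [h3, one_mul]
      have e2 : f' * g' * f' = g' * f' * g' := by
        have hy : (f * g * f) * (f' * g' * f') = 1 := by
          simp only [mul_assoc]
          rw [← mul_assoc f f', h1, one_mul, ← mul_assoc g g', h2, one_mul, h1]
        have hz : (g' * f' * g') * (f * g * f) = 1 := by
          rw [← hb]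
          simp only [mul_assoc]
          rw [← mul_assoc g' g, h4, one_mul, ← mul_assoc f' f, h3, one_mul, h4]
        exact (left_inv_eq_right_inv hz hy).symm
      calc f * w * f' * (g * (f * w * f') * g') = f * w * (f' * g * f) * w * f' * g' := by
            simp only [mul_assoc]
        _ = f * (w * g) * f * (g' * w) * f' * g' := by rw [e1]; simp only [mul_assoc]
        _ = f * g * w * f * w * (g' * f' * g') := by
            rw [← c1.eq, c2.eq]; simp only [mul_assoc]
        _ = _ := by rw [← e2]; simp only [mul_assoc]
    rw [e]
    exact commute_conj hr
      (by rw [← mul_assoc, mul_assoc _ (scal A (legT n (i + 1) F)), h2, mul_one, h1])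
      (by rw [← mul_assoc, mul_assoc _ (scal A (legT n i F⁻¹)), h3, mul_one, h4]) ih

/-- The operators `R_i` commute with the string of the matrix copies. -/
theorem legT_commute_mstring (hF : IsRMatrix F) (hRF : Compatible R F)
    (hM : scal A R * mstring F M 2 = mstring F M 2 * scal A R) {i : ℕ} (hi : i + 1 < n) :
    Commute (scal A (legT n i R)) (mstring F M n) := by
  have h1 : ∀ b ≤ i, Commute (scal A (legT n i R)) (mprod F M n 0 b) := by
    intro b hb
    induction b with
    | zero => exact Commute.one_right _
    | succ b ih =>
      rw [mprod_succ, zero_add]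
      exact (ih (by omega)).mul_right (legT_commute_mcopyT_of_lt hi R (by omega))
  rw [mstring_eq_mprod]
  suffices ∀ b, i + 2 ≤ b → b ≤ n → Commute (scal A (legT n i R)) (mprod F M n 0 b) from
    this n (by omega) le_rfl
  intro b hb
  induction b, hb using Nat.le_induction with
  | base =>
    intro _
    rw [mprod_succ, mprod_succ, mul_assoc, zero_add, zero_add]
    exact (h1 i le_rfl).mul_right (legT_commute_mcopyT_mul hF hRF hM hi)
  | succ b hb ih =>
    intro hbn
    rw [mprod_succ, zero_add]
    exact (ih (by omega)).mul_right (legT_commute_mcopyT_of_gt hF.isUnit hRF hb (by omega))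

end Copies

/-! ### Partial traces -/

section PartialTrace

variable {N k l m n : ℕ} {A : Type*} [Ring A] [Algebra ℂ A] {D : Matrix (Fin N) (Fin N) ℂ}

/-- The multi-index `i` extended by `a`. -/
abbrev snocIdx (i : Fin n → Fin N) (a : Fin N) : Fin (n + 1) → Fin N :=
  Fin.snoc (α := fun _ => Fin N) i a

theorem snocIdx_comp_castSucc (i : Fin n → Fin N) (a : Fin N) : snocIdx i a ∘ Fin.castSucc = i := by
  funext s; simp [snocIdx]

theorem sum_snocIdx {β : Type*} [AddCommMonoid β] (f : (Fin (n + 1) → Fin N) → β) :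
    ∑ i, f i = ∑ i, ∑ a, f (snocIdx i a) := by
  rw [← (Fin.snocEquiv fun _ => Fin N).sum_comp f, Fintype.sum_prod_type_right]
  rfl

/-- The trace of `D_{n+1} X` over the last tensor factor. -/
def ptr (D : Matrix (Fin N) (Fin N) ℂ) (X : Op N (n + 1) A) : Op N n A :=
  Matrix.of fun i j => ∑ a, ∑ b, D a b • X (snocIdx i b) (snocIdx j a)

/-- The trace of `D^{⊗n} X`. -/
def dTrace (D : Matrix (Fin N) (Fin N) ℂ) (X : Op N n A) : A :=
  ∑ i : Fin n → Fin N, ∑ j : Fin n → Fin N, (∏ k, D (i k) (j k)) • X j i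

theorem dTrace_ptr (X : Op N (n + 1) A) : dTrace D (ptr D X) = dTrace D X := by
  rw [dTrace, dTrace, sum_snocIdx]
  simp only [sum_snocIdx (n := n)]
  refine Finset.sum_congr rfl fun i _ => ?_
  rw [Finset.sum_comm]
  refine Finset.sum_congr rfl fun j _ => ?_
  simp only [ptr, Matrix.of_apply, Finset.smul_sum, smul_smul, Fin.prod_univ_castSucc,
    Fin.snoc_castSucc, Fin.snoc_last]

theorem embed_castSucc_apply (Y : Op N n A) (i j : Fin n → Fin N) (a b : Fin N) :
    embed Fin.castSucc Y (snocIdx i a) (snocIdx j b) = if a = b then Y i j else 0 := by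
  rw [embed, Matrix.of_apply, snocIdx_comp_castSucc, snocIdx_comp_castSucc]
  congr 1
  refine propext ⟨fun h => ?_, ?_⟩
  · have := h (Fin.last n) (by simp)
    simpa [snocIdx] using this
  · rintro rfl s hs
    induction s using Fin.lastCases with
    | last => simp [snocIdx]
    | cast s => exact absurd ⟨s, rfl⟩ hs

theorem ptr_embed_mul (Y : Op N n A) (X : Op N (n + 1) A) :
    ptr D (embed Fin.castSucc Y * X) = Y * ptr D X := by
  ext i j
  simp only [ptr, Matrix.of_apply, Matrix.mul_apply, sum_snocIdx (n := n), embed_castSucc_apply,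
    ite_mul, zero_mul, Finset.sum_ite_eq, Finset.mem_univ, if_true, Finset.mul_sum,
    Finset.smul_sum, mul_smul_comm]
  rw [Finset.sum_comm (s := (Finset.univ : Finset (Fin n → Fin N)))]
  refine Finset.sum_congr rfl fun a _ => Finset.sum_comm

theorem ptr_mul_embed (Y : Op N n A) (X : Op N (n + 1) A) :
    ptr D (X * embed Fin.castSucc Y) = ptr D X * Y := by
  ext i j
  simp only [ptr, Matrix.of_apply, Matrix.mul_apply, sum_snocIdx (n := n), embed_castSucc_apply,
    mul_ite, mul_zero, Finset.sum_ite_eq', Finset.mem_univ, if_true, Finset.sum_mul,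
    Finset.smul_sum, smul_mul_assoc]
  rw [Finset.sum_comm (s := (Finset.univ : Finset (Fin n → Fin N)))]
  refine Finset.sum_congr rfl fun a _ => Finset.sum_comm

theorem leg_last_apply (X : Op N 2 ℂ) (i j : Fin n → Fin N) (x y c d : Fin N) :
    legT (n + 2) n X (snocIdx (snocIdx i x) y) (snocIdx (snocIdx j c) d) =
      if i = j then X ![x, y] ![c, d] else 0 := by
  classical
  rw [legT_of_lt (by omega)]
  change embed _ X _ _ = _
  have hp : ∀ (i : Fin n → Fin N) (x y : Fin N),
      snocIdx (snocIdx i x) y ∘ pos (n + 2) n (by omega) = ![x, y] := by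
    intro i x y
    funext a
    fin_cases a
    · have : pos (n + 2) n (by omega) 0 = (Fin.last n).castSucc := rfl
      simp [this, snocIdx]
    · have : pos (n + 2) n (by omega) 1 = Fin.last (n + 1) := rfl
      simp [this, snocIdx]
  rw [embed, Matrix.of_apply, hp, hp]
  congr 1
  refine propext ⟨fun h => ?_, ?_⟩
  · funext s
    have := h s.castSucc.castSucc (by
      rintro ⟨a, ha⟩
      have := congrArg Fin.val ha
      have hs := s.isLt
      fin_cases a <;> simp [pos] at this <;> omega)
    simpa [snocIdx] using this
  · rintro rfl s hs
    induction s using Fin.lastCases with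
    | last => exact absurd ⟨1, rfl⟩ hs
    | cast s =>
      induction s using Fin.lastCases with
      | last => exact absurd ⟨0, rfl⟩ hs
      | cast s => simp [snocIdx]

/-- The coefficients of the map `E ↦ tr_(2) D_2 F_{12} E_1 G_{12}`. -/
def theta (D : Matrix (Fin N) (Fin N) ℂ) (F G : Op N 2 ℂ) (x y c e : Fin N) : ℂ :=
  ∑ a, ∑ b, ∑ d, D a b * F ![x, b] ![c, d] * G ![e, d] ![y, a]

theorem scal_leg_mul_apply (X : Op N 2 ℂ) (Z : Op N (n + 2) A) (i : Fin n → Fin N) (x y : Fin N)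
    (J : Fin (n + 2) → Fin N) : (scal A (legT (n + 2) n X) * Z) (snocIdx (snocIdx i x) y) J =
      ∑ c, ∑ d, X ![x, y] ![c, d] • Z (snocIdx (snocIdx i c) d) J := by
  rw [Matrix.mul_apply, sum_snocIdx, sum_snocIdx]
  simp only [scal_apply, leg_last_apply, ← Algebra.smul_def]
  rw [Finset.sum_eq_single i]
  · simp
  · intro j _ hj
    simp [hj.symm]
  · simp

theorem mul_scal_leg_apply (X : Op N 2 ℂ) (Z : Op N (n + 2) A) (i : Fin n → Fin N) (x y : Fin N)
    (J : Fin (n + 2) → Fin N) : (Z * scal A (legT (n + 2) n X)) J (snocIdx (snocIdx i x) y) =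
      ∑ c, ∑ d, X ![c, d] ![x, y] • Z J (snocIdx (snocIdx i c) d) := by
  rw [Matrix.mul_apply, sum_snocIdx, sum_snocIdx]
  simp only [scal_apply, leg_last_apply, ← Algebra.commutes, ← Algebra.smul_def]
  rw [Finset.sum_eq_single i]
  · simp
  · intro j _ hj
    simp [hj]
  · simp

theorem sum_comm₅ {α β : Type*} [Fintype α] [AddCommMonoid β] (f : α → α → α → α → α → β) :
    ∑ a, ∑ b, ∑ e, ∑ d, ∑ c, f a b e d c = ∑ c, ∑ e, ∑ a, ∑ b, ∑ d, f a b e d c := by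
  calc _ = ∑ a, ∑ b, ∑ c, ∑ e, ∑ d, f a b e d c :=
        Finset.sum_congr rfl fun a _ => Finset.sum_congr rfl fun b _ =>
          (Finset.sum_congr rfl fun e _ => Finset.sum_comm).trans Finset.sum_comm
    _ = ∑ c, ∑ a, ∑ b, ∑ e, ∑ d, f a b e d c :=
        (Finset.sum_congr rfl fun a _ => Finset.sum_comm).trans Finset.sum_comm
    _ = _ := Finset.sum_congr rfl fun c _ =>
        (Finset.sum_congr rfl fun a _ => Finset.sum_comm).trans Finset.sum_comm

/-- The numerical operators give complex coefficients `theta`, so behaviour of partial traces under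
conjugation becomes a question independent of `A` and `W`. -/
theorem ptr_conj_apply (F G : Op N 2 ℂ) (W : Op N (n + 1) A) (i j : Fin n → Fin N) (x y : Fin N) :
    ptr D (scal A (legT (n + 2) n F) * embed Fin.castSucc W * scal A (legT (n + 2) n G))
      (snocIdx i x) (snocIdx j y) = ∑ c, ∑ e, theta D F G x y c e • W (snocIdx i c) (snocIdx j e) := by
  simp only [ptr, Matrix.of_apply, mul_scal_leg_apply, scal_leg_mul_apply, embed_castSucc_apply,
    theta, Finset.sum_smul, Finset.smul_sum, smul_ite, smul_zero, Finset.sum_ite_eq',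
    Finset.mem_univ, if_true, smul_smul]
  rw [sum_comm₅]
  refine Finset.sum_congr rfl fun c _ => Finset.sum_congr rfl fun e _ =>
    Finset.sum_congr rfl fun a _ => Finset.sum_congr rfl fun b _ => Finset.sum_congr rfl fun d _ => ?_
  congr 1
  ring

end PartialTrace

/-! ### Properties of the matrix `D_R` -/

section MatD

variable {N k n : ℕ} {R F G : Op N 2 ℂ} {D : Matrix (Fin N) (Fin N) ℂ}

theorem scal_self (X : Op N n ℂ) : scal ℂ X = X := rfl

theorem sum_comm₄ {α β : Type*} [Fintype α] [AddCommMonoid β] (f : α → α → α → α → β) :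
    ∑ a, ∑ b, ∑ c, ∑ d, f a b c d = ∑ c, ∑ d, ∑ a, ∑ b, f a b c d :=
  calc _ = ∑ c, ∑ a, ∑ b, ∑ d, f a b c d :=
        (Finset.sum_congr rfl fun _ _ => Finset.sum_comm).trans Finset.sum_comm
    _ = _ := Finset.sum_congr rfl fun _ _ =>
        (Finset.sum_congr rfl fun _ _ => Finset.sum_comm).trans Finset.sum_comm

theorem sum_comm_two_three {α β : Type*} [Fintype α] [AddCommMonoid β]
    (f : α → α → α → α → α → β) :
    ∑ c, ∑ x, ∑ a, ∑ b, ∑ d, f c x a b d = ∑ a, ∑ b, ∑ d, ∑ c, ∑ x, f c x a b d :=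
  (sum_comm₄ fun c x a b => ∑ d, f c x a b d).trans
    (Finset.sum_congr rfl fun _ _ => Finset.sum_congr rfl fun _ _ =>
      (Finset.sum_congr rfl fun _ _ => Finset.sum_comm).trans Finset.sum_comm)

/-- Trace the identity `tr_(2) R_{12} Ψ_{23} = P_{13}` over the third factor: `Ψ` becomes `D_R` and
`P` becomes the identity. -/
theorem sum_matD_mul (hs : SkewInvertible R) (x y : Fin N) :
    ∑ a, ∑ b, matD R a b * R ![x, b] ![y, a] = if x = y then 1 else 0 := by
  have h : ∀ c, _ := fun c => (skewInv_spec hs).1 x c y c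
  have h2 := Finset.sum_congr (rfl : (Finset.univ : Finset (Fin N)) = _) fun c _ => h c
  have h3 : ∑ c, (if x = c ∧ c = y then (1 : ℂ) else 0) = if x = y then 1 else 0 := by
    simp only [ite_and, Finset.sum_ite_eq, Finset.mem_univ, if_true]
  rw [h3] at h2
  rw [← h2]
  simp only [matD, Matrix.of_apply, Finset.sum_mul]
  exact ((Finset.sum_congr rfl fun _ _ => Finset.sum_comm).trans Finset.sum_comm).trans
    (Finset.sum_congr rfl fun c _ => Finset.sum_comm.trans
      (Finset.sum_congr rfl fun a _ => Finset.sum_congr rfl fun b _ => mul_comm _ _))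

/-- Contracting once more with the skew inverse recovers `T`. -/
theorem eq_zero_of_sum_mul (hs : SkewInvertible R) {T : Fin N → Fin N → ℂ}
    (h : ∀ i j, ∑ c, ∑ e, T c e * R ![i, c] ![j, e] = 0) (c e : Fin N) : T c e = 0 := by
  have h2 : ∑ a, ∑ b, skewInv R ![e, a] ![c, b] * ∑ c', ∑ e', T c' e' * R ![b, c'] ![a, e'] = 0 := by
    simp [h]
  have h3 : ∑ a, ∑ b, skewInv R ![e, a] ![c, b] * ∑ c', ∑ e', T c' e' * R ![b, c'] ![a, e'] =
      ∑ c', ∑ e', T c' e' * ∑ a, ∑ b, skewInv R ![e, a] ![c, b] * R ![b, c'] ![a, e'] := by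
    simp only [Finset.mul_sum]
    rw [sum_comm₄]
    exact Finset.sum_congr rfl fun c _ => Finset.sum_congr rfl fun e _ =>
      Finset.sum_congr rfl fun a _ => Finset.sum_congr rfl fun b _ => mul_left_comm _ _ _
  simp only [h3, (skewInv_spec hs).2, ite_and, mul_ite, mul_one, mul_zero, Finset.sum_ite_eq,
    Finset.sum_ite_eq', Finset.mem_univ, if_true] at h2
  exact h2

theorem ptr_legT (hs : SkewInvertible R) : ptr (matD R) (legT (n + 2) n R) = 1 := by
  have key : ∀ (i j : Fin n → Fin N) (x y : Fin N), ptr (matD R) (legT (n + 2) n R)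
      (snocIdx i x) (snocIdx j y) = (1 : Op N (n + 1) ℂ) (snocIdx i x) (snocIdx j y) := by
    intro i j x y
    simp only [ptr, Matrix.of_apply, leg_last_apply, Matrix.one_apply, smul_eq_mul, mul_ite,
      mul_zero]
    by_cases h : i = j
    · subst h
      simp only [if_true]
      rw [sum_matD_mul hs]
      simp [snocIdx]
    · simp [h, snocIdx]
  ext i j
  rw [← Fin.snoc_init_self i, ← Fin.snoc_init_self j]
  exact key _ _ _ _

/-- By `eq_zero_of_sum_mul` it suffices to test on `W = R`. There the partial trace of `F_2 R_1 G_2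
= G_1 R_2 F_1` is `G_1 (tr D R_2) F_1 = G_1 F_1 = 1`, and `D_R` gives the same answer by
`sum_matD_mul`. -/
theorem theta_eq (hs : SkewInvertible R) (hGF : G * F = 1)
    (h : leg₂ F * leg₁ R * leg₂ G = leg₁ G * leg₂ R * leg₁ F) (x y c e : Fin N) :
    theta (matD R) F G x y c e = if x = y then matD R e c else 0 := by
  have h' := (legT_relation (n := 3) (i := 0) (by omega)).2 h
  have h1 : ptr (matD R) (legT 3 1 F * legT 3 0 R * legT 3 1 G) = 1 := by
    rw [h', ← embed_castSucc_legT (m := 2) (by omega) G,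
      ← embed_castSucc_legT (m := 2) (by omega) F, ptr_mul_embed, ptr_embed_mul, ptr_legT hs,
      mul_one, ← legT_mul, hGF, legT_one (by omega)]
  have h2 : ∀ (i j : Fin N), ∑ c, ∑ e, theta (matD R) F G x y c e * R ![i, c] ![j, e] =
      if i = j ∧ x = y then 1 else 0 := by
    intro i j
    have e1 := ptr_conj_apply (A := ℂ) (D := matD R) F G R ![i] ![j] x y
    rw [scal_self, scal_self] at e1
    have e3 : embed Fin.castSucc R = legT 3 0 R := by
      conv_lhs => rw [← legT_two R]
      exact embed_castSucc_legT (by omega) R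
    rw [e3, h1] at e1
    have e2 : ∀ i c : Fin N, snocIdx ![i] c = ![i, c] := by
      intro i c; funext a; fin_cases a <;> rfl
    simp only [e2, smul_eq_mul] at e1
    rw [← e1]
    simp [Matrix.one_apply]
  have h3 := eq_zero_of_sum_mul hs
    (T := fun c e => theta (matD R) F G x y c e - if x = y then matD R e c else 0) (by
      intro i j
      simp only [sub_mul, Finset.sum_sub_distrib, h2]
      by_cases hxy : x = y
      · simp only [hxy, and_true, if_true]
        rw [Finset.sum_comm, sum_matD_mul hs, sub_self]
      · simp [hxy]) c e
  exact sub_eq_zero.1 h3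

/-- `D^{⊗n}`. -/
def dMat (D : Matrix (Fin N) (Fin N) ℂ) (n : ℕ) : Op N n ℂ :=
  Matrix.of fun i j => ∏ k, D (i k) (j k)

theorem dTrace_eq_trace {A : Type*} [Ring A] [Algebra ℂ A] (X : Op N n A) :
    dTrace D X = (scal A (dMat D n) * X).trace := by
  simp only [dTrace, Matrix.trace, Matrix.diag, Matrix.mul_apply, scal_apply, dMat,
    Matrix.of_apply, Algebra.smul_def]

theorem trace_scal_mul_comm {A : Type*} [Ring A] [Algebra ℂ A] (X : Op N n ℂ) (Y : Op N n A) :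
    (scal A X * Y).trace = (Y * scal A X).trace := by
  simp only [Matrix.trace, Matrix.diag, Matrix.mul_apply, scal_apply]
  rw [Finset.sum_comm]
  exact Finset.sum_congr rfl fun i _ => Finset.sum_congr rfl fun j _ => Algebra.commutes _ _

theorem sum_fin_two (f : (Fin 2 → Fin N) → ℂ) : ∑ i, f i = ∑ a, ∑ b, f ![a, b] := by
  rw [← (finTwoArrowEquiv (Fin N)).symm.sum_comp, Fintype.sum_prod_type]
  rfl

/-- Contracting the two `theta` formulas with the skew inverse `Ψ` rewrites `V D_2` as `D_1 Ψ_{21}`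
and `D_2 V` as `Ψ_{21} D_1`, up to the ordering of indices (`z1`, `z2`). Both `D_1 D_2 V` and `V D_1
D_2` then become `D_1 Ψ_{21} D_1`. -/
theorem dMat_two_commute_inv {V : Op N 2 ℂ} (hs : SkewInvertible R)
    (h1 : ∀ x y c e, theta (matD R) R V x y c e = if x = y then matD R e c else 0)
    (h2 : ∀ x y c e, theta (matD R) V R x y c e = if x = y then matD R e c else 0) :
    Commute (dMat (matD R) 2) V := by
  have z1 : ∀ p d y b, ∑ a, V ![p, d] ![y, a] * matD R a b =
      ∑ m, matD R p m * skewInv R ![d, m] ![b, y] := by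
    intro e u y w
    have e1 : ∑ c, ∑ x, skewInv R ![u, c] ![w, x] * theta (matD R) R V x y c e =
        ∑ a, ∑ b, ∑ d, matD R a b * V ![e, d] ![y, a] *
          ∑ c, ∑ x, skewInv R ![u, c] ![w, x] * R ![x, b] ![c, d] := by
      simp only [theta, Finset.mul_sum]
      rw [sum_comm_two_three]
      refine Finset.sum_congr rfl fun a _ => Finset.sum_congr rfl fun b _ =>
        Finset.sum_congr rfl fun d _ => Finset.sum_congr rfl fun c _ =>
          Finset.sum_congr rfl fun x _ => by ring
    simp only [h1, (skewInv_spec hs).2, ite_and, mul_ite, mul_one, mul_zero, Finset.sum_ite_eq,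
      Finset.sum_ite_eq', Finset.mem_univ, if_true] at e1
    simp only [mul_comm (matD R e _), e1]
    exact Finset.sum_congr rfl fun _ _ => mul_comm _ _
  have z2 : ∀ a x c d, ∑ b, matD R a b * V ![x, b] ![c, d] =
      ∑ m, skewInv R ![a, x] ![d, m] * matD R m c := by
    intro u x c w
    have e1 : ∑ e, ∑ y, skewInv R ![u, y] ![w, e] * theta (matD R) V R x y c e =
        ∑ a, ∑ b, ∑ d, matD R a b * V ![x, b] ![c, d] *
          ∑ y, ∑ e, skewInv R ![u, y] ![w, e] * R ![e, d] ![y, a] := by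
      simp only [theta, Finset.mul_sum]
      rw [Finset.sum_comm, sum_comm_two_three]
      refine Finset.sum_congr rfl fun a _ => Finset.sum_congr rfl fun b _ =>
        Finset.sum_congr rfl fun d _ => Finset.sum_congr rfl fun c _ =>
          Finset.sum_congr rfl fun x _ => by ring
    simp only [h2, (skewInv_spec hs).2, ite_and, mul_ite, mul_one, mul_zero, Finset.sum_ite_eq,
      Finset.sum_ite_eq', Finset.mem_univ, if_true, Finset.sum_ite_irrel,
      Finset.sum_const_zero] at e1
    exact e1.symm
  rw [Commute, SemiconjBy]
  ext i j
  have hi : ∀ i : Fin 2 → Fin N, i = ![i 0, i 1] := by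
    intro i; funext a; fin_cases a <;> rfl
  rw [hi i, hi j]
  simp only [Matrix.mul_apply, sum_fin_two, dMat, Matrix.of_apply, Fin.prod_univ_two,
    Matrix.cons_val_zero, Matrix.cons_val_one]
  have l : ∀ k, ∑ b, matD R (i 0) k * matD R (i 1) b * V ![k, b] ![j 0, j 1] =
      ∑ m, matD R (i 0) k * skewInv R ![i 1, k] ![j 1, m] * matD R m (j 0) := by
    intro k
    simp only [mul_assoc, ← Finset.mul_sum, z2]
  have r : ∀ k, ∑ b, V ![i 0, i 1] ![k, b] * (matD R k (j 0) * matD R b (j 1)) =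
      ∑ m, matD R (i 0) m * skewInv R ![i 1, m] ![j 1, k] * matD R k (j 0) := by
    intro k
    simp only [mul_comm (matD R k (j 0)), ← mul_assoc, ← Finset.sum_mul, z1]
  simp only [l, r]
  exact Finset.sum_comm

theorem dMat_commute_embed {X : Op N k ℂ} {e : Fin k → Fin n} (he : e.Injective)
    (h : Commute (dMat D k) X) : Commute (dMat D n) (embed e X) := by
  classical
  have hprod : ∀ g : Fin n → ℂ, ∏ s, g s =
      (∏ s ∈ Finset.univ.filter (· ∉ Set.range e), g s) * ∏ a, g (e a) := by
    intro g
    rw [← Finset.prod_filter_mul_prod_filter_not Finset.univ (· ∉ Set.range e)]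
    congr 1
    have : Finset.univ.filter (fun s => ¬s ∉ Set.range e) = Finset.univ.map ⟨e, he⟩ := by
      ext s
      simp
    rw [this, Finset.prod_map]
    rfl
  have hl : ∀ i j, (dMat D n * embed e X) i j =
      (∏ s ∈ Finset.univ.filter (· ∉ Set.range e), D (i s) (j s)) *
        (dMat D k * X) (i ∘ e) (j ∘ e) := by
    intro i j
    rw [Matrix.mul_apply, Matrix.mul_apply, Finset.mul_sum]
    symm
    refine Finset.sum_of_injOn (fun l => Function.extend e l j) ?_ ?_ ?_ ?_
    · intro l _ l' _ hl
      funext t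
      simpa [he.extend_apply] using congrFun hl (e t)
    · intro _ _; simp
    · intro m _ hm
      rw [embed, Matrix.of_apply, if_neg, mul_zero]
      intro h1
      apply hm
      refine ⟨m ∘ e, by simp, ?_⟩
      funext s
      by_cases h3 : s ∈ Set.range e
      · obtain ⟨t, rfl⟩ := h3
        simp [he.extend_apply]
      · dsimp only
        rw [Function.extend_apply' _ _ _ h3]
        exact (h1 s h3).symm
    · intro l _
      have h2 : (Function.extend e l j) ∘ e = l := by
        funext t; simp [he.extend_apply]
      rw [embed, Matrix.of_apply, if_pos, h2, dMat, dMat, Matrix.of_apply, Matrix.of_apply, hprod,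
        mul_assoc]
      · congr 1
        · refine Finset.prod_congr rfl fun s hs => ?_
          rw [Function.extend_apply' _ _ _ (by simpa using hs)]
        · simp [he.extend_apply]
      · intro s hs
        rw [Function.extend_apply' _ _ _ hs]
  have hr : ∀ i j, (embed e X * dMat D n) i j =
      (∏ s ∈ Finset.univ.filter (· ∉ Set.range e), D (i s) (j s)) *
        (X * dMat D k) (i ∘ e) (j ∘ e) := by
    intro i j
    rw [Matrix.mul_apply, Matrix.mul_apply, Finset.mul_sum]
    symm
    refine Finset.sum_of_injOn (fun l => Function.extend e l i) ?_ ?_ ?_ ?_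
    · intro l _ l' _ hl
      funext t
      simpa [he.extend_apply] using congrFun hl (e t)
    · intro _ _; simp
    · intro m _ hm
      rw [embed, Matrix.of_apply, if_neg, zero_mul]
      intro h1
      apply hm
      refine ⟨m ∘ e, by simp, ?_⟩
      funext s
      by_cases h3 : s ∈ Set.range e
      · obtain ⟨t, rfl⟩ := h3
        simp [he.extend_apply]
      · dsimp only
        rw [Function.extend_apply' _ _ _ h3]
        exact h1 s h3
    · intro l _
      have h2 : (Function.extend e l i) ∘ e = l := by
        funext t; simp [he.extend_apply]
      rw [embed, Matrix.of_apply, if_pos, h2, dMat, dMat, Matrix.of_apply, Matrix.of_apply, hprod,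
        mul_left_comm]
      · congr 1
        congr 1
        · refine Finset.prod_congr rfl fun s hs => ?_
          rw [Function.extend_apply' _ _ _ (by simpa using hs)]
        · simp [he.extend_apply]
      · intro s hs
        rw [Function.extend_apply' _ _ _ hs]
  rw [Commute, SemiconjBy]
  ext i j
  rw [hl, hr, h.eq]

theorem IsRMatrix.mul_inv (hR : IsRMatrix R) : R * R⁻¹ = 1 :=
  Matrix.mul_nonsing_inv R ((Matrix.isUnit_iff_isUnit_det R).1 hR.isUnit)

theorem IsRMatrix.inv_mul (hR : IsRMatrix R) : R⁻¹ * R = 1 :=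
  Matrix.nonsing_inv_mul R ((Matrix.isUnit_iff_isUnit_det R).1 hR.isUnit)

theorem Compatible.conj (hF : IsRMatrix F) (h : Compatible R F) :
    leg₂ F * leg₁ R * leg₂ F⁻¹ = leg₁ F⁻¹ * leg₂ R * leg₁ F := by
  have e1 : leg₁ F⁻¹ * leg₁ F = 1 := by rw [← map_mul, hF.inv_mul, map_one]
  have e2 : leg₂ F * leg₂ F⁻¹ = 1 := by rw [← map_mul, hF.mul_inv, map_one]
  calc _ = leg₁ F⁻¹ * (leg₁ F * leg₂ F * leg₁ R) * leg₂ F⁻¹ := by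
        simp only [← mul_assoc]; rw [e1, one_mul]
    _ = _ := by rw [← h.2]; simp only [mul_assoc]; rw [e2, mul_one]

theorem Compatible.conj' (hF : IsRMatrix F) (h : Compatible R F) :
    leg₂ F⁻¹ * leg₁ R * leg₂ F = leg₁ F * leg₂ R * leg₁ F⁻¹ := by
  have e1 : leg₁ F * leg₁ F⁻¹ = 1 := by rw [← map_mul, hF.mul_inv, map_one]
  have e2 : leg₂ F⁻¹ * leg₂ F = 1 := by rw [← map_mul, hF.inv_mul, map_one]
  calc _ = leg₂ F⁻¹ * (leg₁ R * leg₂ F * leg₁ F) * leg₁ F⁻¹ := by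
        simp only [mul_assoc]; rw [e1, mul_one]
    _ = _ := by rw [h.1]; simp only [← mul_assoc]; rw [e2, one_mul]

theorem IsRMatrix.compatible_self (hR : IsRMatrix R) : Compatible R R :=
  ⟨hR.yangBaxter, hR.yangBaxter.symm⟩

/-- `R` is compatible with itself, so `theta_eq` applies to conjugation by `R` and by `R⁻¹`. This
gives commutation with `R⁻¹`, hence with `R`. -/
theorem dMat_commute_leg (hR : IsRMatrix R) (hs : SkewInvertible R) {i : ℕ} :
    Commute (dMat (matD R) n) (legT n i R) := by
  have hc := hR.compatible_self
  have h2 := dMat_two_commute_inv hs (V := R⁻¹) (theta_eq hs hR.inv_mul (hc.conj hR))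
    (theta_eq hs hR.mul_inv (hc.conj' hR))
  have h3 : Commute (dMat (matD R) 2) R := by
    have := mul_eq_of_intertwine h2.eq.symm hR.inv_mul hR.mul_inv
    exact this
  unfold legT
  split_ifs with h
  · exact dMat_commute_embed (pos_injective n i h) h3
  · exact Commute.zero_right _

theorem ptr_conj {A : Type*} [Ring A] [Algebra ℂ A] (hF : IsRMatrix F) (h : Compatible R F)
    (hs : SkewInvertible R) (W : Op N (n + 1) A) :
    ptr (matD R) (scal A (legT (n + 2) n F) * embed Fin.castSucc W * scal A (legT (n + 2) n F⁻¹)) =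
      embed Fin.castSucc (ptr (matD R) W) := by
  ext i j
  rw [← Fin.snoc_init_self i, ← Fin.snoc_init_self j]
  refine (ptr_conj_apply _ _ _ _ _ _ _).trans ?_
  refine Eq.trans ?_ (embed_castSucc_apply _ _ _ _ _).symm
  simp only [theta_eq hs hF.inv_mul (h.conj hF)]
  split_ifs
  · simp only [ptr, Matrix.of_apply]
    exact Finset.sum_comm
  · simp

end MatD

/-! ### Shifts of operators along the tensor factors -/

section Shift

variable {N k m n : ℕ} {A : Type*} [Ring A] [Algebra ℂ A] {R F : Op N 2 ℂ}
  {M : Matrix (Fin N) (Fin N) A}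

/-- `F_1 F_2 ⋯ F_n` on `V^{⊗(n+1)}`. -/
def shiftOp (F : Op N 2 ℂ) : (n : ℕ) → Op N (n + 1) ℂ
  | 0 => 1
  | n + 1 => embed Fin.castSucc (shiftOp F n) * legT (n + 2) n F

/-- `F_n⁻¹ ⋯ F_2⁻¹ F_1⁻¹` on `V^{⊗(n+1)}`. -/
def shiftInv (F : Op N 2 ℂ) : (n : ℕ) → Op N (n + 1) ℂ
  | 0 => 1
  | n + 1 => legT (n + 2) n F⁻¹ * embed Fin.castSucc (shiftInv F n)

/-- The shift `Z ↦ F_1 ⋯ F_n Z F_n⁻¹ ⋯ F_1⁻¹`. -/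
def shift (F : Op N 2 ℂ) (Z : Op N n A) : Op N (n + 1) A :=
  scal A (shiftOp F n) * embed Fin.castSucc Z * scal A (shiftInv F n)

theorem legT_mul_inv (hF : IsRMatrix F) {i : ℕ} (hi : i + 1 < n) :
    legT n i F * legT n i F⁻¹ = 1 := by
  rw [← legT_mul, hF.mul_inv, legT_one hi]

theorem legT_inv_mul (hF : IsRMatrix F) {i : ℕ} (hi : i + 1 < n) :
    legT n i F⁻¹ * legT n i F = 1 := by
  rw [← legT_mul, hF.inv_mul, legT_one hi]

theorem shiftOp_mul_inv (hF : IsRMatrix F) : ∀ n, shiftOp F n * shiftInv F n = 1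
  | 0 => mul_one _
  | n + 1 => by
    rw [shiftOp, shiftInv, mul_assoc, ← mul_assoc (legT _ _ _), legT_mul_inv hF (by omega), one_mul,
      ← embed_mul _ (Fin.castSucc_injective _), shiftOp_mul_inv hF n, embed_one]

theorem shiftInv_mul_op (hF : IsRMatrix F) : ∀ n, shiftInv F n * shiftOp F n = 1
  | 0 => mul_one _
  | n + 1 => by
    rw [shiftOp, shiftInv, mul_assoc, ← mul_assoc (embed _ _),
      ← embed_mul _ (Fin.castSucc_injective _), shiftInv_mul_op hF n, embed_one, one_mul,
      legT_inv_mul hF (by omega)]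

theorem shift_mul (hF : IsRMatrix F) (X Y : Op N n A) :
    shift F (X * Y) = shift F X * shift F Y := by
  have h : scal A (shiftInv F n) * scal A (shiftOp F n) = 1 := by
    rw [← scal_mul, shiftInv_mul_op hF, scal_one]
  rw [shift, shift, shift, embed_mul _ (Fin.castSucc_injective _)]
  simp only [mul_assoc]
  rw [← mul_assoc (scal A (shiftInv F n)), h, one_mul]

theorem scal_shift_inv (hF : IsRMatrix F) (n : ℕ) :
    scal A (shiftOp F n) * scal A (shiftInv F n) = 1 := by
  rw [← scal_mul, shiftOp_mul_inv hF, scal_one]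

theorem shift_diag (hF : IsRMatrix F) (z : A) :
    shift F (Matrix.diagonal fun _ => z : Op N n A) = Matrix.diagonal fun _ => z := by
  classical
  have h1 : embed Fin.castSucc (Matrix.diagonal fun _ => z : Op N n A) =
      Matrix.diagonal fun _ => z := by
    ext i j
    rw [← Fin.snoc_init_self i, ← Fin.snoc_init_self j]
    refine (embed_castSucc_apply _ _ _ _ _).trans ?_
    simp only [Matrix.diagonal_apply, Fin.snoc_init_self]
    by_cases h : i = j
    · simp [h]
    · rw [if_neg h]
      split_ifs with h1 h2
      · exact absurd (by rw [← Fin.snoc_init_self i, ← Fin.snoc_init_self j, h1, h2]) h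
      · rfl
      · rfl
  have h2 : ∀ X : Op N (n + 1) ℂ, scal A X * Matrix.diagonal (fun _ => z) =
      Matrix.diagonal (fun _ => z) * scal A X := by
    intro X
    ext i j
    rw [Matrix.mul_diagonal, Matrix.diagonal_mul, scal_apply, Algebra.commutes]
  rw [shift, h1, h2, mul_assoc, scal_shift_inv hF, mul_one]

theorem shift_one (hF : IsRMatrix F) : shift F (1 : Op N n A) = 1 := by
  have := shift_diag (n := n) hF (1 : A)
  rwa [Matrix.diagonal_one, Matrix.diagonal_one] at this

theorem legT_commute_embed_embed (X : Op N 2 ℂ) (Z : Op N n A) :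
    Commute (scal A (legT (n + 2) n X)) (embed Fin.castSucc (embed Fin.castSucc Z)) := by
  rw [embed_embed _ _ (Fin.castSucc_injective _), legT_of_lt (by omega)]
  refine (embed_commute_scal _ _ ((Fin.castSucc_injective _).comp (Fin.castSucc_injective _))
    (pos_injective _ n (by omega)) ?_ _ _).symm
  rw [Set.disjoint_left]
  rintro _ ⟨a, rfl⟩ ⟨b, hb⟩
  have := congrArg Fin.val hb
  have ha := a.isLt
  fin_cases b <;> simp [pos] at this <;> omega

/-- The additional last `F` acts on factors disjoint from those of `Z`, so it cancels against its
inverse. -/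
theorem shift_embed (hF : IsRMatrix F) (Z : Op N n A) :
    shift F (embed Fin.castSucc Z) = embed Fin.castSucc (shift F Z) := by
  have h := (legT_commute_embed_embed F Z).eq
  have h1 : scal A (legT (n + 2) n F) * scal A (legT (n + 2) n F⁻¹) = 1 := by
    rw [← scal_mul, legT_mul_inv hF (by omega), scal_one]
  rw [shift, shift, embed_mul _ (Fin.castSucc_injective _), embed_mul _ (Fin.castSucc_injective _),
    shiftOp, shiftInv, scal_mul, scal_mul, ← scal_embed, ← scal_embed, mul_assoc (scal A _), h]
  simp only [mul_assoc]
  rw [← mul_assoc (scal A (legT _ _ _)), h1, one_mul]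

/-- Only the last `F` touches the traced factor, and `ptr_conj` removes it; the others come out of
the partial trace. -/
theorem ptr_shift (hF : IsRMatrix F) (h : Compatible R F) (hs : SkewInvertible R)
    (Z : Op N (n + 1) A) : ptr (matD R) (shift F Z) = shift F (ptr (matD R) Z) := by
  rw [shift, shift, ← ptr_conj hF h hs, ← ptr_embed_mul, ← ptr_mul_embed, shiftOp, shiftInv,
    scal_mul, scal_mul, scal_embed, scal_embed]
  simp only [mul_assoc]

/-- By `shift_embed`, `X` may be assumed to act in the last two factors. There `hX` moves it one
step past the last two `F`'s, and the earlier `F`'s commute with the result. -/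
theorem shift_legT (hF : IsRMatrix F) {X : Op N 2 ℂ}
    (hX : leg₂ X * leg₁ F * leg₂ F = leg₁ F * leg₂ F * leg₁ X) : ∀ {n i : ℕ}, i + 1 < n →
    shift F (scal A (legT n i X)) = scal A (legT (n + 1) (i + 1) X)
  | n + 1, i, hi => by
    obtain hi' | rfl : i + 1 < n ∨ n = i + 1 := by omega
    · rw [← embed_castSucc_legT hi', scal_embed, shift_embed hF, shift_legT hF hX hi',
        ← scal_embed, embed_castSucc_legT (by omega)]
    · have h := intertwine_legT (A := A) (n := i + 3) (i := i) (by omega) hX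
      have h1 := scal_legT_mul_inv (A := A) hF.isUnit (n := i + 3) (i := i) (by omega)
      have h2 := scal_legT_mul_inv (A := A) hF.isUnit (n := i + 3) (i := i + 1) (by omega)
      have hc := legT_commute_embed_embed (A := A) X (scal A (shiftOp F i))
      have h3 : (embed Fin.castSucc (embed Fin.castSucc (scal A (shiftOp F i))) *
          embed Fin.castSucc (embed Fin.castSucc (scal A (shiftInv F i))) : Op N (i + 3) A) = 1 := by
        rw [← embed_mul _ (Fin.castSucc_injective _), ← embed_mul _ (Fin.castSucc_injective _),
          scal_shift_inv hF, embed_one, embed_one]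
      rw [shift, shiftOp, shiftOp, shiftInv, shiftInv]
      simp only [scal_mul, scal_embed, embed_mul _ (Fin.castSucc_injective _)]
      simp only [← scal_embed, embed_castSucc_legT (show i + 1 < i + 2 by omega)] at hc h3 ⊢
      simp only [mul_assoc] at hc h3 h ⊢
      rw [← mul_assoc (scal A (legT (i + 3) (i + 1) F)) (scal A (legT (i + 3) i X)),
        ← mul_assoc (scal A (legT (i + 3) i F)), ← h]
      simp only [mul_assoc]
      rw [← mul_assoc (scal A (legT (i + 3) (i + 1) F)) (scal A (legT (i + 3) (i + 1) F⁻¹)), h2,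
        one_mul, ← mul_assoc (scal A (legT (i + 3) i F)) (scal A (legT (i + 3) i F⁻¹)), h1, one_mul,
        ← mul_assoc, ← hc.eq, mul_assoc, h3, mul_one]

theorem shift_mcopyT (hF : IsRMatrix F) : ∀ {n i : ℕ}, i < n →
    shift F (mcopyT F M n i) = mcopyT F M (n + 1) (i + 1)
  | 1, 0, _ => by
    rw [mcopyT_succ (by omega), ← embed_castLE_mcopyT (show 1 ≤ 2 by omega) (by omega), shift,
      shiftOp, shiftOp, shiftInv, shiftInv, embed_one, one_mul, mul_one]
    rfl
  | n + 2, 0, _ => by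
    have h1 : ∀ m i, i < m → embed Fin.castSucc (mcopyT F M m i) = mcopyT F M (m + 1) i :=
      fun m i hi => embed_castLE_mcopyT (Nat.le_succ m) hi
    rw [← h1 (n + 1) 0 (by omega), shift_embed hF, shift_mcopyT hF (by omega), h1 _ _ (by omega)]
  | n, i + 1, hi => by
    have h0 := hF.yangBaxter.symm
    have h1 : leg₂ F⁻¹ * leg₁ F * leg₂ F = leg₁ F * leg₂ F * leg₁ F⁻¹ := by
      have e1 : leg₁ F * leg₁ F⁻¹ = 1 := by rw [← map_mul, hF.mul_inv, map_one]
      have e2 : leg₂ F⁻¹ * leg₂ F = 1 := by rw [← map_mul, hF.inv_mul, map_one]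
      calc _ = leg₂ F⁻¹ * (leg₁ F * leg₂ F * leg₁ F) * leg₁ F⁻¹ := by
            simp only [mul_assoc]; rw [e1, mul_one]
        _ = _ := by rw [hF.yangBaxter]; simp only [← mul_assoc]; rw [e2, one_mul]
    rw [mcopyT_succ hi, shift_mul hF, shift_mul hF, shift_legT hF h0 hi, shift_legT hF h1 hi,
      shift_mcopyT hF (by omega), ← mcopyT_succ (by omega)]

theorem shift_mprod (hF : IsRMatrix F) {a : ℕ} : ∀ {b : ℕ}, a + b ≤ n →
    shift F (mprod F M n a b) = mprod F M (n + 1) (a + 1) b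
  | 0, _ => by rw [mprod_zero, mprod_zero, shift_one hF]
  | b + 1, h => by
    rw [mprod_succ, mprod_succ, shift_mul hF, shift_mprod hF (by omega),
      shift_mcopyT hF (by omega), show a + 1 + b = a + b + 1 by omega]

/-! ### Iterated shifts and traces over the last factors. -/

/-- The iterated shift. -/
def shiftIter (F : Op N 2 ℂ) : (k : ℕ) → Op N m A → Op N (m + k) A
  | 0, Z => Z
  | k + 1, Z => shift F (shiftIter F k Z)

theorem shiftIter_mul (hF : IsRMatrix F) (X Y : Op N m A) : ∀ k,
    shiftIter F k (X * Y) = shiftIter F k X * shiftIter F k Y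
  | 0 => rfl
  | k + 1 => by rw [shiftIter, shiftIter_mul hF X Y k, shift_mul hF]; rfl

theorem shiftIter_mstring (hF : IsRMatrix F) : ∀ k,
    shiftIter F k (mstring F M m) = mprod F M (m + k) k m
  | 0 => mstring_eq_mprod
  | k + 1 => (congrArg (shift F) (shiftIter_mstring hF k)).trans (shift_mprod hF (by omega))

/-- The partial trace of `X` over all the tensor factors but the first `k` ones is `z · 1`. -/
inductive IsTail (D : Matrix (Fin N) (Fin N) ℂ) (z : A) (k : ℕ) : (n : ℕ) → Op N n A → Prop
  | base : IsTail D z k k (Matrix.diagonal fun _ => z)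
  | step {n : ℕ} {X : Op N (n + 1) A} : IsTail D z k n (ptr D X) → IsTail D z k (n + 1) X

theorem IsTail.shift (hF : IsRMatrix F) (h : Compatible R F) (hs : SkewInvertible R) {z : A}
    {X : Op N n A} (hX : IsTail (matD R) z k n X) :
    IsTail (matD R) z (k + 1) (n + 1) (shift F X) := by
  induction hX with
  | base => rw [shift_diag hF]; exact .base
  | step _ ih => exact .step (by rwa [ptr_shift hF h hs])

theorem IsTail.dTrace (D : Matrix (Fin N) (Fin N) ℂ) (z : A) : ∀ (n : ℕ) (X : Op N n A),
    dTrace D X = z → IsTail D z 0 n X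
  | 0, X, h => by
    have : X = Matrix.diagonal fun _ => z := by
      ext i j
      obtain rfl := Subsingleton.elim i j
      rw [← h, QMat.dTrace]
      simp [Subsingleton.elim default i]
    rw [this]
    exact .base
  | n + 1, X, h => .step (IsTail.dTrace D z n _ (by rw [dTrace_ptr, h]))

theorem IsTail.le {D : Matrix (Fin N) (Fin N) ℂ} {z : A} {X : Op N n A}
    (hX : IsTail D z k n X) : k ≤ n := by
  induction hX with
  | base => exact le_rfl
  | step _ ih => omega

theorem IsTail.dTrace_mul {D : Matrix (Fin N) (Fin N) ℂ} {z : A} {X : Op N n A}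
    (hX : IsTail D z k n X) (Y : Op N k A) :
    QMat.dTrace D (embed (Fin.castLE hX.le) Y * X) = QMat.dTrace D Y * z := by
  induction hX with
  | base =>
    have : embed (Fin.castLE le_rfl) Y = Y := by
      ext i j; simp [embed, Matrix.of_apply]
    rw [this, QMat.dTrace, QMat.dTrace]
    simp only [Matrix.mul_diagonal, Finset.sum_mul, smul_mul_assoc]
  | @step n X hX ih =>
    have : embed (Fin.castLE hX.step.le) Y =
        embed Fin.castSucc (embed (Fin.castLE hX.le) Y) := by
      rw [embed_embed _ _ (Fin.castSucc_injective _)]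
      rfl
    rw [this, ← dTrace_ptr, ptr_embed_mul, ih]

theorem IsTail.shiftIter (hF : IsRMatrix F) (h : Compatible R F) (hs : SkewInvertible R)
    (Z : Op N m A) : ∀ k, IsTail (matD R) (QMat.dTrace (matD R) Z) k (m + k) (shiftIter F k Z)
  | 0 => IsTail.dTrace _ _ _ _ rfl
  | k + 1 => (IsTail.shiftIter hF h hs Z k).shift hF h hs

end Shift

/-! ### Trace functionals on Birman-Murakami-Wenzl algebras -/

section Quotient

/-- The quotient is by the radical `{x | ∀ z, f (x * z) = 0}`, two-sided because `f` is a trace; `f`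
factors through it by taking `z = 1`. -/
theorem exists_quotient_of_trace {B : Type*} [Ring B] [Algebra ℂ B] {Q : Type*} [AddCommGroup Q]
    [Module ℂ Q] (f : B →ₗ[ℂ] Q) (htr : ∀ x y, f (x * y) = f (y * x)) :
    ∃ c : RingCon B, (∀ x, (∀ z, f (x * z) = 0) → c.mkₐ ℂ x = 0) ∧
      ∃ g : c.Quotient →ₗ[ℂ] Q, ∀ x, g (c.mkₐ ℂ x) = f x := by
  let c : RingCon B :=
    { r := fun x y => ∀ z, f (x * z) = f (y * z)
      iseqv := ⟨fun _ _ => rfl, fun h z => (h z).symm, fun h h' z => (h z).trans (h' z)⟩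
      mul' := by
        intro w x y z h1 h2 t
        rw [mul_assoc, h1, htr, mul_assoc, h2, ← mul_assoc, htr, mul_assoc]
      add' := by
        intro w x y z h1 h2 t
        rw [add_mul, add_mul, map_add, map_add, h1, h2] }
  refine ⟨c, ?_, ?_⟩
  · intro x hx
    rw [← map_zero (c.mkₐ ℂ)]
    refine Quotient.sound (s := c.toSetoid) fun z => ?_
    rw [hx, zero_mul, map_zero]
  · refine ⟨{
      toFun := Quotient.lift (s := c.toSetoid) f (fun x y h => ?_)
      map_add' := ?_
      map_smul' := ?_ }, fun x => rfl⟩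
    · simpa using h 1
    · intro x y
      obtain ⟨x, rfl⟩ := c.mkₐ_surjective (α := ℂ) x
      obtain ⟨y, rfl⟩ := c.mkₐ_surjective (α := ℂ) y
      exact map_add f x y
    · intro a x
      obtain ⟨x, rfl⟩ := c.mkₐ_surjective (α := ℂ) x
      exact map_smul f a x

end Quotient

section TraceBMW

variable {B : Type*} [Ring B] [Algebra ℂ B] {q μ : ℂ} {n : ℕ} {s t e : ℕ → B}

theorem lowAlg_map {B' : Type*} [Ring B'] [Algebra ℂ B'] (φ : B →ₐ[ℂ] B') {s' : ℕ → B'} {k : ℕ}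
    (h : ∀ i, i + 1 < k → φ (s i) = s' i) : (lowAlg s k).map φ = lowAlg s' k := by
  rw [lowAlg, AlgHom.map_adjoin, lowAlg]
  congr 1
  ext x
  constructor
  · rintro ⟨_, ⟨i, hi, rfl⟩, rfl⟩
    exact ⟨i, hi, h i hi⟩
  · rintro ⟨i, hi, rfl⟩
    exact ⟨_, ⟨i, hi, rfl⟩, h i hi⟩

theorem highAlg_map {B' : Type*} [Ring B'] [Algebra ℂ B'] (φ : B →ₐ[ℂ] B') {s' : ℕ → B'} {k : ℕ}
    (h : ∀ i, i + 1 < n → φ (s i) = s' i) : (highAlg s n k).map φ = highAlg s' n k := by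
  rw [highAlg, AlgHom.map_adjoin, highAlg]
  congr 1
  ext x
  constructor
  · rintro ⟨_, ⟨i, hk, hi, rfl⟩, rfl⟩
    exact ⟨i, hk, hi, h i hi⟩
  · rintro ⟨i, hk, hi, rfl⟩
    exact ⟨_, ⟨i, hk, hi, rfl⟩, h i hi⟩

variable {Q : Type*} [AddCommGroup Q] [Module ℂ Q]

/-- For the last `e`, compute `f (e x e)` twice: it vanishes by `exists_e_mul_e` and `hK`, and by
cyclicity and `e_sq` it is `η f (e x)`. The other `e i` are conjugate to it. -/
theorem BMWSystem.trace_mul_e (h : BMWSystem q μ n s t e)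
    (hη : 1 - (μ - μ⁻¹) * (q - q⁻¹)⁻¹ ≠ 0) {f : B →ₗ[ℂ] Q}
    (htr : ∀ x ∈ lowAlg s n, ∀ y ∈ lowAlg s n, f (x * y) = f (y * x))
    (hK : ∀ k, k + 2 = n → ∀ x ∈ lowAlg s k, f (x * e k) = 0) :
    ∀ i, i + 1 < n → ∀ x ∈ lowAlg s n, f (e i * x) = 0 := by
  have base : ∀ k, k + 2 = n → ∀ x ∈ lowAlg s n, f (e k * x) = 0 := by
    rintro k rfl x hx
    have he := h.e_mem (i := k) (k := k + 2) (by omega) le_rfl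
    obtain ⟨y, hy, ey⟩ := h.exists_e_mul_e (by omega) hx
    have h1 : f (e k * x * e k) = 0 := by rw [ey, hK k rfl y hy]
    rw [htr _ (mul_mem he hx) _ he, ← mul_assoc, h.e_sq (by omega), smul_mul_assoc, map_smul] at h1
    exact (smul_eq_zero.1 h1).resolve_left hη
  intro i hi
  obtain ⟨d, hd⟩ := Nat.exists_eq_add_of_le (show i + 2 ≤ n by omega)
  induction d generalizing i with
  | zero => exact base i (by omega)
  | succ d ih =>
    intro x hx
    have hs0 := mem_lowAlg (s := s) (i := i) (k := n) (by omega)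
    have hs1 := mem_lowAlg (s := s) (i := i + 1) (k := n) (by omega)
    have ht0 := h.t_mem (i := i) (k := n) (by omega) le_rfl
    have ht1 := h.t_mem (i := i + 1) (k := n) (by omega) le_rfl
    have he := h.e_mem (i := i + 1) (k := n) (by omega) le_rfl
    have e1 : e i = t (i + 1) * t i * (e (i + 1) * (s i * s (i + 1))) := by
      rw [← h.ss_e (by omega)]
      simp only [mul_assoc]
      rw [← mul_assoc (t i), h.ts i (by omega), one_mul, ← mul_assoc, h.ts (i + 1) (by omega),
        one_mul]
    rw [e1, mul_assoc, htr _ (mul_mem ht1 ht0) _ (mul_mem (mul_mem he (mul_mem hs0 hs1)) hx)]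
    simp only [mul_assoc]
    exact ih (i + 1) (by omega) (by omega) _
      (mul_mem hs0 (mul_mem hs1 (mul_mem hx (mul_mem ht1 ht0))))

/-- A trace functional on a BMW algebra vanishes if it vanishes on the parabolic subalgebras, on the
ideal generated by `e_{n-2}` and on an (anti)symmetrizer. -/
theorem BMWSystem.trace_eq_zero (h : BMWSystem q μ n s t e) (hn : 1 ≤ n)
    (hη : 1 - (μ - μ⁻¹) * (q - q⁻¹)⁻¹ ≠ 0) {p : ℂ} (hp0 : p ≠ 0) (hpq : p - p⁻¹ = q - q⁻¹)
    (hq : ∀ k, 1 ≤ k → qNum p k ≠ 0) {f : B →ₗ[ℂ] Q}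
    (htr : ∀ x ∈ lowAlg s n, ∀ y ∈ lowAlg s n, f (x * y) = f (y * x))
    (hpar : ∀ k, 1 ≤ k → k < n → ∀ x ∈ lowAlg s k, ∀ y ∈ highAlg s n k, f (x * y) = 0)
    (hK : ∀ k, k + 2 = n → ∀ x ∈ lowAlg s k, f (x * e k) = 0)
    {X : ℕ → B} {b c d : ℕ → ℂ} (hX1 : X 1 = 1)
    (hX : ∀ i, i + 2 ≤ n →
      X (i + 2) = d i • (X (i + 1) * (1 + b i • s i + c i • e i) * X (i + 1)))
    (hd : ∀ i, d i = p ^ (i + 1) / qNum p (i + 2))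
    (hb : ∀ i, b i = -qNum p (i + 1) / p ^ (i + 1))
    (hA : f (X n) = 0) {x : B} (hx : x ∈ lowAlg s n) : f x = 0 := by
  set L := lowAlg s n with hL
  -- `f` is a trace only on `L`, so the radical must be taken inside `L`.
  let s' : ℕ → L := fun i => if hi : i + 1 < n then ⟨s i, mem_lowAlg hi⟩ else 0
  have hs' : ∀ i, i + 1 < n → L.val (s' i) = s i := fun i hi => by simp [s', hi]
  have hpL : p - p⁻¹ ≠ 0 := hpq ▸ h.q_sub_ne_zero
  obtain ⟨C, hC0, g, hg⟩ := exists_quotient_of_trace (f ∘ₗ L.val.toLinearMap)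
    (fun x y => htr _ x.2 _ y.2)
  set π := C.mkₐ ℂ with hπ
  have hsurj : Function.Surjective π := C.mkₐ_surjective
  have hπe : ∀ i (hi : i + 1 < n), π ⟨e i, h.e_mem hi le_rfl⟩ = 0 := fun i hi =>
    hC0 _ fun z => h.trace_mul_e hη htr hK i hi _ z.2
  have hH : HeckeSystem p n (fun i => π (s' i)) := by
    refine ⟨fun i hi => ?_, fun i j hij hj => ?_, fun i hi => ?_⟩
    · simp only [← map_mul]
      congr 1
      apply Subtype.ext
      simp [s', hi, show i + 1 < n by omega, h.braid i hi]
    · simp only [← map_mul]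
      congr 1
      apply Subtype.ext
      simp [s', hj, show i + 1 < n by omega, h.comm i j hij hj]
    · have e1 : s' i * s' i =
          1 + (p - p⁻¹) • (s' i - μ • (⟨e i, h.e_mem hi le_rfl⟩ : L)) := by
        apply Subtype.ext
        simp [s', hi, h.ss hi, hpq]
      rw [← map_mul, e1, map_add, map_one, map_smul, map_sub, map_smul, hπe i hi, smul_zero,
        sub_zero]
  have hlow : ∀ k, k ≤ n → ∀ y ∈ lowAlg (fun i => π (s' i)) k,
      ∃ z : L, (z : B) ∈ lowAlg s k ∧ π z = y := by
    intro k hk y hy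
    rw [← lowAlg_map π (s := s') (fun _ _ => rfl)] at hy
    obtain ⟨z, hz, rfl⟩ := hy
    refine ⟨z, ?_, rfl⟩
    rw [← lowAlg_map L.val (s := s') (fun i hi => hs' i (by omega))]
    exact ⟨z, hz, rfl⟩
  have hhigh : ∀ k, ∀ y ∈ highAlg (fun i => π (s' i)) n k,
      ∃ z : L, (z : B) ∈ highAlg s n k ∧ π z = y := by
    intro k y hy
    rw [← highAlg_map π (s := s') (fun _ _ => rfl)] at hy
    obtain ⟨z, hz, rfl⟩ := hy
    refine ⟨z, ?_, rfl⟩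
    rw [← highAlg_map L.val (s := s') (fun i hi => hs' i (by omega))]
    exact ⟨z, hz, rfl⟩
  -- The `e i` vanish in the quotient, so the coefficients `c i` disappear and the `X k` become the
  -- Hecke antisymmetrizers.
  have hXA : ∀ k, 1 ≤ k → k ≤ n →
      ∃ z : L, (z : B) = X k ∧ π z = heckeA p (fun i => π (s' i)) k := by
    intro k hk
    induction k, hk using Nat.le_induction with
    | base => exact fun _ => ⟨1, by simp [hX1], by simp [heckeA]⟩
    | succ k hk ih =>
      obtain ⟨i, rfl⟩ := Nat.exists_eq_add_of_le' hk
      intro hi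
      obtain ⟨z, hz, hz'⟩ := ih (by omega)
      refine ⟨d i • (z * (1 + b i • s' i + c i • ⟨e i, h.e_mem (by omega) le_rfl⟩) * z), ?_, ?_⟩
      · rw [hX i hi]
        simp [hz, s', show i + 1 < n by omega]
      · rw [map_smul, map_mul, map_mul, map_add, map_add, map_smul, map_smul,
          hπe i (by omega), hz', map_one, smul_zero, add_zero, heckeA]
        have hp1 := pow_ne_zero (i + 1) hp0
        have e1 : p ^ (i + 1) • (1 : C.Quotient) - qNum p (i + 1) • π (s' i) =
            p ^ (i + 1) • (1 + b i • π (s' i)) := by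
          rw [smul_add, smul_smul, hb, mul_div_cancel₀ _ hp1, neg_smul, sub_eq_add_neg]
        rw [e1, mul_smul_comm, smul_mul_assoc, smul_smul, hd, div_eq_inv_mul]
  have hgtr : ∀ x y, g (x * y) = g (y * x) := by
    intro x y
    obtain ⟨x, rfl⟩ := hsurj x
    obtain ⟨y, rfl⟩ := hsurj y
    rw [← map_mul, ← map_mul, hg, hg]
    exact htr _ x.2 _ y.2
  have hgpar : ∀ k, 1 ≤ k → k < n → ∀ x ∈ lowAlg (fun i => π (s' i)) k,
      ∀ y ∈ highAlg (fun i => π (s' i)) n k, g (x * y) = 0 := by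
    intro k hk hkn x hx y hy
    obtain ⟨x', hx', rfl⟩ := hlow k hkn.le x hx
    obtain ⟨y', hy', rfl⟩ := hhigh k y hy
    rw [← map_mul, hg]
    exact hpar k hk hkn _ hx' _ hy'
  have hgA : g (heckeA p (fun i => π (s' i)) n) = 0 := by
    obtain ⟨z, hz, hz'⟩ := hXA n hn le_rfl
    rw [← hz', hg]
    change f (z : B) = 0
    rw [hz, hA]
  have hxm : π ⟨x, hx⟩ ∈ lowAlg (fun i => π (s' i)) n := by
    rw [← lowAlg_map π (s := s') (fun _ _ => rfl)]
    refine ⟨_, ?_, rfl⟩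
    rw [hL, ← lowAlg_map L.val (s := s') (fun i hi => hs' i hi)] at hx
    obtain ⟨z, hz, hzx⟩ := hx
    have : z = ⟨x, hL ▸ hx⟩ := Subtype.ext hzx
    exact this ▸ hz
  have := hH.trace_eq_zero hn hp0 hpL hq hgtr hgpar hgA hxm
  rwa [hg] at this

end TraceBMW

/-! ### The characteristic map -/

section Char

variable {N k m n : ℕ} {q μ : ℂ} {R F : Op N 2 ℂ}

theorem IsBMWType.q_sub_ne_zero (hR : IsBMWType q μ R) : q - q⁻¹ ≠ 0 := by
  intro h
  have h1 : q * q = 1 := by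
    have := hR.q_ne_zero
    rw [sub_eq_zero] at h
    nth_rewrite 1 [h]
    exact inv_mul_cancel₀ this
  rcases mul_self_eq_one_iff.1 h1 with h | h
  exacts [hR.q_ne_one h, hR.q_ne_neg_one h]

theorem IsBMWType.eta_ne_zero (hR : IsBMWType q μ R) : eta q μ ≠ 0 := by
  have h1 : q⁻¹ + μ ≠ 0 := fun h => hR.mu_ne_neg_q_inv (by linear_combination h)
  exact div_ne_zero (mul_ne_zero (sub_ne_zero.2 hR.mu_ne_q.symm) h1)
    (mul_ne_zero hR.mu_ne_zero hR.q_sub_ne_zero)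

theorem IsBMWType.eta_eq (hR : IsBMWType q μ R) :
    1 - (μ - μ⁻¹) * (q - q⁻¹)⁻¹ = eta q μ := by
  have h0 := hR.q_sub_ne_zero
  have h1 := hR.mu_ne_zero
  have h2 : q * q⁻¹ = 1 := mul_inv_cancel₀ hR.q_ne_zero
  have h3 : μ * μ⁻¹ = 1 := mul_inv_cancel₀ h1
  have h4 : (q - q⁻¹) * (q - q⁻¹)⁻¹ = 1 := mul_inv_cancel₀ h0
  rw [eta, eq_div_iff (mul_ne_zero h1 h0)]
  linear_combination (-μ * (μ - μ⁻¹)) * h4 - h2 + h3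

/-- The operators `R_i` and `K_i` satisfy the Birman-Murakami-Wenzl relations. -/
theorem IsBMWType.bmwSystem (hR : IsBMWType q μ R) (n : ℕ) :
    BMWSystem q μ n (fun i => legT n i R) (fun i => legT n i R⁻¹)
      (fun i => legT n i (opK q μ R)) where
  q_ne_zero := hR.q_ne_zero
  mu_ne_zero := hR.mu_ne_zero
  q_sub_ne_zero := hR.q_sub_ne_zero
  braid i hi := (legT_relation hi).1 hR.yangBaxter
  comm i j hij hj := (legT_commute hij R R).eq
  st i hi := legT_mul_inv hR.toIsRMatrix hi
  ts i hi := legT_inv_mul hR.toIsRMatrix hi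
  e_def i hi := by
    simp only [legT_of_lt hi]
    rw [opK]
    simp only [map_smul, map_mul, map_sub, map_add, map_one]
  es i hi := by
    rw [← legT_mul, hR.K_mul_R, legT_of_lt hi, legT_of_lt hi, map_smul]
  ee i hi := by
    have h := (legT_relation (n := n) (i := i) hi (X := R) (Y := R) (Z := opK q μ R)
      (X' := opK q μ R) (Y' := opK q μ R) (Z' := 1)).1
      (by rw [map_one, mul_one, hR.K_two_one])
    rw [legT_one (by omega), mul_one] at h
    exact h.symm
  ee' i hi := by
    have h := (legT_relation (n := n) (i := i) hi (X := R⁻¹) (Y := R⁻¹) (Z := opK q μ R)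
      (X' := opK q μ R) (Y' := opK q μ R) (Z' := 1)).1
      (by rw [map_one, mul_one, hR.K_two_one'])
    rw [legT_one (by omega), mul_one] at h
    exact h.symm
  eee i hi := by
    have h := (legT_relation (n := n) (i := i) hi (X := opK q μ R) (Y := opK q μ R)
      (Z := opK q μ R) (X' := 1) (Y' := opK q μ R) (Z' := 1)).1
      (by rw [map_one, mul_one, one_mul, hR.K_one_two_one])
    rwa [legT_one (by omega), mul_one, one_mul] at h

/-- The shift as an algebra homomorphism. -/
def shiftHom (hF : IsRMatrix F) (n : ℕ) : Op N n ℂ →ₐ[ℂ] Op N (n + 1) ℂ :=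
  AlgHom.ofLinearMap
    { toFun := shift F
      map_add' := fun X Y => by
        rw [shift, shift, shift, embed_add, mul_add, add_mul]
      map_smul' := fun c X => by
        rw [shift, shift, embed_smul, mul_smul_comm, smul_mul_assoc]; rfl }
    (shift_one hF) (shift_mul hF)

/-- The iterated shift as an algebra homomorphism. -/
def shiftIterHom (hF : IsRMatrix F) : (k : ℕ) → Op N m ℂ →ₐ[ℂ] Op N (m + k) ℂ
  | 0 => AlgHom.id ℂ _
  | k + 1 => (shiftHom hF (m + k)).comp (shiftIterHom hF k)

theorem shiftIterHom_apply (hF : IsRMatrix F) (X : Op N m ℂ) :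
    ∀ k, shiftIterHom hF k X = shiftIter F k X
  | 0 => rfl
  | k + 1 => congrArg (shift F) (shiftIterHom_apply hF X k)

theorem scal_shiftIter {A : Type*} [Ring A] [Algebra ℂ A] (X : Op N m ℂ) :
    ∀ k, scal A (shiftIter F k X) = shiftIter F k (scal A X)
  | 0 => rfl
  | k + 1 => by
    rw [shiftIter, shiftIter, ← scal_shiftIter X k, shift, shift, scal_mul, scal_mul, scal_embed]
    rfl

theorem shiftIter_legT (hF : IsRMatrix F) {X : Op N 2 ℂ}
    (hX : leg₂ X * leg₁ F * leg₂ F = leg₁ F * leg₂ F * leg₁ X) {i : ℕ} (hi : i + 1 < m) :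
    ∀ k, shiftIter F k (legT m i X) = legT (m + k) (i + k) X
  | 0 => rfl
  | k + 1 => (congrArg (shift F) (shiftIter_legT hF hX hi k)).trans
      (shift_legT (A := ℂ) hF hX (by omega))

theorem Compatible.shift_opK (h : Compatible R F) :
    leg₂ (opK q μ R) * leg₁ F * leg₂ F = leg₁ F * leg₂ F * leg₁ (opK q μ R) := by
  have h2 := h.2
  rw [mul_assoc] at h2 ⊢
  generalize (leg₁ F : Op N 3 ℂ) * leg₂ F = w at *
  rw [opK]
  simp only [map_smul, map_mul, map_sub, map_add, map_one]
  rw [smul_mul_assoc, mul_smul_comm]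
  congr 1
  simp only [mul_add, mul_sub, add_mul, sub_mul, mul_smul_comm, smul_mul_assoc, mul_one, one_mul,
    ← mul_assoc, ← h2]
  simp only [mul_assoc, h2]
  rw [← mul_assoc (leg₂ R) w, h2, mul_assoc]

theorem map_castLE_lowAlg (h : k ≤ n) :
    (lowAlg (fun i => legT k i R) k).map (embedHom (Fin.castLE h) (Fin.castLE_injective h)) =
      lowAlg (fun i => legT n i R) k :=
  lowAlg_map _ fun _ hi => embed_castLE_legT h hi R

theorem map_shiftIterHom_lowAlg (hF : IsRMatrix F) (hRF : Compatible R F) (k : ℕ) :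
    (lowAlg (fun i => legT m i R) m).map (shiftIterHom hF k) =
      highAlg (fun i => legT (m + k) i R) (m + k) k := by
  rw [lowAlg, AlgHom.map_adjoin, highAlg]
  congr 1
  ext x
  constructor
  · rintro ⟨_, ⟨i, hi, rfl⟩, rfl⟩
    exact ⟨i + k, by omega, by omega,
      (shiftIterHom_apply hF _ k).trans (shiftIter_legT hF hRF.2 hi k)⟩
  · rintro ⟨i, hk, hi, rfl⟩
    obtain ⟨i, rfl⟩ := Nat.exists_eq_add_of_le' hk
    exact ⟨_, ⟨i, by omega, rfl⟩,
      (shiftIterHom_apply hF _ k).trans (shiftIter_legT hF hRF.2 (by omega) k)⟩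

theorem highAlg_le_lowAlg {B : Type*} [Ring B] [Algebra ℂ B] (s : ℕ → B) :
    highAlg s n k ≤ lowAlg s n :=
  Algebra.adjoin_mono fun _ ⟨i, _, hi, hx⟩ => ⟨i, hi, hx⟩

/-- `ch` as a linear map. -/
def chLin (R F : Op N 2 ℂ) (n : ℕ) : Op N n ℂ →ₗ[ℂ] QMAlg R F where
  toFun := chOp R F n
  map_add' X Y := by
    change dTrace (matD R) _ = dTrace (matD R) _ + dTrace (matD R) _
    rw [scal_add, mul_add]
    simp only [dTrace_eq_trace, mul_add, Matrix.trace_add]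
  map_smul' c X := by
    change dTrace (matD R) _ = c • dTrace (matD R) _
    rw [scal_smul, mul_smul_comm]
    simp only [dTrace_eq_trace, mul_smul_comm, Matrix.trace_smul]

theorem map_mcopy {A A' : Type*} [Ring A] [Algebra ℂ A] [Ring A'] [Algebra ℂ A'] (φ : A →ₐ[ℂ] A')
    (M : Matrix (Fin N) (Fin N) A) : ∀ (i : ℕ) (h : i < n),
    φ.mapMatrix (mcopy F M n i h) = mcopy F (M.map φ) n i h
  | 0, h => by
    ext i j
    simp only [mcopy, AlgHom.mapMatrix_apply, Matrix.map_apply, embed, Matrix.of_apply]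
    split_ifs <;> simp
  | i + 1, h => by
    have hs : ∀ X : Op N n ℂ, φ.mapMatrix (scal A X) = scal A' X := by
      intro X; ext i j; simp [scal]
    rw [mcopy, mcopy, map_mul, map_mul, map_mcopy φ M i, hs, hs]

theorem map_mstring {A A' : Type*} [Ring A] [Algebra ℂ A] [Ring A'] [Algebra ℂ A']
    (φ : A →ₐ[ℂ] A') (M : Matrix (Fin N) (Fin N) A) :
    φ.mapMatrix (mstring F M n) = mstring F (M.map φ) n := by
  rw [mstring, mstring, map_list_prod, List.map_ofFn]
  congr 2
  funext i
  exact map_mcopy φ M i i.isLt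

/-- The defining relation of the quantum matrix algebra. -/
theorem scal_mul_mstring_two : scal (QMAlg R F) R * mstring F (genM R F) 2 =
    mstring F (genM R F) 2 * scal (QMAlg R F) R := by
  have hs : (RingQuot.mkAlgHom ℂ (QMRel R F)).mapMatrix (scal _ R) = scal (QMAlg R F) R := by
    ext i j; simp [scal]
  rw [genM, ← map_mstring, ← hs, ← map_mul, ← map_mul]
  ext i j
  exact RingQuot.mkAlgHom_rel ℂ (QMRel.entry i j)

theorem commute_mstring (hF : IsRMatrix F) (hRF : Compatible R F) {X : Op N n ℂ}
    (hX : X ∈ lowAlg (fun i => legT n i R) n) :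
    Commute (scal (QMAlg R F) X) (mstring F (genM R F) n) := by
  induction hX using Algebra.adjoin_induction with
  | mem x hx =>
    obtain ⟨i, hi, rfl⟩ := hx
    exact legT_commute_mstring hF hRF scal_mul_mstring_two hi
  | algebraMap c =>
    rw [Algebra.algebraMap_eq_smul_one, scal_smul, scal_one]
    exact (Commute.one_left _).smul_left c
  | add x y _ _ hx hy => rw [scal_add]; exact hx.add_left hy
  | mul x y _ _ hx hy => rw [scal_mul]; exact hx.mul_left hy

/-- `X` commutes with the string and with `D_R^{⊗n}`, so it reaches the left end of the trace. Being
numerical, it can be cycled although the other entries do not commute. -/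
theorem chOp_mul_comm (hR : IsRMatrix R) (hs : SkewInvertible R) (hF : IsRMatrix F)
    (hRF : Compatible R F) {X : Op N n ℂ} (hX : X ∈ lowAlg (fun i => legT n i R) n)
    (Y : Op N n ℂ) : chOp R F n (X * Y) = chOp R F n (Y * X) := by
  have hc := (commute_mstring hF hRF hX).eq
  have hd : Commute (scal (QMAlg R F) X) (scal (QMAlg R F) (dMat (matD R) n)) :=
    commute_scal (commute_of_mem_lowAlg (fun i _ => (dMat_commute_leg hR hs).symm) hX)
  change dTrace (matD R) _ = dTrace (matD R) _
  rw [dTrace_eq_trace, dTrace_eq_trace, scal_mul, scal_mul, ← mul_assoc _ (scal _ X), ← hc,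
    mul_assoc, ← mul_assoc, ← hd.eq, mul_assoc, trace_scal_mul_comm]
  simp only [mul_assoc]

/-- `ch(α) ch(β) = ch(α β^{↑ k})`. -/
theorem chOp_mul (hs : SkewInvertible R) (hF : IsRMatrix F)
    (hRF : Compatible R F) {X : Op N k ℂ} (hX : X ∈ lowAlg (fun i => legT k i R) k)
    (Y : Op N m ℂ) : chOp R F (m + k) (embed (Fin.castLE (Nat.le_add_left k m)) X * shiftIter F k Y) =
      chOp R F k X * chOp R F m Y := by
  have hle := Nat.le_add_left k m
  have hX' : embed (Fin.castLE hle) X ∈ lowAlg (fun i => legT (m + k) i R) (m + k) := by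
    refine lowAlg_mono hle ?_
    rw [← map_castLE_lowAlg hle]
    exact ⟨X, hX, rfl⟩
  change dTrace (matD R) _ = dTrace (matD R) _ * dTrace (matD R) _
  -- The last `m` copies form the `k`-fold shift of the string of length `m`.
  have e1 : mstring F (genM R F) (m + k) = embed (Fin.castLE hle) (mstring F (genM R F) k) *
      shiftIter F k (mstring F (genM R F) m) := by
    rw [shiftIter_mstring hF, mstring_eq_mprod, mstring_eq_mprod, embed_castLE_mprod _ le_rfl,
      ← mprod_add, Nat.add_comm k m]
  have ht := IsTail.shiftIter hF hRF hs
    (mstring F (genM R F) m * scal (QMAlg R F) Y) k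
  -- Moving `X` to the left of the string separates what acts on the first `k` factors from a
  -- shifted operator, whose trace over the remaining factors is the scalar matrix with entry
  -- `ch(Y)`.
  rw [scal_mul, ← mul_assoc, ← (commute_mstring hF hRF hX').eq, e1, scal_shiftIter,
    scal_embed, ← mul_assoc, ← embed_mul _ (Fin.castLE_injective hle), mul_assoc,
    ← shiftIter_mul hF, (commute_mstring hF hRF hX).eq]
  exact ht.dTrace_mul _

/-- The induction in `chOp_mem` reaches zero factors through `W_{n-2}` with `n = 2`. -/
theorem chOp_zero_mem (𝒜 : Subalgebra ℂ (QMAlg R F)) (X : Op N 0 ℂ) : chOp R F 0 X ∈ 𝒜 := by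
  have : chOp R F 0 X = algebraMap ℂ _ (X default default) := by
    change dTrace _ (mstring F (genM R F) 0 * _) = _
    have h1 : mstring F (genM R F) 0 = 1 := rfl
    rw [h1, one_mul, dTrace]
    simp [scal]
  rw [this]
  exact Subalgebra.algebraMap_mem _ _

/-- A subalgebra contains the image of `ch` if it contains the images of `K` and of a sequence
of (anti)symmetrizers. -/
theorem chOp_mem (hR : IsBMWType q μ R) (hs : SkewInvertible R) (hF : IsRMatrix F)
    (hRF : Compatible R F) {p : ℂ} (hp0 : p ≠ 0) (hpq : p - p⁻¹ = q - q⁻¹)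
    (hq : ∀ k, 1 ≤ k → qNum p k ≠ 0) {𝒜 : Subalgebra ℂ (QMAlg R F)}
    (hK : chOp R F 2 (opK q μ R) ∈ 𝒜) {X : (n : ℕ) → ℕ → Op N n ℂ} {b c d : ℕ → ℂ}
    (hX1 : ∀ n, 1 ≤ n → X n 1 = 1)
    (hX : ∀ n i, i + 2 ≤ n → X n (i + 2) = d i •
      (X n (i + 1) * (1 + b i • legT n i R + c i • legT n i (opK q μ R)) * X n (i + 1)))
    (hd : ∀ i, d i = p ^ (i + 1) / qNum p (i + 2))
    (hb : ∀ i, b i = -qNum p (i + 1) / p ^ (i + 1))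
    (hA : ∀ n, 1 ≤ n → chOp R F n (X n n) ∈ 𝒜) :
    ∀ n, ∀ x ∈ lowAlg (fun i => legT n i R) n, chOp R F n x ∈ 𝒜 := by
  intro n
  induction n using Nat.strong_induction_on with | _ n ih
  intro x hx
  rcases Nat.eq_zero_or_pos n with rfl | hn
  · exact chOp_zero_mem 𝒜 x
  -- `ch` modulo `𝒜`, a quotient of vector spaces only: the claim is that this trace vanishes on
  -- `W_n`.
  let f : Op N n ℂ →ₗ[ℂ] QMAlg R F ⧸ Subalgebra.toSubmodule 𝒜 :=
    (Subalgebra.toSubmodule 𝒜).mkQ ∘ₗ chLin R F n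
  have hf : ∀ x, f x = 0 ↔ chOp R F n x ∈ 𝒜 := fun x =>
    Submodule.Quotient.mk_eq_zero (Subalgebra.toSubmodule 𝒜)
  have hlow : ∀ k, k ≤ n → ∀ x ∈ lowAlg (fun i => legT n i R) k, ∀ hkn : k ≤ n,
      ∃ x' ∈ lowAlg (fun i => legT k i R) k, embed (Fin.castLE hkn) x' = x := by
    intro k _ x hx hkn
    rw [← map_castLE_lowAlg hkn] at hx
    exact hx
  refine (hf x).1 ((hR.bmwSystem n).trace_eq_zero (f := f) hn (hR.eta_eq ▸ hR.eta_ne_zero) hp0 hpq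
    hq ?_ ?_ ?_ (hX1 n hn) (hX n) hd hb ((hf _).2 (hA n hn)) hx)
  · intro x hx y _
    exact congrArg (Submodule.mkQ _) (chOp_mul_comm hR.toIsRMatrix hs hF hRF hx y)
  · intro k hk hkn x hx y hy
    obtain ⟨m, rfl⟩ := Nat.exists_eq_add_of_le' hkn.le
    obtain ⟨x, hx', rfl⟩ := hlow k hkn.le x hx (Nat.le_add_left k m)
    rw [← map_shiftIterHom_lowAlg hF hRF] at hy
    obtain ⟨y, hy, rfl⟩ := hy
    rw [hf]
    have := chOp_mul hs hF hRF hx' y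
    rw [← shiftIterHom_apply hF] at this
    refine (congrArg (· ∈ 𝒜) this).mpr (mul_mem (ih k hkn x hx') (ih m (by omega) y hy))
  · rintro k hk x hx
    obtain rfl : 2 + k = n := by omega
    obtain ⟨x, hx', rfl⟩ := hlow k (by omega) x hx (Nat.le_add_left k 2)
    rw [hf]
    -- As a shifted operator, the last `K` splits off through the product formula, giving `ch(x)
    -- ch(K)`.
    have h1 : legT (2 + k) k (opK q μ R) = shiftIter F k (opK q μ R) := by
      have := shiftIter_legT hF (hRF.shift_opK (q := q) (μ := μ)) (m := 2) (i := 0) (by omega) k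
      rwa [legT_two, zero_add, eq_comm] at this
    rw [h1, chOp_mul hs hF hRF hx']
    exact mul_mem (ih k (by omega) x hx') hK

end Char

/-! ### The characteristic subalgebra -/

section CharSub

variable {N k m n : ℕ} {q μ : ℂ} {R F : Op N 2 ℂ}

theorem IsBMWType.legT_inv_mem (hR : IsBMWType q μ R) {i : ℕ} (hi : i + 1 < n) :
    legT n i R⁻¹ ∈ lowAlg (fun i => legT n i R) n :=
  (hR.bmwSystem n).t_mem hi le_rfl

theorem IsBMWType.braidRep_mem (hR : IsBMWType q μ R) (α : Braid n) :
    (braidRep hR.toIsRMatrix n α : Op N n ℂ) ∈ lowAlg (fun i => legT n i R) n := by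
  -- Inverse generators lie in the algebra by the skein relation; carrying `α` and `α⁻¹` together
  -- makes the inverse step trivial.
  suffices ∀ α : Braid n,
      ((braidRep hR.toIsRMatrix n α : (Op N n ℂ)ˣ) : Op N n ℂ) ∈ lowAlg (fun i => legT n i R) n ∧
      ((braidRep hR.toIsRMatrix n α⁻¹ : (Op N n ℂ)ˣ) : Op N n ℂ) ∈ lowAlg (fun i => legT n i R) n
    from (this α).1
  intro α
  have hα : α ∈ Subgroup.closure (Set.range (PresentedGroup.of (rels := braidRels n))) := by
    rw [PresentedGroup.closure_range_of]; trivial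
  induction hα using Subgroup.closure_induction with
  | mem x hx =>
    obtain ⟨i, rfl⟩ := hx
    have hi : (i : ℕ) + 1 < n := by omega
    have h1 : braidRep hR.toIsRMatrix n (PresentedGroup.of i) = legUnit hR.toIsRMatrix n i :=
      braidRep_gen _ _ _
    rw [map_inv, h1, coe_legUnit, coe_legUnit_inv, ← legT_of_lt hi, ← legT_of_lt hi]
    exact ⟨mem_lowAlg (s := fun i => legT n i R) hi, hR.legT_inv_mem hi⟩
  | one => simp [one_mem]
  | mul x y _ _ hx hy =>
    rw [mul_inv_rev, map_mul, map_mul, Units.val_mul, Units.val_mul]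
    exact ⟨mul_mem hx.1 hy.1, mul_mem hy.2 hx.2⟩
  | inv x _ hx => rw [inv_inv]; exact hx.symm

theorem IsBMWType.bmwRep_mem (hR : IsBMWType q μ R) (w : BMW q μ n) :
    bmwRep hR n w ∈ lowAlg (fun i => legT n i R) n := by
  obtain ⟨w, rfl⟩ := RingQuot.mkAlgHom_surjective ℂ (BMWRel q μ n) w
  rw [bmwRep, RingQuot.liftAlgHom_mkAlgHom_apply]
  induction w using MonoidAlgebra.induction_on with
  | of α =>
    rw [groupAlgRep, MonoidAlgebra.lift_of]
    exact hR.braidRep_mem α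
  | add x y hx hy => rw [map_add]; exact add_mem hx hy
  | smul c x hx => rw [map_smul]; exact Subalgebra.smul_mem _ hx c

theorem bmwRep_sigma (hR : IsBMWType q μ R) (i : Fin (n - 1)) :
    bmwRep hR n (sigma q μ i) = legT n i R := by
  rw [sigma, bmwRep, RingQuot.liftAlgHom_mkAlgHom_apply, groupAlgRep_sigma, legT_of_lt]

theorem bmwRep_kappa (hR : IsBMWType q μ R) (i : Fin (n - 1)) :
    bmwRep hR n (kappa q μ i) = legT n i (opK q μ R) := by
  rw [kappa, bmwRep, RingQuot.liftAlgHom_mkAlgHom_apply, groupAlgRep_kappa, legT_of_lt]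

theorem bmwRep_baxter (hR : IsBMWType q μ R) (α x : ℂ) (i : Fin (n - 1)) :
    bmwRep hR n (baxter q μ α x i) = 1 + ((x - 1) / (q - q⁻¹)) • legT n i R +
      ((x - 1) / (α * x + 1)) • legT n i (opK q μ R) := by
  rw [baxter, map_add, map_add, map_one, map_smul, map_smul, bmwRep_sigma, bmwRep_kappa]

theorem chOp_mem_charSub (hR : IsRMatrix R) (hn : 1 ≤ n) {x : Op N n ℂ}
    (hx : x ∈ lowAlg (fun i => legT n i R) n) : chOp R F n x ∈ charSub hR F := by
  have h1 : lowAlg (fun i => legT n i R) n ≤ (groupAlgRep hR n).range := by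
    refine Algebra.adjoin_le ?_
    rintro _ ⟨i, hi, rfl⟩
    refine ⟨preSigma ⟨i, by omega⟩, ?_⟩
    exact (groupAlgRep_sigma hR n _).trans (legT_of_lt hi R).symm
  obtain ⟨y, rfl⟩ := h1 hx
  clear hx
  change chLin R F n (groupAlgRep hR n y) ∈ _
  induction y using MonoidAlgebra.induction_on with
  | of α =>
    rw [groupAlgRep, MonoidAlgebra.lift_of]
    exact Submodule.subset_span (Or.inr ⟨n, hn, α, rfl⟩)
  | add x y hx hy => rw [map_add, map_add]; exact add_mem hx hy
  | smul c x hx => rw [map_smul, map_smul]; exact Submodule.smul_mem _ c hx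

/-- By `chOp_mul` a product of two characters is the character of an operator that again lies in the
algebra generated by the `R_i`, since the shift raises their indices. -/
theorem charSub_mul_mem (hR : IsBMWType q μ R) (hs : SkewInvertible R) (hF : IsRMatrix F)
    (hRF : Compatible R F) {x y : QMAlg R F} (hx : x ∈ charSub hR.toIsRMatrix F)
    (hy : y ∈ charSub hR.toIsRMatrix F) : x * y ∈ charSub hR.toIsRMatrix F := by
  have h := Submodule.mul_mem_mul hx hy
  rw [charSub, Submodule.span_mul_span] at h
  refine Submodule.span_le.2 ?_ h
  rintro _ ⟨x, hx, y, hy, rfl⟩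
  dsimp only
  obtain rfl | ⟨k, hk, α, rfl⟩ := hx
  · rw [one_mul]; exact Submodule.subset_span hy
  obtain rfl | ⟨m, hm, β, rfl⟩ := hy
  · rw [mul_one]; exact Submodule.subset_span (Or.inr ⟨k, hk, α, rfl⟩)
  rw [chBraid, chBraid, ← chOp_mul hs hF hRF (hR.braidRep_mem α)]
  refine chOp_mem_charSub hR.toIsRMatrix (by omega) (mul_mem ?_ ?_)
  · refine lowAlg_mono (Nat.le_add_left k m) ?_
    rw [← map_castLE_lowAlg (Nat.le_add_left k m)]
    exact ⟨_, hR.braidRep_mem α, rfl⟩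
  · refine highAlg_le_lowAlg (k := k) _ ?_
    rw [← map_shiftIterHom_lowAlg hF hRF]
    exact ⟨_, hR.braidRep_mem β, shiftIterHom_apply hF _ k⟩

theorem adjoin_le_charSub (hR : IsBMWType q μ R) (hs : SkewInvertible R) (hF : IsRMatrix F)
    (hRF : Compatible R F) {u : ℕ → QMAlg R F}
    (hu0 : u 0 = 1) (hu : ∀ i, 1 ≤ i → ∃ w : BMW q μ i, u i = chBMW hR F w) :
    Subalgebra.toSubmodule (Algebra.adjoin ℂ ({contraction hR F} ∪ Set.range u)) ≤
      charSub hR.toIsRMatrix F := by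
  let C : Subalgebra ℂ (QMAlg R F) := (charSub hR.toIsRMatrix F).toSubalgebra
    (Submodule.subset_span (Or.inl rfl)) fun x y hx hy => charSub_mul_mem hR hs hF hRF hx hy
  suffices Algebra.adjoin ℂ ({contraction hR F} ∪ Set.range u) ≤ C from this
  refine Algebra.adjoin_le ?_
  rintro _ (rfl | ⟨i, rfl⟩)
  · exact chOp_mem_charSub (n := 2) hR.toIsRMatrix (by omega) (hR.bmwRep_mem _)
  · rcases Nat.eq_zero_or_pos i with rfl | hi
    · rw [hu0]; exact one_mem C
    · obtain ⟨w, hw⟩ := hu i hi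
      rw [hw]
      exact chOp_mem_charSub hR.toIsRMatrix hi (hR.bmwRep_mem _)

/-- Common form of both cases: `hd` and `hb` match the normalization and the `σ`-coefficient with
the Hecke antisymmetrizer of parameter `p`. The parameter `α` enters only the coefficient of `κ`,
which is immaterial. -/
theorem charSub_le (hR : IsBMWType q μ R) (hs : SkewInvertible R) (hF : IsRMatrix F)
    (hRF : Compatible R F) {p : ℂ} (hp0 : p ≠ 0) (hpq : p - p⁻¹ = q - q⁻¹)
    (hq : ∀ k, 1 ≤ k → qNum p k ≠ 0) {𝒜 : Subalgebra ℂ (QMAlg R F)}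
    (hg : contraction hR F ∈ 𝒜) {w : (n i : ℕ) → i ≤ n → BMW q μ n} {α : ℂ} {x d : ℕ → ℂ}
    (hw1 : ∀ n h, w n 1 h = 1)
    (hw : ∀ n i (h : i + 2 ≤ n), w n (i + 2) h = d i •
      (w n (i + 1) (by omega) * baxter q μ α (x i) ⟨i, by omega⟩ * w n (i + 1) (by omega)))
    (hd : ∀ i, d i = p ^ (i + 1) / qNum p (i + 2))
    (hb : ∀ i, (x i - 1) / (q - q⁻¹) = -qNum p (i + 1) / p ^ (i + 1))
    (hA : ∀ n, 1 ≤ n → chBMW hR F (w n n le_rfl) ∈ 𝒜) :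
    charSub hR.toIsRMatrix F ≤ Subalgebra.toSubmodule 𝒜 := by
  -- `g = η⁻¹ ch(κ)` and `η ≠ 0`, so `g` may be replaced by `ch(κ)`.
  have hK : chOp R F 2 (opK q μ R) ∈ 𝒜 := by
    have h1 : contraction hR F = (eta q μ)⁻¹ • chOp R F 2 (opK q μ R) := by
      rw [contraction, chBMW, contractor, map_smul, bmwRep_kappa]
      refine (map_smul (chLin R F 2) _ _).trans ?_
      rw [Fin.val_zero, legT_two]
      rfl
    have h2 := Subalgebra.smul_mem 𝒜 hg (eta q μ)
    rwa [h1, smul_smul, mul_inv_cancel₀ hR.eta_ne_zero, one_smul] at h2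
  have key := chOp_mem hR hs hF hRF hp0 hpq hq hK
    (X := fun n i => if h : i ≤ n then bmwRep hR n (w n i h) else 1)
    (b := fun i => (x i - 1) / (q - q⁻¹)) (c := fun i => (x i - 1) / (α * x i + 1)) (d := d)
    (fun n hn => by rw [dif_pos hn, hw1, map_one])
    (fun n i hi => by
      rw [dif_pos hi, dif_pos (by omega), hw, map_smul, map_mul, map_mul, bmwRep_baxter])
    hd hb (fun n hn => by rw [dif_pos le_rfl]; exact hA n hn)
  refine Submodule.span_le.2 ?_
  rintro _ (rfl | ⟨n, hn, β, rfl⟩)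
  · exact one_mem 𝒜
  · exact key n _ (hR.braidRep_mem β)

/-! ### The parameters `p = q` and `p = -q⁻¹`. -/

theorem qNum_neg_inv (k : ℕ) : qNum (-q⁻¹) (k + 1) = (-1) ^ k * qNum q (k + 1) := by
  rw [qNum, qNum, inv_neg, inv_inv, neg_pow, neg_pow q, ← mul_div_assoc]
  congr 1
  · ring
  · ring

theorem baxter_coeff_minus (hq0 : q ≠ 0) (hq : q - q⁻¹ ≠ 0) (i : ℕ) :
    ((q⁻¹) ^ (2 * (i + 1)) - 1) / (q - q⁻¹) = -qNum q (i + 1) / q ^ (i + 1) := by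
  have ha := pow_ne_zero (i + 1) hq0
  rw [qNum, pow_mul', inv_pow]
  generalize q - q⁻¹ = D at *
  generalize q ^ (i + 1) = a at *
  field_simp
  ring

theorem baxter_coeff_plus (hq0 : q ≠ 0) (hq : q - q⁻¹ ≠ 0) (i : ℕ) :
    (q ^ (2 * (i + 1)) - 1) / (q - q⁻¹) = -qNum (-q⁻¹) (i + 1) / (-q⁻¹) ^ (i + 1) := by
  have ha := pow_ne_zero (i + 1) hq0
  have he : (-1 : ℂ) ^ i ≠ 0 := pow_ne_zero i (by norm_num)
  rw [qNum_neg_inv, qNum, pow_mul', neg_pow q⁻¹, pow_succ (-1 : ℂ), inv_pow]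
  generalize (-1 : ℂ) ^ i = c at *
  generalize q - q⁻¹ = D at *
  generalize q ^ (i + 1) = a at *
  field_simp

end CharSub

end QMat

end

theorem proposition4p8 {N : ℕ} (q μ : ℂ) (R F : QMat.Op N 2 ℂ)
    (hR : QMat.IsBMWType q μ R) (hRs : QMat.StrictSkewInvertible R)
    (hF : QMat.IsRMatrix F) (hFs : QMat.StrictSkewInvertible F)
    (hRF : QMat.Compatible R F) :
    ((∀ j : ℕ, 2 ≤ j → QMat.qNum q j ≠ 0 ∧ μ ≠ -q ^ (-2 * (j : ℤ) + 3)) →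
      Subalgebra.toSubmodule (Algebra.adjoin ℂ
        ({QMat.contraction hR F} ∪ Set.range (QMat.elemA hR F))) =
        QMat.charSub hR.toIsRMatrix F) ∧
    ((∀ j : ℕ, 2 ≤ j → QMat.qNum q j ≠ 0 ∧ μ ≠ q ^ (2 * (j : ℤ) - 3)) →
      Subalgebra.toSubmodule (Algebra.adjoin ℂ
        ({QMat.contraction hR F} ∪ Set.range (QMat.elemS hR F))) =
        QMat.charSub hR.toIsRMatrix F) := by
  have hq0 := hR.q_ne_zero
  have hqq := hR.q_sub_ne_zero
  constructor
  · intro h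
    have hq : ∀ k, 1 ≤ k → QMat.qNum q k ≠ 0 := by
      intro k hk
      obtain rfl | hk := hk.eq_or_lt
      · rw [QMat.qNum_one hqq]; exact one_ne_zero
      · exact (h k hk).1
    refine le_antisymm (QMat.adjoin_le_charSub hR hRs.1 hF hRF (if_pos rfl)
      fun i hi => ⟨_, if_neg (by omega)⟩) ?_
    refine QMat.charSub_le hR hRs.1 hF hRF hq0 rfl hq (w := QMat.antisym q μ)
      (Algebra.subset_adjoin (Or.inl rfl)) (fun _ _ => rfl) (fun _ _ _ => rfl) (fun _ => rfl) ?_ ?_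
    · intro i
      exact QMat.baxter_coeff_minus hq0 hqq i
    · intro n hn
      refine Algebra.subset_adjoin (Or.inr ⟨n, if_neg (by omega)⟩)
  · intro h
    have hq : ∀ k, 1 ≤ k → QMat.qNum (-q⁻¹) k ≠ 0 := by
      intro k hk
      obtain ⟨k, rfl⟩ := Nat.exists_eq_add_of_le' hk
      rw [QMat.qNum_neg_inv]
      refine mul_ne_zero (pow_ne_zero _ (by norm_num)) ?_
      obtain rfl | hk := Nat.eq_zero_or_pos k
      · rw [QMat.qNum_one hqq]; exact one_ne_zero
      · exact (h (k + 1) (by omega)).1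
    refine le_antisymm (QMat.adjoin_le_charSub hR hRs.1 hF hRF (if_pos rfl)
      fun i hi => ⟨_, if_neg (by omega)⟩) ?_
    -- Exchanging the roles of the eigenvalues `q` and `-q⁻¹` turns symmetrizers into
    -- antisymmetrizers.
    refine QMat.charSub_le hR hRs.1 hF hRF (p := -q⁻¹) (neg_ne_zero.2 (inv_ne_zero hq0))
      (by rw [inv_neg, inv_inv]; ring) hq (w := QMat.sym q μ)
      (Algebra.subset_adjoin (Or.inl rfl)) (fun _ _ => rfl) (fun _ _ _ => rfl) ?_ ?_ ?_
    · intro i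
      -- The sign `(-1)^(i+1)` occurs in both the power and the `q`-number and cancels.
      rw [QMat.qNum_neg_inv, neg_pow, mul_div_mul_left _ _ (pow_ne_zero _ (by norm_num))]
    · intro i
      exact QMat.baxter_coeff_plus hq0 hqq i
    · intro n hn
      refine Algebra.subset_adjoin (Or.inr ⟨n, if_neg (by omega)⟩)
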